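/- **Conventions.** Let $\mathbb F$ be a field. For a finite dimensional vector space $V$ put $|V|:=\Lambda^{\dim V}(V)$; for a non-zero $v$ in a line, $v^*$ is the dual vector with $v^*(v)=1$. A *pseudo-inverse* of a linear map $A:V\to W$ is a linear map $A^\dagger:W\to V$ such that $AA^\dagger$ and $1-A^\dagger A$ are idempotents with images $\operatorname{Im}A$ and $\operatorname{Ker}A$, and $\operatorname{Im}(1-AA^\dagger)=\operatorname{Ker}A^\dagger$ (equivalently $AA^\dagger A=A$ and $A^\dagger AA^\dagger=A^\dagger$). An endomorphism $T$ is of *determinant class* if it is invertible and $1-T$ has finite rank; $\det T$ is then the determinant of $T$ restricted to a finite dimensional invariant subspace containing $\operatorname{Im}(1-T)$. **Operators.** Let $A,B:V\to W$ be linear maps with finite dimensional kernels and cokernels, with $A-B$ of finite rank, let $A^\dagger,B^\dagger$ be pseudo-inverses, and put $P_A=1-A^\dagger A$, $Q_B=1-BB^\dagger$. The maps $A,B$ have the same index $\dim\operatorname{Ker}-\dim\operatorname{Coker}$. * *Index $\le 0$.* A perturbation triple consists of linear maps $L:\operatorname{Ker}A\to W$, $M:\operatorname{Ker}B^\dagger\to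 V$, $N:\operatorname{Ker}B^\dagger\to W$ such that $\operatorname{Ker}A\xrightarrow{L}W\to\operatorname{Coker}A$ is injective, $\operatorname{Ker}B^\dagger\xrightarrow{M}V\to\operatorname{Coker}B^\dagger$ is surjective, $\operatorname{Ker}M\xrightarrow{N}W\to W/(\operatorname{Im}A+\operatorname{Im}L)$ is an isomorphism, and $N$ vanishes on a complement of $\operatorname{Ker}M$. Put $\Sigma=(A+LP_A)(B^\dagger+MQ_B)+NQ_B$, which is of determinant class, and $$P(B,A):\ s\otimes(Ls\wedge Nt_1)^*\mapsto\det(\Sigma)^{-1}\,Mt_0\otimes(t_0\wedge t_1)^*$$ for non-zero $s\in|\operatorname{Ker}A|$, $t_1\in|\operatorname{Ker}M|$, $t_0\in|\operatorname{Ker}N|$. * *Index $\ge 0$.* A perturbation triple consists of linear maps $L:\operatorname{Ker}A\to W$, $M:\operatorname{Ker}B^\dagger\to V$, $N:\operatorname{Ker}A\to V$ such that $\operatorname{Ker}A\xrightarrow{L}W\to\operatorname{Coker}A$ is surjective, $\operatorname{Ker}B^\dagger\xrightarrow{M}V\to\operatorname{Coker}B^\dagger$ is injective, $\operatorname{Ker}L\xrightarrow{N}V\to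 V/(\operatorname{Im}M+\operatorname{Im}B^\dagger)$ is an isomorphism, and $N$ vanishes on a complement of $\operatorname{Ker}L$. Put $\Sigma=(B^\dagger+MQ_B)(A+LP_A)+NP_A$, which is of determinant class, and $$P(B,A):\ (s_0\wedge s_1)\otimes(Ls_1)^*\mapsto\det(\Sigma)^{-1}\,(Ns_0\wedge Mt)\otimes t^*$$ for non-zero $s_0\in|\operatorname{Ker}L|$, $s_1\in|\operatorname{Ker}N|$, $t\in|\operatorname{Coker}B|$. Here $P(B,A)$ is a map $|\operatorname{Ker}A|\otimes|\operatorname{Coker}A|^*\to|\operatorname{Ker}B|\otimes|\operatorname{Coker}B|^*$, and $\operatorname{Ker}B^\dagger\cong\operatorname{Coker}B$, $\operatorname{Ker}B\cong\operatorname{Coker}B^\dagger$ are identified through the quotient maps. **Complexes.** A $\mathbb Z/2\mathbb Z$-graded Fredholm complex $D=(X,d)$ consists of linear maps $d_+:X_+\to X_-$, $d_-:X_-\to X_+$ of $\mathbb F$-vector spaces with $d_-d_+=0=d_+d_-$ whose homology groups $H_+(D)=\operatorname{Ker}d_+/\operatorname{Im}d_-$ and $H_-(D)=\operatorname{Ker}d_-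 /\operatorname{Im}d_+$ are finite dimensional; $|D|:=|H_+(D)|\otimes|H_-(D)|^*$. A pseudo-inverse $D^\dagger$ of $D$ is a Fredholm complex formed by pseudo-inverses $d_+^\dagger:X_-\to X_+$ and $d_-^\dagger:X_+\to X_-$ of $d_+$ and $d_-$. Let $D=(X,d)$ and $\Delta=(X,\delta)$ be $\mathbb Z/2\mathbb Z$-graded Fredholm complexes on the same spaces such that $d_\pm-\delta_\pm$ have finite rank. Choose pseudo-inverses $D^\dagger,\Delta^\dagger$ with $d_\pm^\dagger-\delta_\pm^\dagger$ of finite rank, and put $\sigma_+=d_++d_-^\dagger$, $\tau_+=\delta_++\delta_-^\dagger:X_+\to X_-$. These have finite dimensional kernels and cokernels, and there are canonical isomorphisms $\operatorname{Ker}\sigma_+\cong H_+(D)$, $\operatorname{Coker}\sigma_+\cong H_-(D)$, $\operatorname{Ker}\tau_+\cong H_+(\Delta)$, $\operatorname{Coker}\tau_+\cong H_-(\Delta)$. Choose pseudo-inverses of $\sigma_+$ and $\tau_+$ (for instance $d_-+d_+^\dagger$ and $\delta_-+\delta_+^\dagger$) and a perturbation triple $(L,M,N)$ for $\sigma_+\to\tau_+$.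 Then $P(\Delta,D):|D|\to|\Delta|$ is the map corresponding to $P(\tau_+,\sigma_+)$ under these isomorphisms. **Theorem.** Such choices exist. For every choice, the construction determines a well-defined linear map $P(\Delta,D):|D|\to|\Delta|$; it is an isomorphism, and it is the same for all choices: it does not depend on the pseudo-inverses $D^\dagger$ and $\Delta^\dagger$, on the pseudo-inverses of $\sigma_+$ and $\tau_+$, or on the perturbation triple $(L,M,N)$ (including, when the index is $0$, on which of the two kinds of triple is used). -/

import Mathlib

open scoped TensorProduct

noncomputable section

namespace PerturbationIso

universe u v w

/-! ### Linear algebra: finite rank, Fredholm operators, pseudo-inverses, determinants -/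

section Operators

variable {F : Type u} [Field F]
  {V : Type v} [AddCommGroup V] [Module F V]
  {W : Type w} [AddCommGroup W] [Module F W]

/-- A linear map of finite rank. -/
def FiniteRank (f : V →ₗ[F] W) : Prop :=
  FiniteDimensional F (LinearMap.range f)

/-- The cokernel of a linear map. -/
abbrev Coker (A : V →ₗ[F] W) : Type w := W ⧸ LinearMap.range A

/-- The index `dim Ker A - dim Coker A` of a Fredholm operator. -/
def index (A : V →ₗ[F] W) : ℤ :=
  (Module.finrank F (LinearMap.ker A) : ℤ) - (Module.finrank F (Coker A) : ℤ)

/-- `A'` is a pseudo-inverse of `A`: the maps `A A'` and `1 - A' A` are idempotents onto `Im A`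
and `Ker A`, and `1 - A A'` has image `Ker A'`.
Equivalently, `A A' A = A` and `A' A A' = A'`. -/
structure IsPseudoInverse (A : V →ₗ[F] W) (A' : W →ₗ[F] V) : Prop where
  idem_left : (A ∘ₗ A') ∘ₗ (A ∘ₗ A') = A ∘ₗ A'
  idem_right : (LinearMap.id - A' ∘ₗ A) ∘ₗ (LinearMap.id - A' ∘ₗ A) = LinearMap.id - A' ∘ₗ A
  range_left : LinearMap.range (A ∘ₗ A') = LinearMap.range A
  range_right : LinearMap.range (LinearMap.id - A' ∘ₗ A) = LinearMap.ker A
  range_coker : LinearMap.range (LinearMap.id - A ∘ₗ A') = LinearMap.ker A'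

/-- The idempotent `P_A = 1 - A' A`, regarded as a map onto its image `Ker A`. -/
def kerProj (A : V →ₗ[F] W) (A' : W →ₗ[F] V) (h : IsPseudoInverse A A') :
    V →ₗ[F] LinearMap.ker A :=
  LinearMap.codRestrict (LinearMap.ker A) (LinearMap.id - A' ∘ₗ A)
    (fun x => h.range_right ▸ LinearMap.mem_range_self _ x)

/-- The idempotent `Q_A = 1 - A A'`, regarded as a map onto its image `Ker A'`. -/
def cokerProj (A : V →ₗ[F] W) (A' : W →ₗ[F] V) (h : IsPseudoInverse A A') :
    W →ₗ[F] LinearMap.ker A' :=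
  LinearMap.codRestrict (LinearMap.ker A') (LinearMap.id - A ∘ₗ A')
    (fun x => h.range_coker ▸ LinearMap.mem_range_self _ x)

/-- An endomorphism is of determinant class if it is invertible and differs from the identity by
an operator of finite rank. -/
def IsDeterminantClass (T : V →ₗ[F] V) : Prop :=
  Function.Bijective T ∧ FiniteRank (LinearMap.id - T)

/-- The determinant of an endomorphism `T` of determinant class: the determinant of the
restriction of `T` to the finite dimensional invariant subspace `Im (1 - T)`. (Any larger finite
dimensional invariant subspace gives the same value, since `T` is the identity modulo
`Im (1 - T)`.) -/
def detClassDet (T : V →ₗ[F] V) : F :=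
  LinearMap.det (T.restrict (p := LinearMap.range (LinearMap.id - T))
    (q := LinearMap.range (LinearMap.id - T)) (by
      rintro _ ⟨y, rfl⟩
      exact ⟨T y, by simp⟩))

end Operators

/-! ### Determinant lines -/

section Lines

/-- The determinant `|V|` of a finite dimensional vector space: the top exterior power. -/
abbrev DetLine (F : Type u) [Field F] (V : Type v) [AddCommGroup V] [Module F V] : Type (max u v) :=
  ⋀[F]^(Module.finrank F V) V

variable {F : Type u} [Field F]
  {U : Type*} [AddCommGroup U] [Module F U]
  {U' : Type*} [AddCommGroup U'] [Module F U']
  {V : Type*} [AddCommGroup V] [Module F V]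

variable (F V) in
/-- The homogeneous component of degree `dim V` of an element of the exterior algebra of `V`. -/
def topPart : ExteriorAlgebra F V →ₗ[F] DetLine F V :=
  (DirectSum.component F ℕ (fun n => ⋀[F]^n V) (Module.finrank F V)) ∘ₗ
    (DirectSum.decomposeLinearEquiv (fun n => ⋀[F]^n V)).toLinearMap

/-- The map `|U| → |V|`, `u₁ ∧ ⋯ ∧ uₙ ↦ f u₁ ∧ ⋯ ∧ f uₙ` induced by a linear map `f : U → V`
between spaces of the same dimension. -/
def detMap (f : U →ₗ[F] V) : DetLine F U →ₗ[F] DetLine F V :=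
  topPart F V ∘ₗ (ExteriorAlgebra.map f).toLinearMap ∘ₗ (⋀[F]^(Module.finrank F U) U).subtype

/-- The vector `f(s) ∧ g(t) ∈ |V|`, for `s ∈ |U|`, `t ∈ |U'|` and linear maps `f : U → V`,
`g : U' → V` with `dim U + dim U' = dim V`. -/
def detWedge (f : U →ₗ[F] V) (s : DetLine F U) (g : U' →ₗ[F] V) (t : DetLine F U') :
    DetLine F V :=
  topPart F V (ExteriorAlgebra.map f (s : ExteriorAlgebra F U) *
    ExteriorAlgebra.map g (t : ExteriorAlgebra F U'))

end Lines

/-! ### Perturbations of Fredholm operators -/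

section Perturbation

variable {F : Type u} [Field F]
  {V : Type v} [AddCommGroup V] [Module F V]
  {W : Type w} [AddCommGroup W] [Module F W]

/-- The line `|Ker A| ⊗ |Coker A|^*` of a Fredholm operator. -/
abbrev OpLine (A : V →ₗ[F] W) : Type (max u v w) :=
  DetLine F (LinearMap.ker A) ⊗[F] Module.Dual F (DetLine F (Coker A))

/-- A perturbation triple `(L, M, N)` for `A → B` when the index is `≤ 0`; here `B'` is a
pseudo-inverse of `B`. -/
structure NonposTriple (A : V →ₗ[F] W) (B' : W →ₗ[F] V) where
  L : LinearMap.ker A →ₗ[F] W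
  M : LinearMap.ker B' →ₗ[F] V
  /-- `N` is already extended from `Ker M` to all of `Ker B'`. -/
  N : LinearMap.ker B' →ₗ[F] W
  injective_L : Function.Injective ((LinearMap.range A).mkQ ∘ₗ L)
  surjective_M : Function.Surjective ((LinearMap.range B').mkQ ∘ₗ M)
  bijective_N : Function.Bijective
    ((LinearMap.range A ⊔ LinearMap.range L).mkQ ∘ₗ N ∘ₗ (LinearMap.ker M).subtype)
  /-- `N` is zero on a complement of `Ker M`; as `N` is injective on `Ker M`, this complement is
  `Ker N`. -/
  compl_N : IsCompl (LinearMap.ker M) (LinearMap.ker N)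

/-- A perturbation triple `(L, M, N)` for `A → B` when the index is `≥ 0`; here `B'` is a
pseudo-inverse of `B`. -/
structure NonnegTriple (A : V →ₗ[F] W) (B' : W →ₗ[F] V) where
  L : LinearMap.ker A →ₗ[F] W
  M : LinearMap.ker B' →ₗ[F] V
  /-- `N` is already extended from `Ker L` to all of `Ker A`. -/
  N : LinearMap.ker A →ₗ[F] V
  surjective_L : Function.Surjective ((LinearMap.range A).mkQ ∘ₗ L)
  injective_M : Function.Injective ((LinearMap.range B').mkQ ∘ₗ M)
  bijective_N : Function.Bijective
    ((LinearMap.range M ⊔ LinearMap.range B').mkQ ∘ₗ N ∘ₗ (LinearMap.ker L).subtype)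
  /-- `N` is zero on a complement of `Ker L`; as `N` is injective on `Ker L`, this complement is
  `Ker N`. -/
  compl_N : IsCompl (LinearMap.ker L) (LinearMap.ker N)

/-- A perturbation triple for `A → B`, of either kind when the index is zero. -/
inductive PerturbationTriple (A : V →ₗ[F] W) (B' : W →ₗ[F] V) : Type (max v w)
  | nonpos (h : index A ≤ 0) (T : NonposTriple A B') : PerturbationTriple A B'
  | nonneg (h : 0 ≤ index A) (T : NonnegTriple A B') : PerturbationTriple A B'

variable {A B : V →ₗ[F] W} {A' B' : W →ₗ[F] V}

/-- `Σ = (A + L P_A)(B' + M Q_B) + N Q_B` on `W`. -/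
def NonposTriple.sigma (T : NonposTriple A B') (hA : IsPseudoInverse A A')
    (hB : IsPseudoInverse B B') : W →ₗ[F] W :=
  (A + T.L ∘ₗ kerProj A A' hA) ∘ₗ (B' + T.M ∘ₗ cokerProj B B' hB) + T.N ∘ₗ cokerProj B B' hB

/-- `Σ = (B' + M Q_B)(A + L P_A) + N P_A` on `V`. -/
def NonnegTriple.sigma (T : NonnegTriple A B') (hA : IsPseudoInverse A A')
    (hB : IsPseudoInverse B B') : V →ₗ[F] V :=
  (B' + T.M ∘ₗ cokerProj B B' hB) ∘ₗ (A + T.L ∘ₗ kerProj A A' hA) + T.N ∘ₗ kerProj A A' hA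

/-- `P : |Ker A| ⊗ |Coker A|^* → |Ker B| ⊗ |Coker B|^*` is the perturbation isomorphism given by
a triple with index `≤ 0`:
`P (s ⊗ (L s ∧ N t₁)^*) = det(Σ)⁻¹ (M t₀ ⊗ (t₀ ∧ t₁)^*)` for non-zero
`s ∈ |Ker A|`, `t₁ ∈ |Ker M|`, `t₀ ∈ |Ker N|`, where `x^*` is the functional with `x^*(x) = 1`.
The spaces `Ker B'` and `Coker B` are identified by the quotient map; `Coker B'` and `Ker B` are
identified by the map induced by `P_B = 1 - B' B`, which inverts `Ker B → Coker B'`. -/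
def NonposTriple.IsPerturbationMap (T : NonposTriple A B') (hA : IsPseudoInverse A A')
    (hB : IsPseudoInverse B B') (P : OpLine A →ₗ[F] OpLine B) : Prop :=
  IsDeterminantClass (T.sigma hA hB) ∧
  ∀ (s : DetLine F (LinearMap.ker A)) (t₁ : DetLine F (LinearMap.ker T.M))
    (t₀ : DetLine F (LinearMap.ker T.N)), s ≠ 0 → t₁ ≠ 0 → t₀ ≠ 0 →
  ∀ (φ : Module.Dual F (DetLine F (Coker A))) (ψ : Module.Dual F (DetLine F (Coker B))),
    φ (detWedge ((LinearMap.range A).mkQ ∘ₗ T.L) s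
        ((LinearMap.range A).mkQ ∘ₗ T.N ∘ₗ (LinearMap.ker T.M).subtype) t₁) = 1 →
    ψ (detWedge
        ((LinearMap.range B).mkQ ∘ₗ (LinearMap.ker B').subtype ∘ₗ (LinearMap.ker T.N).subtype) t₀
        ((LinearMap.range B).mkQ ∘ₗ (LinearMap.ker B').subtype ∘ₗ (LinearMap.ker T.M).subtype) t₁)
      = 1 →
    P (s ⊗ₜ[F] φ) = (detClassDet (T.sigma hA hB))⁻¹ •
      (detMap (kerProj B B' hB ∘ₗ T.M ∘ₗ (LinearMap.ker T.N).subtype) t₀ ⊗ₜ[F] ψ)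

/-- `P : |Ker A| ⊗ |Coker A|^* → |Ker B| ⊗ |Coker B|^*` is the perturbation isomorphism given by
a triple with index `≥ 0`:
`P ((s₀ ∧ s₁) ⊗ (L s₁)^*) = det(Σ)⁻¹ ((N s₀ ∧ M t) ⊗ t^*)` for non-zero
`s₀ ∈ |Ker L|`, `s₁ ∈ |Ker N|`, `t ∈ |Ker B'| = |Coker B|`. The identifications are those of the
other case. -/
def NonnegTriple.IsPerturbationMap (T : NonnegTriple A B') (hA : IsPseudoInverse A A')
    (hB : IsPseudoInverse B B') (P : OpLine A →ₗ[F] OpLine B) : Prop :=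
  IsDeterminantClass (T.sigma hA hB) ∧
  ∀ (s₀ : DetLine F (LinearMap.ker T.L)) (s₁ : DetLine F (LinearMap.ker T.N))
    (t : DetLine F (LinearMap.ker B')), s₀ ≠ 0 → s₁ ≠ 0 → t ≠ 0 →
  ∀ (φ : Module.Dual F (DetLine F (Coker A))) (ψ : Module.Dual F (DetLine F (Coker B))),
    φ (detMap ((LinearMap.range A).mkQ ∘ₗ T.L ∘ₗ (LinearMap.ker T.N).subtype) s₁) = 1 →
    ψ (detMap ((LinearMap.range B).mkQ ∘ₗ (LinearMap.ker B').subtype) t) = 1 →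
    P (detWedge (LinearMap.ker T.L).subtype s₀ (LinearMap.ker T.N).subtype s₁ ⊗ₜ[F] φ) =
      (detClassDet (T.sigma hA hB))⁻¹ •
        (detWedge (kerProj B B' hB ∘ₗ T.N ∘ₗ (LinearMap.ker T.L).subtype) s₀
          (kerProj B B' hB ∘ₗ T.M) t ⊗ₜ[F] ψ)

/-- `P` is the perturbation isomorphism from `A` to `B` obtained from the pseudo-inverses `A'`,
`B'` and the given perturbation triple. -/
def PerturbationTriple.IsPerturbationMap (hA : IsPseudoInverse A A')
    (hB : IsPseudoInverse B B') (P : OpLine A →ₗ[F] OpLine B) : PerturbationTriple A B' → Prop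
  | .nonpos _ T => T.IsPerturbationMap hA hB P
  | .nonneg _ T => T.IsPerturbationMap hA hB P

end Perturbation

/-! ### `ℤ/2ℤ`-graded complexes -/

/-- A `ℤ/2ℤ`-graded complex `X₊ → X₋ → X₊`. -/
structure GradedComplex (F : Type u) [Field F] (Xp : Type v) [AddCommGroup Xp] [Module F Xp]
    (Xm : Type w) [AddCommGroup Xm] [Module F Xm] where
  dPlus : Xp →ₗ[F] Xm
  dMinus : Xm →ₗ[F] Xp
  minus_plus : dMinus ∘ₗ dPlus = 0
  plus_minus : dPlus ∘ₗ dMinus = 0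

namespace GradedComplex

variable {F : Type u} [Field F]
  {Xp : Type v} [AddCommGroup Xp] [Module F Xp]
  {Xm : Type w} [AddCommGroup Xm] [Module F Xm]

/-- `H₊(D) = Ker d₊ / Im d₋`. -/
abbrev HPlus (D : GradedComplex F Xp Xm) : Type v :=
  LinearMap.ker D.dPlus ⧸ (LinearMap.range D.dMinus).submoduleOf (LinearMap.ker D.dPlus)

/-- `H₋(D) = Ker d₋ / Im d₊`. -/
abbrev HMinus (D : GradedComplex F Xp Xm) : Type w :=
  LinearMap.ker D.dMinus ⧸ (LinearMap.range D.dPlus).submoduleOf (LinearMap.ker D.dMinus)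

/-- A complex is Fredholm if its homology is finite dimensional. -/
def IsFredholm (D : GradedComplex F Xp Xm) : Prop :=
  FiniteDimensional F D.HPlus ∧ FiniteDimensional F D.HMinus

/-- The determinant `|D| = |H₊(D)| ⊗ |H₋(D)|^*`. -/
abbrev Line (D : GradedComplex F Xp Xm) : Type (max u v w) :=
  DetLine F D.HPlus ⊗[F] Module.Dual F (DetLine F D.HMinus)

/-- The differentials of the two complexes differ by operators of finite rank. -/
def IsFiniteRankPerturbation (D Δ : GradedComplex F Xp Xm) : Prop :=
  FiniteRank (D.dPlus - Δ.dPlus) ∧ FiniteRank (D.dMinus - Δ.dMinus)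

/-- A pseudo-inverse of a complex: a Fredholm complex `X₋ → X₊ → X₋` whose differentials are
pseudo-inverses of `d₊` and `d₋`. -/
structure IsDagger (D : GradedComplex F Xp Xm) (D' : GradedComplex F Xm Xp) : Prop where
  fredholm : D'.IsFredholm
  plus : IsPseudoInverse D.dPlus D'.dPlus
  minus : IsPseudoInverse D.dMinus D'.dMinus

/-- `σ₊ = d₊ + d₋^†`. -/
def sigmaPlus (D : GradedComplex F Xp Xm) (D' : GradedComplex F Xm Xp) : Xp →ₗ[F] Xm :=
  D.dPlus + D'.dMinus

variable {D : GradedComplex F Xp Xm} {D' : GradedComplex F Xm Xp}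

theorem IsDagger.plus_apply (h : D.IsDagger D') (x : Xp) :
    D.dPlus (D'.dPlus (D.dPlus x)) = D.dPlus x := by
  have h1 : x - D'.dPlus (D.dPlus x) ∈ LinearMap.ker D.dPlus := by
    rw [← h.plus.range_right]
    exact ⟨x, by simp⟩
  rw [LinearMap.mem_ker, map_sub, sub_eq_zero] at h1
  exact h1.symm

theorem IsDagger.ker_le (h : D.IsDagger D') :
    LinearMap.ker (D.sigmaPlus D') ≤ LinearMap.ker D.dPlus := by
  intro x hx
  have h1 : D.dPlus x = -D'.dMinus x := eq_neg_of_add_eq_zero_left hx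
  have h2 : D'.dPlus (D'.dMinus x) = 0 := LinearMap.congr_fun D'.plus_minus x
  rw [LinearMap.mem_ker, ← h.plus_apply, h1, map_neg, h2, neg_zero, map_zero]

theorem IsDagger.range_le (h : D.IsDagger D') :
    LinearMap.range D.dPlus ≤ LinearMap.range (D.sigmaPlus D') := by
  rintro _ ⟨x, rfl⟩
  have h2 : D'.dMinus (D'.dPlus (D.dPlus x)) = 0 := LinearMap.congr_fun D'.minus_plus _
  exact ⟨D'.dPlus (D.dPlus x), by simp [sigmaPlus, h.plus_apply, h2]⟩

/-- The canonical isomorphism `Ker σ₊ → H₊(D)`, induced by the inclusion `Ker σ₊ ⊆ Ker d₊`. -/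
def IsDagger.kerToHPlus (h : D.IsDagger D') :
    LinearMap.ker (D.sigmaPlus D') →ₗ[F] D.HPlus :=
  Submodule.mkQ _ ∘ₗ Submodule.inclusion h.ker_le

/-- The canonical isomorphism `H₋(D) → Coker σ₊`, induced by the inclusion `Ker d₋ ⊆ X₋`. -/
def IsDagger.hMinusToCoker (h : D.IsDagger D') :
    D.HMinus →ₗ[F] Coker (D.sigmaPlus D') :=
  Submodule.mapQ _ _ (LinearMap.ker D.dMinus).subtype (Submodule.comap_mono h.range_le)

/-- The canonical isomorphism `|Ker σ₊| ⊗ |Coker σ₊|^* → |D|`. -/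
def IsDagger.lineMap (h : D.IsDagger D') : OpLine (D.sigmaPlus D') →ₗ[F] D.Line :=
  TensorProduct.map (detMap h.kerToHPlus) (detMap h.hMinusToCoker).dualMap

/-- All choices entering the construction of `P(Δ, D)`: pseudo-inverses `D^†` of `D` and `Δ^†` of
`Δ` which are finite rank perturbations of each other; pseudo-inverses of the Fredholm operators
`σ₊ = d₊ + d₋^†` and `τ₊ = δ₊ + δ₋^†` (for instance `d₋ + d₊^†` and `δ₋ + δ₊^†`); and a
perturbation triple for `σ₊ → τ₊`. -/
structure PerturbationData (D Δ : GradedComplex F Xp Xm) where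
  Ddag : GradedComplex F Xm Xp
  Δdag : GradedComplex F Xm Xp
  isDagger_D : D.IsDagger Ddag
  isDagger_Δ : Δ.IsDagger Δdag
  finiteRank : Ddag.IsFiniteRankPerturbation Δdag
  sigmaInv : Xm →ₗ[F] Xp
  tauInv : Xm →ₗ[F] Xp
  isPseudoInverse_sigma : IsPseudoInverse (D.sigmaPlus Ddag) sigmaInv
  isPseudoInverse_tau : IsPseudoInverse (Δ.sigmaPlus Δdag) tauInv
  triple : PerturbationTriple (D.sigmaPlus Ddag) tauInv

/-- `P : |D| → |Δ|` is the perturbation isomorphism built from the choices `c`: under the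
canonical isomorphisms `|Ker σ₊| ⊗ |Coker σ₊|^* ≅ |D|` and `|Ker τ₊| ⊗ |Coker τ₊|^* ≅ |Δ|` it is
the perturbation isomorphism from `σ₊` to `τ₊`. -/
def PerturbationData.IsPerturbationIso {D Δ : GradedComplex F Xp Xm} (c : PerturbationData D Δ)
    (P : D.Line →ₗ[F] Δ.Line) : Prop :=
  ∃ P₀ : OpLine (D.sigmaPlus c.Ddag) →ₗ[F] OpLine (Δ.sigmaPlus c.Δdag),
    c.triple.IsPerturbationMap c.isPseudoInverse_sigma c.isPseudoInverse_tau P₀ ∧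
    P ∘ₗ c.isDagger_D.lineMap = c.isDagger_Δ.lineMap ∘ₗ P₀

end GradedComplex

end PerturbationIso

end

open scoped TensorProduct

set_option linter.unusedSectionVars false

namespace PerturbationIso

open ExteriorAlgebra Module

/-! ### Exterior algebra: sign rules, rank bounds, volumes and determinants. -/

section Exterior

variable {F : Type*} [Field F]
  {U : Type*} [AddCommGroup U] [Module F U]
  {U' : Type*} [AddCommGroup U'] [Module F U']
  {V : Type*} [AddCommGroup V] [Module F V]
  {W : Type*} [AddCommGroup W] [Module F W]

/-! The perturbation isomorphism is, up to a sign depending only on the dimensions of the homology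
groups, a quotient of two torsions, and the torsions involve none of the choices except a common
subcomplex of finite codimension.

For a finite dimensional `ℤ/2ℤ`-graded complex with representatives `jp`, `jm` of the homology, pick
`yp`, `ym` of degrees equal to the ranks of `dp`, `dm`. The quotient of `yp ∧ dm ym ∧ jp h` by `dp
yp ∧ ym ∧ jm c` is independent of `yp`, `ym`, because both terms scale by the same factor. It
defines an isomorphism from `|H₊| ⊗ |H₋|^*` to the field (`HodgeModel.exists_isTorsion`). An
operator is the special case `dm = 0`.

In infinite dimensions, let `E` be an acyclic graded subspace of finite codimension, stable under
the differentials and the pseudo-inverses, on which all the data of `D` and `Δ` agree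
(`PerturbationData.exists_isReduction`). Dividing by `E` keeps the homology (`HodgeModel.descend`),
and `D`, `Δ` get torsions `Φ`, `Ψ`. Since `Σ` is the identity on the part of `E` in its domain, its
determinant is that of a map on a finite dimensional quotient (`detClassDet_eq`). Evaluating one
linear functional on two proportional vectors of top degree turns the formula with `(L, M, N)` into
an identity between torsions (`nonpos_torsion`, `nonneg_torsion`). The torsion of the folded
operator `d₊ + d₋^†` is that of the complex (`HodgeModel.torsion_fold`). Together these show that
`P` is a perturbation isomorphism exactly if `Ψ ∘ P = ± Φ` (`IsReduction.isPerturbationIso_iff`).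

Only `E` is left to vary. Passing from `E'` to a smaller `E` multiplies both torsions by a number
attached to the acyclic complex `E' / E`; as `D` and `Δ` coincide there, the number is the same for
both and cancels (`exists_smul_torsion`).

For existence, the two pseudo-inverses are prescribed to agree on a subspace of finite codimension
(`exists_perturbationData`); triples then exist by counting dimensions, the index being stable under
perturbations of finite rank. -/

theorem topPart_of_mem {x : ExteriorAlgebra F V} (hx : x ∈ ⋀[F]^(finrank F V) V) :
    (topPart F V x : ExteriorAlgebra F V) = x := by
  exact DirectSum.decompose_of_mem_same (fun n => ⋀[F]^n V) hx

theorem topPart_of_mem_ne {x : ExteriorAlgebra F V} {k : ℕ} (hx : x ∈ ⋀[F]^k V)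
    (hk : k ≠ finrank F V) : topPart F V x = 0 := by
  apply Subtype.ext
  exact DirectSum.decompose_of_mem_ne (fun n => ⋀[F]^n V) hx hk

theorem map_mem (f : U →ₗ[F] V) {k : ℕ} {x : ExteriorAlgebra F U} (hx : x ∈ ⋀[F]^k U) :
    map f x ∈ ⋀[F]^k V := by
  have h := Submodule.mem_map_of_mem (f := (map f).toLinearMap) hx
  rw [Submodule.map_pow, ι_range_map_map] at h
  exact pow_le_pow_left' LinearMap.map_le_range k h

theorem map_map_apply (g : V →ₗ[F] W) (f : U →ₗ[F] V) (x : ExteriorAlgebra F U) :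
    map g (map f x) = map (g ∘ₗ f) x := by
  rw [← map_comp_map]; rfl

theorem mul_mem_exteriorPower {p q : ℕ} {a b : ExteriorAlgebra F V} (ha : a ∈ ⋀[F]^p V)
    (hb : b ∈ ⋀[F]^q V) : a * b ∈ ⋀[F]^(p + q) V :=
  SetLike.GradedMul.mul_mem ha hb

theorem ι_mul_comm (v : V) {q : ℕ} {b : ExteriorAlgebra F V} (hb : b ∈ ⋀[F]^q V) :
    ι F v * b = (-1 : F) ^ q • (b * ι F v) := by
  rw [← ιMulti_span_fixedDegree] at hb
  induction hb using Submodule.span_induction with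
  | mem x hx =>
    obtain ⟨w, rfl⟩ := hx
    induction q with
    | zero => simp
    | succ q ih =>
      rw [ιMulti_succ_apply, ← mul_assoc, eq_neg_of_add_eq_zero_left (ι_add_mul_swap v (w 0)),
        neg_mul, mul_assoc, ih, pow_succ]
      simp [mul_assoc]
  | zero => simp
  | add x y _ _ hx hy => rw [mul_add, hx, hy, add_mul, smul_add]
  | smul c x _ hx => rw [mul_smul_comm, hx, smul_mul_assoc, smul_comm]

/-- Each vector of `a` is moved past `b` by `ι_mul_comm`. The signs in the comparison of torsions
all come from this rule. -/
theorem graded_comm {p q : ℕ} {a b : ExteriorAlgebra F V} (ha : a ∈ ⋀[F]^p V)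
    (hb : b ∈ ⋀[F]^q V) : a * b = (-1 : F) ^ (p * q) • (b * a) := by
  rw [← ιMulti_span_fixedDegree] at ha
  induction ha using Submodule.span_induction with
  | mem x hx =>
    obtain ⟨w, rfl⟩ := hx
    induction p with
    | zero => simp
    | succ p ih =>
      rw [ιMulti_succ_apply, mul_assoc, ih, mul_smul_comm, ← mul_assoc, ι_mul_comm _ hb,
        smul_mul_assoc, smul_smul, mul_assoc, ← pow_add, Nat.succ_mul]
  | zero => simp
  | add x y _ _ hx hy => rw [add_mul, hx, hy, mul_add, smul_add]
  | smul c x _ hx => rw [smul_mul_assoc, hx, mul_smul_comm, smul_comm]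

theorem finrank_detLine [FiniteDimensional F V] : finrank F (DetLine F V) = 1 := by
  rw [exteriorPower.finrank_eq, Nat.choose_self]

theorem eq_zero_of_mem_exteriorPower [FiniteDimensional F V] {k : ℕ} (hk : finrank F V < k)
    {x : ExteriorAlgebra F V} (hx : x ∈ ⋀[F]^k V) : x = 0 := by
  have h : finrank F (⋀[F]^k V) = 0 := by
    rw [exteriorPower.finrank_eq, Nat.choose_eq_zero_of_lt hk]
  have := finrank_zero_iff.1 h
  exact congrArg Subtype.val (Subsingleton.elim (⟨x, hx⟩ : ⋀[F]^k V) 0)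

theorem map_eq_zero_of_rank_lt (f : U →ₗ[F] V) [FiniteDimensional F (LinearMap.range f)] {k : ℕ}
    (hk : finrank F (LinearMap.range f) < k) {x : ExteriorAlgebra F U} (hx : x ∈ ⋀[F]^k U) :
    map f x = 0 := by
  have h : map f x = map (LinearMap.range f).subtype (map f.rangeRestrict x) := by
    rw [map_map_apply]; rfl
  rw [h, eq_zero_of_mem_exteriorPower hk (map_mem _ hx), map_zero]

/-- For `v = f u` the product is the image of `x ∧ u`, whose degree exceeds the rank of `f`. Hence,
next to a factor `f x` of maximal degree, other vectors matter only modulo `range f`. -/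
theorem map_mul_ι_eq_zero (f : U →ₗ[F] V) [FiniteDimensional F (LinearMap.range f)] {k : ℕ}
    (hk : finrank F (LinearMap.range f) ≤ k) {x : ExteriorAlgebra F U} (hx : x ∈ ⋀[F]^k U)
    {v : V} (hv : v ∈ LinearMap.range f) : map f x * ι F v = 0 := by
  obtain ⟨u, rfl⟩ := hv
  rw [← map_apply_ι, ← map_mul]
  refine map_eq_zero_of_rank_lt f (Nat.lt_succ_of_le hk) (mul_mem_exteriorPower (q := 1) hx ?_)
  have h := Submodule.pow_mem_pow (LinearMap.range (ι F : U →ₗ[F] _)) ⟨u, rfl⟩ 1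
  rwa [pow_one (ι F u)] at h

theorem ι_mul_map_eq_zero (f : U →ₗ[F] V) [FiniteDimensional F (LinearMap.range f)] {k : ℕ}
    (hk : finrank F (LinearMap.range f) ≤ k) {x : ExteriorAlgebra F U} (hx : x ∈ ⋀[F]^k U)
    {v : V} (hv : v ∈ LinearMap.range f) : ι F v * map f x = 0 := by
  rw [ι_mul_comm v (map_mem f hx), map_mul_ι_eq_zero f hk hx hv, smul_zero]

/-- The maps `f` and `g` may be exchanged one vector at a time, since every difference `f u - g u`
can be moved to `k` and dies there. -/
theorem map_mul_eq_of_sub_mem {f g : U →ₗ[F] V} {k : ExteriorAlgebra F V}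
    (hk : ∀ u, ι F (f u - g u) * k = 0) (x : ExteriorAlgebra F U) : map f x * k = map g x * k := by
  -- The induction must also carry that `map g x * k` is annihilated by the differences.
  suffices h : ∀ x : ExteriorAlgebra F U, map f x * k = map g x * k ∧ ∀ u, ι F (f u - g u) * (map g x * k) = 0 from (h x).1
  intro x
  induction x using CliffordAlgebra.left_induction with
  | algebraMap r =>
    have : (algebraMap F (CliffordAlgebra (0 : QuadraticForm F U)) r) =
      algebraMap F (ExteriorAlgebra F U) r := rfl
    rw [this, AlgHom.commutes, AlgHom.commutes]
    refine ⟨rfl, fun u => ?_⟩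
    rw [← mul_assoc, ← Algebra.commutes, mul_assoc, hk, mul_zero]
  | add x y hx hy =>
    rw [map_add, map_add, add_mul, add_mul, hx.1, hy.1]
    exact ⟨rfl, fun u => by rw [mul_add, hx.2, hy.2, add_zero]⟩
  | ι_mul x m hx =>
    have : (CliffordAlgebra.ι (0 : QuadraticForm F U) m) = ι F m := rfl
    rw [this, map_mul, map_mul, map_apply_ι, map_apply_ι, mul_assoc, mul_assoc, hx.1]
    refine ⟨?_, fun u => ?_⟩
    · rw [← sub_eq_zero, ← sub_mul, ← map_sub, hx.2]
    · rw [← mul_assoc, eq_neg_of_add_eq_zero_left (ι_add_mul_swap _ _), neg_mul, mul_assoc, hx.2,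
        mul_zero, neg_zero]

theorem mul_map_eq_of_sub_mem {f g : U →ₗ[F] V} {k : ExteriorAlgebra F V}
    (hk : ∀ u, k * ι F (f u - g u) = 0) (x : ExteriorAlgebra F U) : k * map f x = k * map g x := by
  suffices h : ∀ x : ExteriorAlgebra F U, k * map f x = k * map g x ∧ ∀ u, (k * map g x) * ι F (f u - g u) = 0 from (h x).1
  intro x
  induction x using CliffordAlgebra.right_induction with
  | algebraMap r =>
    have : (algebraMap F (CliffordAlgebra (0 : QuadraticForm F U)) r) =
      algebraMap F (ExteriorAlgebra F U) r := rfl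
    rw [this, AlgHom.commutes, AlgHom.commutes]
    refine ⟨rfl, fun u => ?_⟩
    rw [mul_assoc, Algebra.commutes, ← mul_assoc, hk, zero_mul]
  | add x y hx hy =>
    rw [map_add, map_add, mul_add, mul_add, hx.1, hy.1]
    exact ⟨rfl, fun u => by rw [add_mul, hx.2, hy.2, add_zero]⟩
  | mul_ι m x hx =>
    have : (CliffordAlgebra.ι (0 : QuadraticForm F U) m) = ι F m := rfl
    rw [this, map_mul, map_mul, map_apply_ι, map_apply_ι, ← mul_assoc, ← mul_assoc, hx.1]
    refine ⟨?_, fun u => ?_⟩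
    · rw [← sub_eq_zero, ← mul_sub, ← map_sub, hx.2]
    · rw [mul_assoc, eq_neg_of_add_eq_zero_left (ι_add_mul_swap _ _), mul_neg, ← mul_assoc, hx.2,
        zero_mul, neg_zero]

/-- The degree `dim V` part of the exterior algebra of `V`, identified with the ground field. -/
noncomputable def volume (F : Type*) [Field F] (V : Type*) [AddCommGroup V] [Module F V]
    [FiniteDimensional F V] : ExteriorAlgebra F V →ₗ[F] F :=
  (LinearEquiv.ofFinrankEq (DetLine F V) F (finrank_detLine.trans (finrank_self F).symm)).toLinearMap
    ∘ₗ topPart F V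

variable [FiniteDimensional F V]

theorem volume_of_mem_ne {x : ExteriorAlgebra F V} {k : ℕ} (hx : x ∈ ⋀[F]^k V)
    (hk : k ≠ finrank F V) : volume F V x = 0 := by
  simp [volume, topPart_of_mem_ne hx hk]

theorem volume_eq_zero_iff {x : ExteriorAlgebra F V} (hx : x ∈ ⋀[F]^(finrank F V) V) :
    volume F V x = 0 ↔ x = 0 := by
  simp only [volume, LinearMap.comp_apply, LinearEquiv.coe_coe, LinearEquiv.map_eq_zero_iff]
  rw [← Subtype.coe_inj, topPart_of_mem hx, Submodule.coe_zero]

theorem eq_smul_of_finrank {x y : ExteriorAlgebra F V} (hx : x ∈ ⋀[F]^(finrank F V) V)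
    (hy : y ∈ ⋀[F]^(finrank F V) V) (h0 : x ≠ 0) : ∃ c : F, y = c • x := by
  obtain ⟨c, hc⟩ := (finrank_eq_one_iff_of_nonzero' (⟨x, hx⟩ : DetLine F V)
    (fun h => h0 (congrArg Subtype.val h))).1 finrank_detLine ⟨y, hy⟩
  exact ⟨c, (congrArg Subtype.val hc).symm⟩

/-- Elements of top degree are proportional. Stated as an exchange rule this avoids dividing by
either volume. -/
theorem apply_mul_volume_comm {x y : ExteriorAlgebra F V} (hx : x ∈ ⋀[F]^(finrank F V) V)
    (hy : y ∈ ⋀[F]^(finrank F V) V) (f : ExteriorAlgebra F V →ₗ[F] F) :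
    f x * volume F V y = f y * volume F V x := by
  by_cases h0 : x = 0
  · simp [h0]
  · obtain ⟨c, rfl⟩ := eq_smul_of_finrank hx hy h0
    simp only [map_smul, smul_eq_mul]; ring

/-- On top degree the volume of a wedge is a multiple of the determinant in a basis; in all other
degrees both sides vanish. -/
theorem volume_map (T : V →ₗ[F] V) (z : ExteriorAlgebra F V) :
    volume F V (map T z) = LinearMap.det T * volume F V z := by
  set n := finrank F V
  suffices h : volume F V ∘ₗ (map T).toLinearMap = LinearMap.det T • volume F V from
    LinearMap.congr_fun h z
  apply lhom_ext
  intro k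
  ext v
  simp only [LinearMap.compAlternatingMap_apply, LinearMap.comp_apply, AlgHom.toLinearMap_apply,
    map_apply_ιMulti, LinearMap.smul_apply, smul_eq_mul]
  have hmem : ∀ w : Fin k → V, ιMulti F k w ∈ ⋀[F]^k V := fun w =>
    ιMulti_range F k ⟨w, rfl⟩
  by_cases hk : k = n
  · subst hk
    let b := finBasis F V
    let g : V [⋀^Fin n]→ₗ[F] F := (volume F V).compAlternatingMap (ιMulti F n)
    have hg := g.eq_smul_basis_det b
    have h1 : ∀ w : Fin n → V, volume F V (ιMulti F n w) = g b * b.det w := fun w => by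
      conv_lhs => rw [show volume F V (ιMulti F n w) = g w from rfl, hg]
      simp
    rw [h1, h1, Basis.det_comp]; ring
  · rw [volume_of_mem_ne (hmem _) hk, volume_of_mem_ne (hmem _) hk, mul_zero]

/-- The alternating form `b.det` takes the value one on it. -/
theorem ιMulti_basis_ne_zero {n : ℕ} (b : Basis (Fin n) F U) : ιMulti F n b ≠ 0 := by
  intro h
  have h1 := exteriorPower.alternatingMapLinearEquiv_apply_ιMulti b.det b
  rw [Basis.det_self, show exteriorPower.ιMulti F n b = 0 from Subtype.ext h, map_zero] at h1
  exact zero_ne_one h1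

theorem exists_eq_smul_ιMulti_basis (U : Type*) [AddCommGroup U] [Module F U] [FiniteDimensional F U] (u : DetLine F U) :
    ∃ c : F, (u : ExteriorAlgebra F U) = c • ιMulti F _ (finBasis F U) :=
  eq_smul_of_finrank (ιMulti_range F _ ⟨_, rfl⟩) u.2 (ιMulti_basis_ne_zero _)

/-- Bases of `U` and `U'` combine to a basis of `U × U'`, and `f.coprod g`, being injective, is
injective on exterior algebras. -/
theorem wedge_ne_zero [FiniteDimensional F U] [FiniteDimensional F U'] {f : U →ₗ[F] W}
    {g : U' →ₗ[F] W} (h : Function.Injective (f.coprod g)) {u : DetLine F U} {u' : DetLine F U'}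
    (hu : u ≠ 0) (hu' : u' ≠ 0) :
    map f (u : ExteriorAlgebra F U) * map g (u' : ExteriorAlgebra F U') ≠ 0 := by
  obtain ⟨c, hc⟩ := exists_eq_smul_ιMulti_basis U u
  obtain ⟨c', hc'⟩ := exists_eq_smul_ιMulti_basis U' u'
  have hc0 : c ≠ 0 := by rintro rfl; exact hu (Subtype.ext (by simpa using hc))
  have hc0' : c' ≠ 0 := by rintro rfl; exact hu' (Subtype.ext (by simpa using hc'))
  rw [hc, hc', map_smul, map_smul, smul_mul_assoc, mul_smul_comm, smul_smul]
  refine smul_ne_zero (mul_ne_zero hc0 hc0') ?_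
  let b := ((finBasis F U).prod (finBasis F U')).reindex finSumFinEquiv
  have h1 : map f (ιMulti F _ (finBasis F U)) * map g (ιMulti F _ (finBasis F U')) =
      map (f.coprod g) (ιMulti F _ b) := by
    rw [map_apply_ιMulti, map_apply_ιMulti, ιMulti_mul_ιMulti, map_apply_ιMulti]
    congr 1
    ext i
    refine Fin.addCases (fun i => ?_) (fun i => ?_) i <;> simp [b]
  rw [h1]
  intro h2
  refine ιMulti_basis_ne_zero b (map_injective_field (LinearMap.ker_eq_bot.2 h) ?_)
  rw [h2, map_zero]

theorem map_ne_zero_of_injective {f : U →ₗ[F] W} (h : Function.Injective f)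
    {u : ExteriorAlgebra F U} (hu : u ≠ 0) : map f u ≠ 0 := fun h2 =>
  hu (map_injective_field (LinearMap.ker_eq_bot.2 h) (by rw [h2, map_zero]))

end Exterior

end PerturbationIso

namespace PerturbationIso

open ExteriorAlgebra Module

/-! ### The torsion of a finite dimensional `ℤ/2ℤ`-graded complex. -/

section Torsion

variable {F : Type*} [Field F]
  {U : Type*} [AddCommGroup U] [Module F U]
  {V : Type*} [AddCommGroup V] [Module F V]
  {W : Type*} [AddCommGroup W] [Module F W]
  {Xp : Type*} [AddCommGroup Xp] [Module F Xp]
  {Xm : Type*} [AddCommGroup Xm] [Module F Xm]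
  {Hp : Type*} [AddCommGroup Hp] [Module F Hp]
  {Hm : Type*} [AddCommGroup Hm] [Module F Hm]

/-- Linear maps `jp`, `jm` splitting off the homology of a `ℤ/2ℤ`-graded complex. -/
structure HodgeModel (dp : Xp →ₗ[F] Xm) (dm : Xm →ₗ[F] Xp) (jp : Hp →ₗ[F] Xp)
    (jm : Hm →ₗ[F] Xm) : Prop where
  inj_p : Function.Injective jp
  inj_m : Function.Injective jm
  disj_p : Disjoint (LinearMap.range jp) (LinearMap.range dm)
  disj_m : Disjoint (LinearMap.range jm) (LinearMap.range dp)
  sup_p : LinearMap.range jp ⊔ LinearMap.range dm = LinearMap.ker dp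
  sup_m : LinearMap.range jm ⊔ LinearMap.range dp = LinearMap.ker dm

theorem HodgeModel.swap {dp : Xp →ₗ[F] Xm} {dm : Xm →ₗ[F] Xp} {jp : Hp →ₗ[F] Xp}
    {jm : Hm →ₗ[F] Xm} (h : HodgeModel dp dm jp jm) : HodgeModel dm dp jm jp :=
  ⟨h.inj_m, h.inj_p, h.disj_m, h.disj_p, h.sup_m, h.sup_p⟩

theorem exists_section (f : V →ₗ[F] W) : ∃ g : W →ₗ[F] V, ∀ v, f (g (f v)) = f v := by
  obtain ⟨g, hg⟩ := f.rangeRestrict.exists_rightInverse_of_surjective f.range_rangeRestrict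
  obtain ⟨g', hg'⟩ := LinearMap.exists_extend g
  refine ⟨g', fun v => ?_⟩
  have h1 : g' (f v) = g (f.rangeRestrict v) := LinearMap.congr_fun hg' (f.rangeRestrict v)
  rw [h1]
  exact congrArg Subtype.val (LinearMap.congr_fun hg (f.rangeRestrict v))

theorem exists_detLine_range (f : V →ₗ[F] W) {y : ExteriorAlgebra F V}
    (hy : y ∈ ⋀[F]^(finrank F (LinearMap.range f)) V) :
    ∃ z : DetLine F (LinearMap.range f), map f y = map (LinearMap.range f).subtype
      (z : ExteriorAlgebra F (LinearMap.range f)) := by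
  refine ⟨⟨map f.rangeRestrict y, map_mem _ hy⟩, ?_⟩
  rw [map_map_apply]; rfl

theorem exists_map_ne_zero (f : V →ₗ[F] W) [FiniteDimensional F (LinearMap.range f)] :
    ∃ y ∈ ⋀[F]^(finrank F (LinearMap.range f)) V, map f y ≠ 0 := by
  obtain ⟨g, hg⟩ := f.rangeRestrict.exists_rightInverse_of_surjective f.range_rangeRestrict
  have : Nontrivial (DetLine F (LinearMap.range f)) :=
    nontrivial_of_finrank_pos (R := F) (by rw [finrank_detLine]; exact one_pos)
  obtain ⟨z, hz⟩ := exists_ne (0 : DetLine F (LinearMap.range f))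
  refine ⟨map g (z : ExteriorAlgebra F (LinearMap.range f)), map_mem _ z.2, ?_⟩
  rw [map_map_apply]
  refine map_ne_zero_of_injective ?_ (fun h => hz (Subtype.ext h))
  have : f ∘ₗ g = (LinearMap.range f).subtype := by
    ext x
    exact congrArg Subtype.val (LinearMap.congr_fun hg x)
  rw [this]; exact Subtype.val_injective

theorem exists_map_eq_smul (f : V →ₗ[F] W) [FiniteDimensional F (LinearMap.range f)]
    {y y' : ExteriorAlgebra F V} (hy : y ∈ ⋀[F]^(finrank F (LinearMap.range f)) V)
    (hy' : y' ∈ ⋀[F]^(finrank F (LinearMap.range f)) V) (h0 : map f y ≠ 0) :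
    ∃ a : F, map f y' = a • map f y := by
  obtain ⟨z, hz⟩ := exists_detLine_range f hy
  obtain ⟨z', hz'⟩ := exists_detLine_range f hy'
  obtain ⟨a, ha⟩ := eq_smul_of_finrank z.2 z'.2 (by rintro h; rw [hz, h, map_zero] at h0; exact h0 rfl)
  exact ⟨a, by rw [hz', ha, map_smul, hz]⟩

theorem wedge₃_ne_zero {A B C : Type*} [AddCommGroup A] [Module F A] [AddCommGroup B] [Module F B]
    [AddCommGroup C] [Module F C] [FiniteDimensional F A] [FiniteDimensional F B]
    [FiniteDimensional F C] {f : A →ₗ[F] W} {g : B →ₗ[F] W} {k : C →ₗ[F] W}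
    (h : Function.Injective (f.coprod (g.coprod k))) {a : DetLine F A} {b : DetLine F B}
    {c : DetLine F C} (ha : a ≠ 0) (hb : b ≠ 0) (hc : c ≠ 0) :
    map f (a : ExteriorAlgebra F A) * (map g (b : ExteriorAlgebra F B) *
      map k (c : ExteriorAlgebra F C)) ≠ 0 := by
  let e : DetLine F (B × C) := ⟨map (LinearMap.inl F B C) (b : ExteriorAlgebra F B) *
    map (LinearMap.inr F B C) (c : ExteriorAlgebra F C), by
      rw [finrank_prod]
      exact mul_mem_exteriorPower (map_mem _ b.2) (map_mem _ c.2)⟩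
  have he : e ≠ 0 := by
    intro h0
    refine wedge_ne_zero (f := LinearMap.inl F B C) (g := LinearMap.inr F B C) ?_ hb hc
      (congrArg Subtype.val h0)
    rw [LinearMap.coprod_inl_inr]; exact Function.injective_id
  have h1 := wedge_ne_zero h ha he
  simpa only [e, map_mul, map_map_apply, LinearMap.coprod_inl, LinearMap.coprod_inr] using h1

/-- The numerator `yp ∧ dm ym ∧ jp h` of the torsion. -/
noncomputable def torsionNum [FiniteDimensional F Xp] (dm : Xm →ₗ[F] Xp) (jp : Hp →ₗ[F] Xp)
    (yp : ExteriorAlgebra F Xp) (ym : ExteriorAlgebra F Xm) (h : ExteriorAlgebra F Hp) : F :=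
  volume F Xp (yp * (map dm ym * map jp h))

/-- The denominator `dp yp ∧ ym ∧ jm c` of the torsion. -/
noncomputable def torsionDen [FiniteDimensional F Xm] (dp : Xp →ₗ[F] Xm) (jm : Hm →ₗ[F] Xm)
    (yp : ExteriorAlgebra F Xp) (ym : ExteriorAlgebra F Xm) (c : ExteriorAlgebra F Hm) : F :=
  volume F Xm (map dp yp * (ym * map jm c))

/-- Exchanging even and odd turns the denominator into a numerator up to sign, so facts about
denominators follow from `HodgeModel.swap`. -/
theorem torsionDen_eq [FiniteDimensional F Xm] (dp : Xp →ₗ[F] Xm) (jm : Hm →ₗ[F] Xm)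
    {p q : ℕ} {yp : ExteriorAlgebra F Xp} {ym : ExteriorAlgebra F Xm} (hp : yp ∈ ⋀[F]^p Xp)
    (hq : ym ∈ ⋀[F]^q Xm) (c : ExteriorAlgebra F Hm) :
    torsionDen dp jm yp ym c = (-1) ^ (p * q) * torsionNum dp jm ym yp c := by
  rw [torsionDen, torsionNum, ← mul_assoc, graded_comm (map_mem dp hp) hq, smul_mul_assoc,
    map_smul, mul_assoc, smul_eq_mul]

namespace HodgeModel

variable {dp : Xp →ₗ[F] Xm} {dm : Xm →ₗ[F] Xp} {jp : Hp →ₗ[F] Xp} {jm : Hm →ₗ[F] Xm}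

/-- The vector `u - θ (dp u)` is a cycle, hence a sum of a homology representative and a boundary.
Both are killed by `dm ym ∧ jp h`, which has full degree in the boundaries and in the
representatives. So the product sees `yp` only through `dp yp`. -/
theorem mul_map_mul_map [FiniteDimensional F Hp] [FiniteDimensional F (LinearMap.range dm)]
    (M : HodgeModel dp dm jp jm) {θ : Xm →ₗ[F] Xp}
    (hθ : ∀ v, dp (θ (dp v)) = dp v) (yp : ExteriorAlgebra F Xp)
    {ym : ExteriorAlgebra F Xm} (hm : ym ∈ ⋀[F]^(finrank F (LinearMap.range dm)) Xm)
    (h : DetLine F Hp) :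
    yp * (map dm ym * map jp (h : ExteriorAlgebra F Hp)) =
      map θ (map dp yp) * (map dm ym * map jp (h : ExteriorAlgebra F Hp)) := by
  have key := map_mul_eq_of_sub_mem (f := LinearMap.id) (g := θ ∘ₗ dp)
    (k := map dm ym * map jp (h : ExteriorAlgebra F Hp)) (fun u => ?_) yp
  · rw [map_map_apply, ← key, map_id]; rfl
  · have hu : u - θ (dp u) ∈ LinearMap.ker dp := by simp [hθ]
    rw [← M.sup_p] at hu
    obtain ⟨_, ⟨a, rfl⟩, _, ⟨b, rfl⟩, hab⟩ := Submodule.mem_sup.1 hu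
    simp only [LinearMap.id_apply, LinearMap.comp_apply]
    rw [← hab, map_add, add_mul, ← mul_assoc _ (map dm ym), ← mul_assoc _ (map dm ym),
      ι_mul_map_eq_zero dm le_rfl hm ⟨b, rfl⟩, zero_mul, add_zero, ι_mul_comm _ (map_mem dm hm),
      smul_mul_assoc, mul_assoc,
      ι_mul_map_eq_zero jp (LinearMap.finrank_range_le jp) h.2 ⟨a, rfl⟩, mul_zero, smul_zero]

variable [FiniteDimensional F Xp] [FiniteDimensional F Xm]
  [FiniteDimensional F Hp] [FiniteDimensional F Hm]

theorem finrank_eq (M : HodgeModel dp dm jp jm) :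
    finrank F Xp = finrank F (LinearMap.range dp) +
      (finrank F (LinearMap.range dm) + finrank F Hp) := by
  rw [← LinearMap.finrank_range_add_finrank_ker dp, ← M.sup_p]
  have h := Submodule.finrank_sup_add_finrank_inf_eq (LinearMap.range jp) (LinearMap.range dm)
  rw [M.disj_p.eq_bot, finrank_bot, add_zero, LinearMap.finrank_range_of_inj M.inj_p] at h
  omega

/-- The factor `a * b` is the one by which the denominator changes in `torsionDen_eq'`; therefore
the torsion does not depend on `yp`, `ym`. -/
theorem torsionNum_eq (M : HodgeModel dp dm jp jm) {yp yp' : ExteriorAlgebra F Xp}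
    {ym ym' : ExteriorAlgebra F Xm}
    (hm : ym ∈ ⋀[F]^(finrank F (LinearMap.range dm)) Xm)
    (hm' : ym' ∈ ⋀[F]^(finrank F (LinearMap.range dm)) Xm) {a b : F}
    (ha : map dp yp' = a • map dp yp) (hb : map dm ym' = b • map dm ym) (h : DetLine F Hp) :
    torsionNum dm jp yp' ym' (h : ExteriorAlgebra F Hp) =
      a * b * torsionNum dm jp yp ym (h : ExteriorAlgebra F Hp) := by
  obtain ⟨θ, hθ⟩ := exists_section dp
  rw [torsionNum, torsionNum, M.mul_map_mul_map hθ yp' hm', M.mul_map_mul_map hθ yp hm, ha, hb]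
  simp only [map_smul, smul_mul_assoc, mul_smul_comm, smul_eq_mul]
  ring

theorem torsionDen_eq' (M : HodgeModel dp dm jp jm) {yp yp' : ExteriorAlgebra F Xp}
    {ym ym' : ExteriorAlgebra F Xm}
    (hp : yp ∈ ⋀[F]^(finrank F (LinearMap.range dp)) Xp)
    (hp' : yp' ∈ ⋀[F]^(finrank F (LinearMap.range dp)) Xp)
    (hm : ym ∈ ⋀[F]^(finrank F (LinearMap.range dm)) Xm)
    (hm' : ym' ∈ ⋀[F]^(finrank F (LinearMap.range dm)) Xm) {a b : F}
    (ha : map dp yp' = a • map dp yp) (hb : map dm ym' = b • map dm ym) (c : DetLine F Hm) :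
    torsionDen dp jm yp' ym' (c : ExteriorAlgebra F Hm) =
      a * b * torsionDen dp jm yp ym (c : ExteriorAlgebra F Hm) := by
  rw [torsionDen_eq dp jm hp' hm', torsionDen_eq dp jm hp hm, M.swap.torsionNum_eq hp hp' hb ha c]
  ring

/-- After replacing `yp` by `θ (dp yp)`, the three factors are non-zero top wedges of the images of
`θ` on `range dp`, of `dm` and of `jp`, and these subspaces are independent. -/
theorem torsionNum_ne_zero (M : HodgeModel dp dm jp jm) {yp : ExteriorAlgebra F Xp}
    {ym : ExteriorAlgebra F Xm}
    (hp : yp ∈ ⋀[F]^(finrank F (LinearMap.range dp)) Xp)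
    (hm : ym ∈ ⋀[F]^(finrank F (LinearMap.range dm)) Xm)
    (hp0 : map dp yp ≠ 0) (hm0 : map dm ym ≠ 0) {h : DetLine F Hp} (hh : h ≠ 0) :
    torsionNum dm jp yp ym (h : ExteriorAlgebra F Hp) ≠ 0 := by
  obtain ⟨θ, hθ⟩ := exists_section dp
  have hmem : yp * (map dm ym * map jp (h : ExteriorAlgebra F Hp)) ∈ ⋀[F]^(finrank F Xp) Xp := by
    rw [M.finrank_eq]
    exact mul_mem_exteriorPower hp (mul_mem_exteriorPower (map_mem _ hm) (map_mem _ h.2))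
  rw [torsionNum, Ne, volume_eq_zero_iff hmem, M.mul_map_mul_map hθ yp hm]
  obtain ⟨z, hz⟩ := exists_detLine_range dp hp
  obtain ⟨w, hw⟩ := exists_detLine_range dm hm
  rw [hz, hw, map_map_apply]
  refine wedge₃_ne_zero ?_ ?_ ?_ hh
  · rw [← LinearMap.ker_eq_bot, LinearMap.ker_eq_bot']
    rintro ⟨⟨_, ⟨v, rfl⟩⟩, ⟨b, hb⟩, k⟩ h0
    simp only [LinearMap.coprod_apply, LinearMap.comp_apply, Submodule.subtype_apply] at h0
    -- Applying `dp` removes the last two terms and forces `dp v = 0`; what remains is the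
    -- independence of boundaries and representatives.
    have hker : b + jp k ∈ LinearMap.ker dp := by
      rw [← M.sup_p]
      exact add_mem (Submodule.mem_sup_right hb) (Submodule.mem_sup_left ⟨k, rfl⟩)
    have h1 : dp v = 0 := by
      have h2 := congrArg dp h0
      rwa [map_add, hθ, hker, add_zero, map_zero] at h2
    rw [h1, map_zero, zero_add] at h0
    have h3 : jp k = 0 := Submodule.disjoint_def.1 M.disj_p _ ⟨k, rfl⟩
      (by rw [eq_neg_of_add_eq_zero_right h0]; exact neg_mem hb)
    have h4 : k = 0 := M.inj_p (by rw [h3, map_zero])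
    have h5 : b = 0 := by rwa [h3, add_zero] at h0
    simp only [h1, h4, h5]; rfl
  · rintro rfl; exact hp0 (by rw [hz]; exact map_zero _)
  · rintro rfl; exact hm0 (by rw [hw]; exact map_zero _)

theorem torsionDen_ne_zero (M : HodgeModel dp dm jp jm) {yp : ExteriorAlgebra F Xp}
    {ym : ExteriorAlgebra F Xm}
    (hp : yp ∈ ⋀[F]^(finrank F (LinearMap.range dp)) Xp)
    (hm : ym ∈ ⋀[F]^(finrank F (LinearMap.range dm)) Xm)
    (hp0 : map dp yp ≠ 0) (hm0 : map dm ym ≠ 0) {c : DetLine F Hm} (hc : c ≠ 0) :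
    torsionDen dp jm yp ym (c : ExteriorAlgebra F Hm) ≠ 0 := by
  rw [torsionDen_eq dp jm hp hm]
  exact mul_ne_zero (pow_ne_zero _ (neg_ne_zero.2 one_ne_zero))
    (M.swap.torsionNum_ne_zero hm hp hm0 hp0 hc)

end HodgeModel

/-- A functional on `|Hp| ⊗ |Hm|^*` is the torsion functional of a complex if it sends `h ⊗ c^*` to
the quotient of `yp ∧ dm ym ∧ jp h` and `dp yp ∧ ym ∧ jm c`. -/
def IsTorsion [FiniteDimensional F Xp] [FiniteDimensional F Xm] (dp : Xp →ₗ[F] Xm)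
    (dm : Xm →ₗ[F] Xp) (jp : Hp →ₗ[F] Xp) (jm : Hm →ₗ[F] Xm)
    (Φ : DetLine F Hp ⊗[F] Dual F (DetLine F Hm) →ₗ[F] F) : Prop :=
  ∀ yp ∈ ⋀[F]^(finrank F (LinearMap.range dp)) Xp,
  ∀ ym ∈ ⋀[F]^(finrank F (LinearMap.range dm)) Xm,
  ∀ (h : DetLine F Hp) (φ : Dual F (DetLine F Hm)) (c : DetLine F Hm),
    Φ (h ⊗ₜ φ) * torsionDen dp jm yp ym (c : ExteriorAlgebra F Hm) =
      torsionNum dm jp yp ym (h : ExteriorAlgebra F Hp) * φ c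

section

variable {dp : Xp →ₗ[F] Xm} {dm : Xm →ₗ[F] Xp} {jp : Hp →ₗ[F] Xp} {jm : Hm →ₗ[F] Xm}
  [FiniteDimensional F Xp] [FiniteDimensional F Xm]
  [FiniteDimensional F Hp] [FiniteDimensional F Hm]

theorem exists_detLine_ne_zero (F V : Type*) [Field F] [AddCommGroup V] [Module F V]
    [FiniteDimensional F V] : ∃ v : DetLine F V, v ≠ 0 := by
  have : Nontrivial (DetLine F V) :=
    nontrivial_of_finrank_pos (R := F) (by rw [finrank_detLine]; exact one_pos)
  exact exists_ne 0

theorem detLine_eq_smul {c c' : DetLine F Hm} (hc : c ≠ 0) : ∃ a : F, c' = a • c := by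
  obtain ⟨a, ha⟩ := eq_smul_of_finrank c.2 c'.2 (fun h => hc (Subtype.ext h))
  exact ⟨a, Subtype.ext ha⟩

theorem finrank_line : finrank F (DetLine F Hp ⊗[F] Dual F (DetLine F Hm)) = 1 := by
  rw [finrank_tensorProduct, Subspace.dual_finrank_eq, finrank_detLine, finrank_detLine]

theorem bijective_of_apply_ne_zero {V W : Type*} [AddCommGroup V] [Module F V] [AddCommGroup W]
    [Module F W] (hV : finrank F V = 1) (hW : finrank F W = 1) {Φ : V →ₗ[F] W} {v : V}
    (h : Φ v ≠ 0) : Function.Bijective Φ := by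
  have : FiniteDimensional F V := FiniteDimensional.of_finrank_eq_succ hV
  have : FiniteDimensional F W := FiniteDimensional.of_finrank_eq_succ hW
  have hinj : Function.Injective Φ := by
    rw [← LinearMap.ker_eq_bot, LinearMap.ker_eq_bot']
    intro w hw
    have hv : v ≠ 0 := by rintro rfl; exact h (map_zero _)
    obtain ⟨a, rfl⟩ := (finrank_eq_one_iff_of_nonzero' v hv).1 hV w
    rw [map_smul, smul_eq_zero] at hw
    rw [hw.resolve_right h, zero_smul]
  exact ⟨hinj, (LinearMap.injective_iff_surjective_of_finrank_eq_finrank (hV.trans hW.symm)).1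
    hinj⟩

theorem line_bijective {Φ : DetLine F Hp ⊗[F] Dual F (DetLine F Hm) →ₗ[F] F}
    {v : DetLine F Hp ⊗[F] Dual F (DetLine F Hm)} (h : Φ v ≠ 0) : Function.Bijective Φ := by
  have h1 : finrank F (DetLine F Hp ⊗[F] Dual F (DetLine F Hm)) = 1 := finrank_line
  have h2 := bijective_of_apply_ne_zero (Φ := Φ) (v := v)
  specialize h2 h1
  exact h2 (finrank_self F) h

/-- One pair `yp`, `ym` with non-zero images and one `c₀` define the functional as an honest
quotient; the scaling rules extend the cross-multiplied relation to all pairs, including degenerate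
ones, where both sides vanish. -/
theorem HodgeModel.exists_isTorsion (M : HodgeModel dp dm jp jm) :
    ∃ Φ : DetLine F Hp ⊗[F] Dual F (DetLine F Hm) →ₗ[F] F,
      Function.Bijective Φ ∧ IsTorsion dp dm jp jm Φ := by
  obtain ⟨yp, hp, hp0⟩ := exists_map_ne_zero dp
  obtain ⟨ym, hm, hm0⟩ := exists_map_ne_zero dm
  obtain ⟨h₀, hh₀⟩ := exists_detLine_ne_zero F Hp
  obtain ⟨c₀, hc₀⟩ := exists_detLine_ne_zero F Hm
  have hD := M.torsionDen_ne_zero hp hm hp0 hm0 hc₀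
  have hN := M.torsionNum_ne_zero hp hm hp0 hm0 hh₀
  let num : DetLine F Hp →ₗ[F] F := volume F Xp ∘ₗ LinearMap.mulLeft F (yp * map dm ym) ∘ₗ
    (map jp).toLinearMap ∘ₗ Submodule.subtype _
  have hnum : ∀ h, num h = torsionNum dm jp yp ym (h : ExteriorAlgebra F Hp) := fun h => by
    simp [num, torsionNum]
  let Φ : DetLine F Hp ⊗[F] Dual F (DetLine F Hm) →ₗ[F] F := TensorProduct.lift
    (LinearMap.mk₂ F (fun h φ => num h * φ c₀ / torsionDen dp jm yp ym (c₀ : ExteriorAlgebra F Hm))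
      (fun _ _ _ => by simp only [map_add]; ring) (fun _ _ _ => by simp; ring)
      (fun _ _ _ => by simp only [LinearMap.add_apply]; ring) (fun _ _ _ => by simp; ring))
  have hΦ : ∀ h φ, Φ (h ⊗ₜ φ) =
      num h * φ c₀ / torsionDen dp jm yp ym (c₀ : ExteriorAlgebra F Hm) := fun h φ => by simp [Φ]
  refine ⟨Φ, ?_, ?_⟩
  · obtain ⟨φ, hφ⟩ := Projective.exists_dual_ne_zero F hc₀
    have hval : Φ (h₀ ⊗ₜ φ) ≠ 0 := by
      rw [hΦ, hnum]
      exact div_ne_zero (mul_ne_zero hN hφ) hD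
    exact line_bijective hval
  · intro yp' hp' ym' hm' h φ c
    obtain ⟨a, ha⟩ := exists_map_eq_smul dp hp hp' hp0
    obtain ⟨b, hb⟩ := exists_map_eq_smul dm hm hm' hm0
    obtain ⟨e, rfl⟩ := detLine_eq_smul (c' := c) hc₀
    rw [M.torsionNum_eq hm hm' ha hb, M.torsionDen_eq' hp hp' hm hm' ha hb, hΦ, hnum, map_smul]
    have : torsionDen dp jm yp ym ((e • c₀ : DetLine F Hm) : ExteriorAlgebra F Hm) =
        e * torsionDen dp jm yp ym (c₀ : ExteriorAlgebra F Hm) := by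
      simp [torsionDen]
    rw [this, smul_eq_mul]
    field_simp

end

end Torsion

end PerturbationIso

namespace PerturbationIso

open ExteriorAlgebra Module

/-! ### Quotients by acyclic subcomplexes; determinants computed on finite dimensional quotients. -/

section Descent

variable {F : Type*} [Field F]
  {V : Type*} [AddCommGroup V] [Module F V]
  {W : Type*} [AddCommGroup W] [Module F W]
  {Xp : Type*} [AddCommGroup Xp] [Module F Xp]
  {Xm : Type*} [AddCommGroup Xm] [Module F Xm]
  {Hp : Type*} [AddCommGroup Hp] [Module F Hp]
  {Hm : Type*} [AddCommGroup Hm] [Module F Hm]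

/-- An acyclic subcomplex. -/
structure AcyclicSub (dp : Xp →ₗ[F] Xm) (dm : Xm →ₗ[F] Xp) (Ep : Submodule F Xp)
    (Em : Submodule F Xm) : Prop where
  map_p : Ep ≤ Em.comap dp
  map_m : Em ≤ Ep.comap dm
  exact_p : ∀ x ∈ Ep, dp x = 0 → ∃ e ∈ Em, dm e = x
  exact_m : ∀ x ∈ Em, dm x = 0 → ∃ e ∈ Ep, dp e = x

theorem AcyclicSub.swap {dp : Xp →ₗ[F] Xm} {dm : Xm →ₗ[F] Xp} {Ep : Submodule F Xp}
    {Em : Submodule F Xm} (h : AcyclicSub dp dm Ep Em) : AcyclicSub dm dp Em Ep :=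
  ⟨h.map_m, h.map_p, h.exact_m, h.exact_p⟩

section

variable {dp : Xp →ₗ[F] Xm} {dm : Xm →ₗ[F] Xp} {jp : Hp →ₗ[F] Xp} {jm : Hm →ₗ[F] Xm}
  {Ep : Submodule F Xp} {Em : Submodule F Xm}

theorem HodgeModel.dm_dp (M : HodgeModel dp dm jp jm) (x : Xp) : dm (dp x) = 0 := by
  have : dp x ∈ LinearMap.ker dm := M.sup_m ▸ Submodule.mem_sup_right ⟨x, rfl⟩
  exact this

theorem HodgeModel.dp_jp (M : HodgeModel dp dm jp jm) (x : Hp) : dp (jp x) = 0 := by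
  have : jp x ∈ LinearMap.ker dp := M.sup_p ▸ Submodule.mem_sup_left ⟨x, rfl⟩
  exact this

/-- The difference `jp h - dm w` is a cycle in the acyclic subcomplex, hence a boundary. Then `jp h`
is a boundary as well and must vanish. -/
theorem HodgeModel.eq_zero_of_mkQ_eq (M : HodgeModel dp dm jp jm) (hE : AcyclicSub dp dm Ep Em)
    {h : Hp} {w : Xm} (hw : Ep.mkQ (jp h) = Ep.mkQ (dm w)) : h = 0 := by
  rw [Submodule.mkQ_apply, Submodule.mkQ_apply, Submodule.Quotient.eq] at hw
  obtain ⟨e, -, he⟩ := hE.exact_p _ hw (by rw [map_sub, M.dp_jp, M.swap.dm_dp, sub_zero])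
  have h1 : jp h = dm (e + w) := by rw [map_add, he, sub_add_cancel]
  have h2 : jp h = 0 := Submodule.disjoint_def.1 M.disj_p _ ⟨h, rfl⟩ ⟨_, h1.symm⟩
  exact M.inj_p (h2.trans (map_zero jp).symm)

theorem HodgeModel.descend_aux (M : HodgeModel dp dm jp jm) (hE : AcyclicSub dp dm Ep Em) :
    Function.Injective (Ep.mkQ ∘ₗ jp) ∧
    Disjoint (LinearMap.range (Ep.mkQ ∘ₗ jp)) (LinearMap.range (Em.mapQ Ep dm hE.map_m)) ∧
    LinearMap.range (Ep.mkQ ∘ₗ jp) ⊔ LinearMap.range (Em.mapQ Ep dm hE.map_m) =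
      LinearMap.ker (Ep.mapQ Em dp hE.map_p) := by
  refine ⟨?_, ?_, ?_⟩
  · rw [← LinearMap.ker_eq_bot, LinearMap.ker_eq_bot']
    intro h hh
    exact M.eq_zero_of_mkQ_eq hE (w := 0) (by rw [map_zero, map_zero]; exact hh)
  · rw [Submodule.disjoint_def]
    rintro _ ⟨h, rfl⟩ ⟨w, hw⟩
    obtain ⟨w, rfl⟩ := Em.mkQ_surjective w
    have : h = 0 := M.eq_zero_of_mkQ_eq hE hw.symm
    rw [this, map_zero]
  · apply le_antisymm
    · rw [sup_le_iff]
      constructor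
      · rintro _ ⟨h, rfl⟩
        change Em.mkQ (dp (jp h)) = 0
        rw [M.dp_jp, map_zero]
      · rintro _ ⟨w, rfl⟩
        obtain ⟨w, rfl⟩ := Em.mkQ_surjective w
        change Em.mkQ (dp (dm w)) = 0
        rw [M.swap.dm_dp, map_zero]
    · intro x hx
      obtain ⟨x, rfl⟩ := Ep.mkQ_surjective x
      have hx' : dp x ∈ Em := (Submodule.Quotient.mk_eq_zero _).1 hx
      -- A cycle of the quotient is corrected by an element of `Ep` to a genuine cycle, which then
      -- decomposes.
      obtain ⟨e, he, hex⟩ := hE.exact_m _ hx' (M.dm_dp x)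
      have h1 : x - e ∈ LinearMap.ker dp := by simp [hex]
      rw [← M.sup_p] at h1
      obtain ⟨_, ⟨h, rfl⟩, _, ⟨w, rfl⟩, hhw⟩ := Submodule.mem_sup.1 h1
      have h2 : Ep.mkQ x = Ep.mkQ (jp h) + Ep.mkQ (dm w) := by
        have h3 : Ep.mkQ e = 0 := (Submodule.Quotient.mk_eq_zero Ep).2 he
        rw [← map_add, hhw, map_sub, h3, sub_zero]
      rw [h2]
      exact add_mem (Submodule.mem_sup_left ⟨h, rfl⟩)
        (Submodule.mem_sup_right ⟨Em.mkQ w, rfl⟩)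

/-- The quotient by an acyclic subcomplex has the same homology. -/
theorem HodgeModel.descend (M : HodgeModel dp dm jp jm) (hE : AcyclicSub dp dm Ep Em) :
    HodgeModel (Ep.mapQ Em dp hE.map_p) (Em.mapQ Ep dm hE.map_m) (Ep.mkQ ∘ₗ jp) (Em.mkQ ∘ₗ jm) :=
  have hp := M.descend_aux hE
  have hm := M.swap.descend_aux hE.swap
  ⟨hp.1, hm.1, hp.2.1, hm.2.1, hp.2.2, hm.2.2⟩

end

/-- Sylvester's determinant identity, between spaces of possibly different dimension. -/
theorem det_one_sub_comp_comm [FiniteDimensional F V] [FiniteDimensional F W] (a : V →ₗ[F] W)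
    (b : W →ₗ[F] V) :
    LinearMap.det (LinearMap.id - a ∘ₗ b) = LinearMap.det (LinearMap.id - b ∘ₗ a) := by
  let v := finBasis F V
  let w := finBasis F W
  rw [← LinearMap.det_toMatrix w, ← LinearMap.det_toMatrix v, map_sub, map_sub,
    LinearMap.toMatrix_comp w v w, LinearMap.toMatrix_comp v w v, LinearMap.toMatrix_id,
    LinearMap.toMatrix_id, Matrix.det_one_sub_mul_comm]

variable {R : Submodule F W} [FiniteDimensional F (W ⧸ R)] {T : W →ₗ[F] W}

theorem finiteRank_id_sub (hT : ∀ x ∈ R, T x = x) : FiniteRank (LinearMap.id - T) := by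
  have hle : R ≤ LinearMap.ker (LinearMap.id - T) := fun x hx => by simp [hT x hx]
  rw [FiniteRank, ← Submodule.range_liftQ R _ hle]
  infer_instance

/-- The map `1 - T` kills `R`. It induces `a : W ⧸ R → Im (1 - T)`, and with `b : Im (1 - T) → W ⧸
R` the products `a b` and `b a` are `1 - T` on its image and on the quotient. Sylvester's identity
compares the two determinants. -/
theorem detClassDet_eq (hT : ∀ x ∈ R, T x = x) :
    detClassDet T = LinearMap.det (R.mapQ R T (fun x hx => by simpa [hT x hx] using hx)) := by
  have hle : R ≤ LinearMap.ker (LinearMap.id - T) := fun x hx => by simp [hT x hx]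
  have : FiniteDimensional F (LinearMap.range (LinearMap.id - T)) := finiteRank_id_sub hT
  let a : (W ⧸ R) →ₗ[F] LinearMap.range (LinearMap.id - T) :=
    R.liftQ (LinearMap.rangeRestrict (LinearMap.id - T)) (by simpa using hle)
  let b : LinearMap.range (LinearMap.id - T) →ₗ[F] W ⧸ R := R.mkQ ∘ₗ Submodule.subtype _
  have h := det_one_sub_comp_comm a b
  rw [detClassDet]
  convert h using 2
  · ext x
    simp [a, b]
  · ext x
    simp [a, b]

/-- `T` is the identity on `R` and invertible on `W ⧸ R`, as in the five lemma. -/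
theorem bijective_of_mapQ (hT : ∀ x ∈ R, T x = x)
    (h : LinearMap.det (R.mapQ R T (fun x hx => by simpa [hT x hx] using hx)) ≠ 0) :
    Function.Bijective T := by
  have hb : Function.Bijective (R.mapQ R T (fun x hx => by simpa [hT x hx] using hx)) :=
    (LinearEquiv.ofIsUnitDet (v := finBasis F _) (v' := finBasis F _) (f := R.mapQ R T _) (by rw [LinearMap.det_toMatrix]; exact h.isUnit)).bijective
  constructor
  · rw [← LinearMap.ker_eq_bot, LinearMap.ker_eq_bot']
    intro x hx
    have h1 : R.mkQ x = 0 := hb.1 (by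
      rw [map_zero]; exact congrArg R.mkQ hx |>.trans (map_zero _))
    rw [← hT x ((Submodule.Quotient.mk_eq_zero _).1 h1), hx]
  · intro y
    obtain ⟨x, hx⟩ := hb.2 (R.mkQ y)
    obtain ⟨x, rfl⟩ := R.mkQ_surjective x
    have h1 : T x - y ∈ R := (Submodule.Quotient.eq R).1 hx
    exact ⟨x - (T x - y), by rw [map_sub, hT _ h1, sub_sub_cancel]⟩

end Descent

end PerturbationIso

namespace PerturbationIso

open ExteriorAlgebra Module

/-! ### Perturbation formulas as identities between torsions of operators, in finite dimensions. -/

section OperatorTorsion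

variable {F : Type*} [Field F]
  {U : Type*} [AddCommGroup U] [Module F U]
  {U' : Type*} [AddCommGroup U'] [Module F U']
  {V : Type*} [AddCommGroup V] [Module F V]
  {W : Type*} [AddCommGroup W] [Module F W]

/-- Both maps are changed at once by working with `f.coprod g` on `U × U'`. -/
theorem mul_map_mul_map_eq_of_sub_mem {k : ExteriorAlgebra F V} {R : Submodule F V}
    (hk : ∀ v ∈ R, k * ι F v = 0) {f f' : U →ₗ[F] V} {g g' : U' →ₗ[F] V}
    (hf : ∀ u, f u - f' u ∈ R) (hg : ∀ u, g u - g' u ∈ R)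
    (x : ExteriorAlgebra F U) (y : ExteriorAlgebra F U') :
    k * (map f x * map g y) = k * (map f' x * map g' y) := by
  have h := mul_map_eq_of_sub_mem (k := k) (f := f.coprod g) (g := f'.coprod g')
    (fun u => hk _ (by
      simp only [LinearMap.coprod_apply, add_sub_add_comm]
      exact add_mem (hf _) (hg _)))
    (map (LinearMap.inl F U U') x * map (LinearMap.inr F U U') y)
  simpa only [map_mul, map_map_apply, LinearMap.coprod_inl, LinearMap.coprod_inr] using h

theorem mul_map_eq_of_sub_mem' {k : ExteriorAlgebra F V} {R : Submodule F V}
    (hk : ∀ v ∈ R, k * ι F v = 0) {f f' : U →ₗ[F] V} (hf : ∀ u, f u - f' u ∈ R)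
    (x : ExteriorAlgebra F U) : k * map f x = k * map f' x :=
  mul_map_eq_of_sub_mem (fun u => hk _ (hf u)) x

theorem coe_detMap {f : U →ₗ[F] V} (h : finrank F U = finrank F V) (u : DetLine F U) :
    (detMap f u : ExteriorAlgebra F V) = map f (u : ExteriorAlgebra F U) :=
  topPart_of_mem (h ▸ map_mem f u.2)

theorem coe_detWedge {f : U →ₗ[F] V} {g : U' →ₗ[F] V}
    (h : finrank F U + finrank F U' = finrank F V) (u : DetLine F U) (u' : DetLine F U') :
    (detWedge f u g u' : ExteriorAlgebra F V) =
      map f (u : ExteriorAlgebra F U) * map g (u' : ExteriorAlgebra F U') :=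
  topPart_of_mem (h ▸ mul_mem_exteriorPower (map_mem f u.2) (map_mem g u'.2))

theorem finrank_range_zero : finrank F (LinearMap.range (0 : V →ₗ[F] W)) = 0 := by
  rw [LinearMap.range_zero, finrank_bot]

variable {KA : Type*} [AddCommGroup KA] [Module F KA]
  {KB : Type*} [AddCommGroup KB] [Module F KB]
  {CA : Type*} [AddCommGroup CA] [Module F CA]
  {CB : Type*} [AddCommGroup CB] [Module F CB]
  [FiniteDimensional F V] [FiniteDimensional F W]
  [FiniteDimensional F KA] [FiniteDimensional F KB]
  [FiniteDimensional F CA] [FiniteDimensional F CB]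
  {A B : V →ₗ[F] W} {κA : KA →ₗ[F] V} {κB : KB →ₗ[F] V} {jA : CA →ₗ[F] W} {jB : CB →ₗ[F] W}

theorem one_mem_exteriorPower_range_zero :
    (1 : ExteriorAlgebra F W) ∈ ⋀[F]^(finrank F (LinearMap.range (0 : W →ₗ[F] V))) W := by
  rw [finrank_range_zero]
  exact SetLike.GradedOne.one_mem (A := fun n => ⋀[F]^n W)

/-- With zero as second differential, `1` is an admissible `ym`, and the torsion is the quotient of
`y ∧ κA s` by `A y ∧ jA c`. -/
theorem IsTorsion.op {Φ : DetLine F KA ⊗[F] Dual F (DetLine F CA) →ₗ[F] F}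
    (hΦ : IsTorsion A 0 κA jA Φ) {y : ExteriorAlgebra F V}
    (hy : y ∈ ⋀[F]^(finrank F (LinearMap.range A)) V) (s : DetLine F KA)
    (φ : Dual F (DetLine F CA)) (c : DetLine F CA) :
    Φ (s ⊗ₜ φ) * volume F W (map A y * map jA (c : ExteriorAlgebra F CA)) =
      volume F V (y * map κA (s : ExteriorAlgebra F KA)) * φ c := by
  simpa [torsionDen, torsionNum] using
    hΦ y hy 1 one_mem_exteriorPower_range_zero s φ c

theorem HodgeModel.op_den_ne_zero (M : HodgeModel A 0 κA jA) {y : ExteriorAlgebra F V}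
    (hy : y ∈ ⋀[F]^(finrank F (LinearMap.range A)) V) (hy0 : map A y ≠ 0) {c : DetLine F CA}
    (hc : c ≠ 0) : volume F W (map A y * map jA (c : ExteriorAlgebra F CA)) ≠ 0 := by
  simpa [torsionDen] using
    M.torsionDen_ne_zero hy one_mem_exteriorPower_range_zero hy0 (by simp) hc

theorem HodgeModel.op_num_ne_zero (M : HodgeModel A 0 κA jA) {y : ExteriorAlgebra F V}
    (hy : y ∈ ⋀[F]^(finrank F (LinearMap.range A)) V) (hy0 : map A y ≠ 0) {s : DetLine F KA}
    (hs : s ≠ 0) : volume F V (y * map κA (s : ExteriorAlgebra F KA)) ≠ 0 := by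
  simpa [torsionNum] using
    M.torsionNum_ne_zero hy one_mem_exteriorPower_range_zero hy0 (by simp) hs

theorem HodgeModel.op_finrank (M : HodgeModel A 0 κA jA) :
    finrank F (LinearMap.range A) + finrank F KA = finrank F V := by
  rw [M.finrank_eq, finrank_range_zero, zero_add]

theorem HodgeModel.op_finrank' (M : HodgeModel A 0 κA jA) :
    finrank F (LinearMap.range A) + finrank F CA = finrank F W := by
  rw [M.swap.finrank_eq, finrank_range_zero, zero_add]

theorem finrank_range_comp_le (f : V →ₗ[F] W) (g : W →ₗ[F] V) :
    finrank F (LinearMap.range (g ∘ₗ f)) ≤ finrank F (LinearMap.range f) := by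
  rw [LinearMap.range_comp]
  exact Submodule.finrank_map_le g _

variable {T₀ : Type*} [AddCommGroup T₀] [Module F T₀] [FiniteDimensional F T₀]
  {T₁ : Type*} [AddCommGroup T₁] [Module F T₁] [FiniteDimensional F T₁]
  {T : Type*} [AddCommGroup T] [Module F T] [FiniteDimensional F T]

/-- Here `H` plays the role of `A + L P_A`. The functional `f z = vol (H z ∧ n₁ t₁)` is evaluated on
two vectors of top degree in `V`. On `y ∧ κA s` it gives the denominator for `A`; on `x ∧ m₀ t₀` it
gives the volume of `S` applied to the denominator for `B`, whence `det S`. The volumes of these two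
vectors are the numerators, and proportionality gives the identity. -/
theorem nonpos_torsion (MA : HodgeModel A 0 κA jA) (MB : HodgeModel B 0 κB jB)
    {ΦA : DetLine F KA ⊗[F] Dual F (DetLine F CA) →ₗ[F] F} (hΦA : IsTorsion A 0 κA jA ΦA)
    {ΦB : DetLine F KB ⊗[F] Dual F (DetLine F CB) →ₗ[F] F} (hΦB : IsTorsion B 0 κB jB ΦB)
    {A' B' : W →ₗ[F] V} {H : V →ₗ[F] W} {S : W →ₗ[F] W}
    (hA : A ∘ₗ A' ∘ₗ A = A) (hB : B ∘ₗ B' ∘ₗ B = B) (hHA : H ∘ₗ A' ∘ₗ A = A)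
    (hSB : S ∘ₗ B = H ∘ₗ B' ∘ₗ B) {l : KA →ₗ[F] W} (hHκ : H ∘ₗ κA = l)
    {m₀ : T₀ →ₗ[F] V} {i₀ : T₀ →ₗ[F] W} {i₁ n₁ : T₁ →ₗ[F] W}
    (hS₀ : S ∘ₗ i₀ = H ∘ₗ m₀) (hS₁ : S ∘ₗ i₁ = n₁)
    {cA : KA →ₗ[F] CA} {dA : T₁ →ₗ[F] CA} {c₀ : T₀ →ₗ[F] CB} {c₁ : T₁ →ₗ[F] CB}
    {k₀ : T₀ →ₗ[F] KB}
    (hcA : ∀ u, l u - (jA ∘ₗ cA) u ∈ LinearMap.range A)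
    (hdA : ∀ u, n₁ u - (jA ∘ₗ dA) u ∈ LinearMap.range A)
    (hc₀ : ∀ u, i₀ u - (jB ∘ₗ c₀) u ∈ LinearMap.range B)
    (hc₁ : ∀ u, i₁ u - (jB ∘ₗ c₁) u ∈ LinearMap.range B)
    (hk₀ : ∀ u, m₀ u - (κB ∘ₗ k₀) u ∈ LinearMap.range (B' ∘ₗ B))
    (dimA : finrank F KA + finrank F T₁ = finrank F CA)
    (dimB : finrank F T₀ + finrank F T₁ = finrank F CB)
    (dimK : finrank F T₀ = finrank F KB)
    (s : DetLine F KA) (t₀ : DetLine F T₀) (t₁ : DetLine F T₁)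
    {φ : Dual F (DetLine F CA)} {ψ : Dual F (DetLine F CB)}
    (hφ : φ (detWedge cA s dA t₁) = 1) (hψ : ψ (detWedge c₀ t₀ c₁ t₁) = 1) :
    LinearMap.det S * ΦA (s ⊗ₜ φ) = ΦB (detMap k₀ t₀ ⊗ₜ ψ) := by
  obtain ⟨y₀, hy₀, hy0⟩ := exists_map_ne_zero A
  obtain ⟨x₀, hx₀, hx0⟩ := exists_map_ne_zero B
  -- The frames are moved into the images of the pseudo-inverses, where `H` and `S` are known
  -- through `hHA` and `hSB`.
  set x := map (B' ∘ₗ B) x₀ with hx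
  set y := map (A' ∘ₗ A) y₀ with hy
  have hAy : map A y = map A y₀ := by rw [hy, map_map_apply, hA]
  have hBx : map B x = map B x₀ := by rw [hx, map_map_apply, hB]
  have hym := map_mem (A' ∘ₗ A) hy₀
  have hxm := map_mem (B' ∘ₗ B) hx₀
  have hcwA : detWedge cA s dA t₁ ≠ 0 := by intro h; rw [h, map_zero] at hφ; exact zero_ne_one hφ
  have hcwB : detWedge c₀ t₀ c₁ t₁ ≠ 0 := by
    intro h; rw [h, map_zero] at hψ; exact zero_ne_one hψ
  have h1 := hΦA.op hym s φ (detWedge cA s dA t₁)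
  have h2 := hΦB.op hxm (detMap k₀ t₀) ψ (detWedge c₀ t₀ c₁ t₁)
  have n1 := MA.op_den_ne_zero hy₀ hy0 hcwA
  have n2 := MB.op_den_ne_zero hx₀ hx0 hcwB
  rw [hφ, mul_one, hAy] at h1
  rw [hψ, mul_one, hBx] at h2
  -- the lifts of the cokernel vectors do not matter
  have e1 : map A y₀ * map jA (detWedge cA s dA t₁ : ExteriorAlgebra F CA) =
      map A y₀ * (map l (s : ExteriorAlgebra F KA) * map n₁ (t₁ : ExteriorAlgebra F T₁)) := by
    rw [coe_detWedge dimA, map_mul, map_map_apply, map_map_apply]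
    exact (mul_map_mul_map_eq_of_sub_mem (fun v => map_mul_ι_eq_zero A le_rfl hy₀) hcA hdA _ _).symm
  have e2 : map B x₀ * map jB (detWedge c₀ t₀ c₁ t₁ : ExteriorAlgebra F CB) =
      map B x₀ * (map i₀ (t₀ : ExteriorAlgebra F T₀) * map i₁ (t₁ : ExteriorAlgebra F T₁)) := by
    rw [coe_detWedge dimB, map_mul, map_map_apply, map_map_apply]
    exact (mul_map_mul_map_eq_of_sub_mem (fun v => map_mul_ι_eq_zero B le_rfl hx₀) hc₀ hc₁ _ _).symm
  have e3 : x * map κB (detMap k₀ t₀ : ExteriorAlgebra F KB) =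
      x * map m₀ (t₀ : ExteriorAlgebra F T₀) := by
    rw [coe_detMap dimK, map_map_apply]
    exact (mul_map_eq_of_sub_mem' (fun v => map_mul_ι_eq_zero _ (finrank_range_comp_le B B') hx₀)
      hk₀ _).symm
  rw [e1] at h1 n1
  rw [e2] at h2 n2
  rw [e3] at h2
  let f : ExteriorAlgebra F V →ₗ[F] F := volume F W ∘ₗ
    LinearMap.mulRight F (map n₁ (t₁ : ExteriorAlgebra F T₁)) ∘ₗ (map H).toLinearMap
  have hf : ∀ z, f z = volume F W (map H z * map n₁ (t₁ : ExteriorAlgebra F T₁)) := fun _ => rfl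
  have key := apply_mul_volume_comm (x := x * map m₀ (t₀ : ExteriorAlgebra F T₀))
    (y := y * map κA (s : ExteriorAlgebra F KA))
    (by rw [← MB.op_finrank, ← dimK]; exact mul_mem_exteriorPower hxm (map_mem _ t₀.2))
    (by rw [← MA.op_finrank]; exact mul_mem_exteriorPower hym (map_mem _ s.2)) f
  have f1 : f (y * map κA (s : ExteriorAlgebra F KA)) = volume F W (map A y₀ *
      (map l (s : ExteriorAlgebra F KA) * map n₁ (t₁ : ExteriorAlgebra F T₁))) := by
    rw [hf, map_mul (map H), map_map_apply H κA, hHκ, hy, map_map_apply, hHA, mul_assoc]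
  have f2 : f (x * map m₀ (t₀ : ExteriorAlgebra F T₀)) = LinearMap.det S * volume F W (map B x₀ *
      (map i₀ (t₀ : ExteriorAlgebra F T₀) * map i₁ (t₁ : ExteriorAlgebra F T₁))) := by
    rw [← volume_map, hf]
    simp only [map_mul, map_map_apply, hS₀, hS₁, hSB, hx, mul_assoc]
  rw [f1, f2] at key
  apply mul_right_cancel₀ (mul_ne_zero n1 n2)
  linear_combination (LinearMap.det S) * h1 * volume F W (map B x₀ *
      (map i₀ (t₀ : ExteriorAlgebra F T₀) * map i₁ (t₁ : ExteriorAlgebra F T₁))) - h2 * volume F W (map A y₀ *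
      (map l (s : ExteriorAlgebra F KA) * map n₁ (t₁ : ExteriorAlgebra F T₁))) + key

/-- Dual to the previous argument: `G` plays the role of `B' + M Q_B`, and `g z = vol (n₀ s₀ ∧ G z)`
is evaluated on the denominators `A y₀ ∧ l₁ s₁` and `B x₀ ∧ i t` in `W`. Now `n₀ s₀` has to pass `G
(A y₀)` in one case and `B' (B x₀)` in the other, which produces the sign. -/
theorem nonneg_torsion (MA : HodgeModel A 0 κA jA) (MB : HodgeModel B 0 κB jB)
    {ΦA : DetLine F KA ⊗[F] Dual F (DetLine F CA) →ₗ[F] F} (hΦA : IsTorsion A 0 κA jA ΦA)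
    {ΦB : DetLine F KB ⊗[F] Dual F (DetLine F CB) →ₗ[F] F} (hΦB : IsTorsion B 0 κB jB ΦB)
    {A' B' : W →ₗ[F] V} {G : W →ₗ[F] V} {S : V →ₗ[F] V}
    (hA : A ∘ₗ A' ∘ₗ A = A) (hB : B ∘ₗ B' ∘ₗ B = B) (hGB : G ∘ₗ B = B' ∘ₗ B)
    (hSA : S ∘ₗ A' ∘ₗ A = G ∘ₗ A)
    {a₀ : T₀ →ₗ[F] KA} {a₁ : T₁ →ₗ[F] KA} {n₀ : T₀ →ₗ[F] V} {l₁ : T₁ →ₗ[F] W}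
    {i : T →ₗ[F] W} {m : T →ₗ[F] V}
    (hS₀ : S ∘ₗ κA ∘ₗ a₀ = n₀) (hS₁ : S ∘ₗ κA ∘ₗ a₁ = G ∘ₗ l₁) (hG : G ∘ₗ i = m)
    {cA : T₁ →ₗ[F] CA} {cB : T →ₗ[F] CB} {k₀ : T₀ →ₗ[F] KB} {k₁ : T →ₗ[F] KB}
    (hcA : ∀ u, l₁ u - (jA ∘ₗ cA) u ∈ LinearMap.range A)
    (hcB : ∀ u, i u - (jB ∘ₗ cB) u ∈ LinearMap.range B)
    (hk₀ : ∀ u, n₀ u - (κB ∘ₗ k₀) u ∈ LinearMap.range (B' ∘ₗ B))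
    (hk₁ : ∀ u, m u - (κB ∘ₗ k₁) u ∈ LinearMap.range (B' ∘ₗ B))
    (dimA : finrank F T₁ = finrank F CA) (dimB : finrank F T = finrank F CB)
    (dimKA : finrank F T₀ + finrank F T₁ = finrank F KA)
    (dimKB : finrank F T₀ + finrank F T = finrank F KB)
    (s₀ : DetLine F T₀) (s₁ : DetLine F T₁) (t : DetLine F T)
    {φ : Dual F (DetLine F CA)} {ψ : Dual F (DetLine F CB)}
    (hφ : φ (detMap cA s₁) = 1) (hψ : ψ (detMap cB t) = 1) :
    LinearMap.det S * ΦA (detWedge a₀ s₀ a₁ s₁ ⊗ₜ φ) =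
      (-1) ^ (finrank F T₀ * (finrank F KA + finrank F KB)) *
        ΦB (detWedge k₀ s₀ k₁ t ⊗ₜ ψ) := by
  obtain ⟨y₀, hy₀, hy0⟩ := exists_map_ne_zero A
  obtain ⟨x₀, hx₀, hx0⟩ := exists_map_ne_zero B
  set x := map (B' ∘ₗ B) x₀ with hx
  set y := map (A' ∘ₗ A) y₀ with hy
  have hAy : map A y = map A y₀ := by rw [hy, map_map_apply, hA]
  have hBx : map B x = map B x₀ := by rw [hx, map_map_apply, hB]
  have hym := map_mem (A' ∘ₗ A) hy₀
  have hxm := map_mem (B' ∘ₗ B) hx₀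
  have hcwA : detMap cA s₁ ≠ 0 := by intro h; rw [h, map_zero] at hφ; exact zero_ne_one hφ
  have hcwB : detMap cB t ≠ 0 := by intro h; rw [h, map_zero] at hψ; exact zero_ne_one hψ
  have h1 := hΦA.op hym (detWedge a₀ s₀ a₁ s₁) φ (detMap cA s₁)
  have h2 := hΦB.op hxm (detWedge k₀ s₀ k₁ t) ψ (detMap cB t)
  have n1 := MA.op_den_ne_zero hy₀ hy0 hcwA
  have n2 := MB.op_den_ne_zero hx₀ hx0 hcwB
  rw [hφ, mul_one, hAy] at h1
  rw [hψ, mul_one, hBx] at h2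
  have e1 : map A y₀ * map jA (detMap cA s₁ : ExteriorAlgebra F CA) =
      map A y₀ * map l₁ (s₁ : ExteriorAlgebra F T₁) := by
    rw [coe_detMap dimA, map_map_apply]
    exact (mul_map_eq_of_sub_mem' (fun v => map_mul_ι_eq_zero A le_rfl hy₀) hcA _).symm
  have e2 : map B x₀ * map jB (detMap cB t : ExteriorAlgebra F CB) =
      map B x₀ * map i (t : ExteriorAlgebra F T) := by
    rw [coe_detMap dimB, map_map_apply]
    exact (mul_map_eq_of_sub_mem' (fun v => map_mul_ι_eq_zero B le_rfl hx₀) hcB _).symm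
  have e3 : x * map κB (detWedge k₀ s₀ k₁ t : ExteriorAlgebra F KB) =
      x * (map n₀ (s₀ : ExteriorAlgebra F T₀) * map m (t : ExteriorAlgebra F T)) := by
    rw [coe_detWedge dimKB, map_mul, map_map_apply, map_map_apply]
    exact (mul_map_mul_map_eq_of_sub_mem
      (fun v => map_mul_ι_eq_zero _ (finrank_range_comp_le B B') hx₀) hk₀ hk₁ _ _).symm
  rw [e1] at h1 n1
  rw [e2] at h2 n2
  rw [e3] at h2
  let g : ExteriorAlgebra F W →ₗ[F] F := volume F V ∘ₗ
    LinearMap.mulLeft F (map n₀ (s₀ : ExteriorAlgebra F T₀)) ∘ₗ (map G).toLinearMap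
  have hg : ∀ z, g z = volume F V (map n₀ (s₀ : ExteriorAlgebra F T₀) * map G z) := fun _ => rfl
  have key := apply_mul_volume_comm (x := map A y₀ * map l₁ (s₁ : ExteriorAlgebra F T₁))
    (y := map B x₀ * map i (t : ExteriorAlgebra F T))
    (by rw [← MA.op_finrank', ← dimA]; exact mul_mem_exteriorPower (map_mem _ hy₀) (map_mem _ s₁.2))
    (by rw [← MB.op_finrank', ← dimB]; exact mul_mem_exteriorPower (map_mem _ hx₀) (map_mem _ t.2))
    g
  have g1 : LinearMap.det S *
      volume F V (y * map κA (detWedge a₀ s₀ a₁ s₁ : ExteriorAlgebra F KA)) =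
      (-1) ^ (finrank F (LinearMap.range A) * finrank F T₀) *
        g (map A y₀ * map l₁ (s₁ : ExteriorAlgebra F T₁)) := by
    rw [← volume_map, hg, coe_detWedge dimKA]
    simp only [map_mul, map_map_apply, hS₀, hS₁, hSA, hy]
    rw [← mul_assoc, graded_comm (map_mem (G ∘ₗ A) hy₀) (map_mem n₀ s₀.2), smul_mul_assoc,
      map_smul, mul_assoc, smul_eq_mul]
  have g2 : g (map B x₀ * map i (t : ExteriorAlgebra F T)) =
      (-1) ^ (finrank F T₀ * finrank F (LinearMap.range B)) *
        volume F V (x * (map n₀ (s₀ : ExteriorAlgebra F T₀) * map m (t : ExteriorAlgebra F T))) := by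
    rw [hg]
    simp only [map_mul, map_map_apply, hG, hGB, hx]
    rw [← mul_assoc, graded_comm (map_mem n₀ s₀.2) (map_mem (B' ∘ₗ B) hx₀), smul_mul_assoc,
      map_smul, mul_assoc, smul_eq_mul]
  -- Rank and nullity of `A` add up to `dim V`, as do those of `B`; so the sum of the ranks and the
  -- sum of the nullities have equal parity.
  have hsign : ((-1 : F) ^ (finrank F (LinearMap.range A) * finrank F T₀)) *
      (-1) ^ (finrank F T₀ * finrank F (LinearMap.range B)) =
      (-1) ^ (finrank F T₀ * (finrank F KA + finrank F KB)) := by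
    have ha := MA.op_finrank
    have hb := MB.op_finrank
    rw [← pow_add, neg_one_pow_eq_pow_mod_two, neg_one_pow_eq_pow_mod_two (n := finrank F T₀ * _)]
    congr 1
    have h3 : finrank F (LinearMap.range A) * finrank F T₀ +
        finrank F T₀ * finrank F (LinearMap.range B) =
        finrank F T₀ * (finrank F (LinearMap.range A) + finrank F (LinearMap.range B)) := by ring
    rw [h3, Nat.mul_mod, Nat.mul_mod _ (finrank F KA + finrank F KB)]
    congr 2
    omega
  rw [← hsign]
  rw [g2] at key
  apply mul_right_cancel₀ (mul_ne_zero n1 n2)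
  generalize g (map A y₀ * map l₁ (s₁ : ExteriorAlgebra F T₁)) = g₀ at *
  linear_combination (LinearMap.det S) * h1 *
      volume F W (map B x₀ * map i (t : ExteriorAlgebra F T)) +
    g1 * volume F W (map B x₀ * map i (t : ExteriorAlgebra F T)) +
    ((-1 : F) ^ (finrank F (LinearMap.range A) * finrank F T₀)) * key -
    ((-1 : F) ^ (finrank F (LinearMap.range A) * finrank F T₀)) *
      (-1) ^ (finrank F T₀ * finrank F (LinearMap.range B)) * h2 *
      volume F W (map A y₀ * map l₁ (s₁ : ExteriorAlgebra F T₁))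

theorem HodgeModel.op_torsion_ne_zero (M : HodgeModel A 0 κA jA)
    {Φ : DetLine F KA ⊗[F] Dual F (DetLine F CA) →ₗ[F] F} (hΦ : IsTorsion A 0 κA jA Φ)
    {s : DetLine F KA} {φ : Dual F (DetLine F CA)} (hs : s ≠ 0) (hφ : φ ≠ 0) : Φ (s ⊗ₜ φ) ≠ 0 := by
  obtain ⟨y, hy, hy0⟩ := exists_map_ne_zero A
  obtain ⟨c, hc⟩ : ∃ c, φ c ≠ 0 := by
    by_contra! h
    exact hφ (LinearMap.ext h)
  intro h
  have h1 := hΦ.op hy s φ c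
  rw [h, zero_mul] at h1
  exact mul_ne_zero (M.op_num_ne_zero hy hy0 hs) hc h1.symm

end OperatorTorsion

end PerturbationIso

namespace PerturbationIso

open ExteriorAlgebra Module

/-! ### Pseudo-inverses and restriction to a common subspace of finite codimension. -/

section OperatorReduction

variable {F : Type*} [Field F]
  {V : Type*} [AddCommGroup V] [Module F V]
  {W : Type*} [AddCommGroup W] [Module F W]
  {A B : V →ₗ[F] W} {A' B' : W →ₗ[F] V}

theorem IsPseudoInverse.apply_apply (h : IsPseudoInverse A A') (x : V) : A (A' (A x)) = A x := by
  have h1 : x - A' (A x) ∈ LinearMap.ker A := h.range_right ▸ ⟨x, by simp⟩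
  rw [LinearMap.mem_ker, map_sub, sub_eq_zero] at h1
  exact h1.symm

theorem IsPseudoInverse.apply_apply' (h : IsPseudoInverse A A') (x : W) :
    A' (A (A' x)) = A' x := by
  have h1 : x - A (A' x) ∈ LinearMap.ker A' := h.range_coker ▸ ⟨x, by simp⟩
  rw [LinearMap.mem_ker, map_sub, sub_eq_zero] at h1
  exact h1.symm

theorem IsPseudoInverse.of_apply_apply (h₁ : ∀ x, A (A' (A x)) = A x)
    (h₂ : ∀ x, A' (A (A' x)) = A' x) : IsPseudoInverse A A' where
  idem_left := by ext x; simp [h₁]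
  idem_right := by ext x; simp [h₁]
  range_left := by
    apply le_antisymm (LinearMap.range_comp_le_range _ _)
    rintro _ ⟨x, rfl⟩
    exact ⟨A x, h₁ x⟩
  range_right := by
    ext x
    constructor
    · rintro ⟨x, rfl⟩; simp [h₁]
    · intro hx; exact ⟨x, by simp [LinearMap.mem_ker.1 hx]⟩
  range_coker := by
    ext x
    constructor
    · rintro ⟨x, rfl⟩; simp [h₂]
    · intro hx; exact ⟨x, by simp [LinearMap.mem_ker.1 hx]⟩

theorem coe_kerProj (h : IsPseudoInverse A A') (x : V) :
    (kerProj A A' h x : V) = x - A' (A x) := rfl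

theorem coe_cokerProj (h : IsPseudoInverse A A') (x : W) :
    (cokerProj A A' h x : W) = x - A (A' x) := rfl

theorem kerProj_eq_zero_iff (h : IsPseudoInverse A A') (x : V) :
    kerProj A A' h x = 0 ↔ x ∈ LinearMap.range A' := by
  rw [← Subtype.coe_inj, coe_kerProj, Submodule.coe_zero, sub_eq_zero]
  constructor
  · intro hx; exact ⟨_, hx.symm⟩
  · rintro ⟨y, rfl⟩; exact (h.apply_apply' y).symm

theorem kerProj_coe (h : IsPseudoInverse A A') (x : LinearMap.ker A) :
    kerProj A A' h (x : V) = x := by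
  apply Subtype.ext
  rw [coe_kerProj, LinearMap.mem_ker.1 x.2, map_zero, sub_zero]

theorem kerProj_range (h : IsPseudoInverse A A') (w : W) : kerProj A A' h (A' w) = 0 :=
  (kerProj_eq_zero_iff h _).2 ⟨w, rfl⟩

theorem cokerProj_coe (h : IsPseudoInverse A A') (x : LinearMap.ker A') :
    cokerProj A A' h (x : W) = x := by
  apply Subtype.ext
  rw [coe_cokerProj, LinearMap.mem_ker.1 x.2, map_zero, sub_zero]

theorem cokerProj_range (h : IsPseudoInverse A A') (v : V) : cokerProj A A' h (A v) = 0 := by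
  apply Subtype.ext
  rw [coe_cokerProj, h.apply_apply, sub_self, Submodule.coe_zero]

/-- The complement `Ker A'` of `Im A` is the cokernel of `A`. -/
noncomputable def kerEquivCoker (h : IsPseudoInverse A A') : LinearMap.ker A' ≃ₗ[F] Coker A :=
  LinearEquiv.ofBijective ((LinearMap.range A).mkQ ∘ₗ (LinearMap.ker A').subtype) (by
    constructor
    · rw [← LinearMap.ker_eq_bot, LinearMap.ker_eq_bot']
      rintro x hx
      obtain ⟨v, hv⟩ := (Submodule.Quotient.mk_eq_zero _).1 hx
      have hv' : A v = x := hv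
      rw [← cokerProj_coe h x, ← hv', cokerProj_range]
    · intro c
      obtain ⟨w, rfl⟩ := Submodule.mkQ_surjective _ c
      refine ⟨cokerProj A A' h w, ?_⟩
      refine (Submodule.Quotient.eq _).2 ?_
      change w - A (A' w) - w ∈ _
      rw [sub_sub_cancel_left]
      exact neg_mem ⟨_, rfl⟩)

/-- The cokernel of `A'` is the kernel of `A`. -/
noncomputable def cokerEquivKer (h : IsPseudoInverse A A') : Coker A' ≃ₗ[F] LinearMap.ker A :=
  LinearEquiv.ofBijective ((LinearMap.range A').liftQ (kerProj A A' h)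
    (fun x hx => (kerProj_eq_zero_iff h x).2 hx)) (by
    constructor
    · rw [← LinearMap.ker_eq_bot, LinearMap.ker_eq_bot']
      intro x hx
      obtain ⟨x, rfl⟩ := Submodule.mkQ_surjective _ x
      exact (Submodule.Quotient.mk_eq_zero _).2 ((kerProj_eq_zero_iff h x).1 hx)
    · intro x
      exact ⟨(LinearMap.range A').mkQ (x : V), kerProj_coe h x⟩)

theorem cokerEquivKer_mkQ (h : IsPseudoInverse A A') (x : V) :
    cokerEquivKer h ((LinearMap.range A').mkQ x) = kerProj A A' h x := rfl

theorem finrank_eq_of_coprod {U U' X : Type*} [AddCommGroup U] [Module F U] [AddCommGroup U']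
    [Module F U'] [AddCommGroup X] [Module F X] [FiniteDimensional F U] [FiniteDimensional F U']
    {f : U →ₗ[F] X} {g : U' →ₗ[F] X} (h : Function.Bijective (f.coprod g)) :
    finrank F U + finrank F U' = finrank F X := by
  rw [← finrank_prod, (LinearEquiv.ofBijective _ h).finrank_eq]

theorem injective_coprod_of_isCompl {U X : Type*} [AddCommGroup U] [Module F U] [AddCommGroup X]
    [Module F X] {P Q : Submodule F U} (h : IsCompl P Q) {f : U →ₗ[F] X}
    (hf : Function.Injective f) :
    Function.Injective ((f ∘ₗ P.subtype).coprod (f ∘ₗ Q.subtype)) := by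
  have h1 : (f ∘ₗ P.subtype).coprod (f ∘ₗ Q.subtype) =
      f ∘ₗ (Submodule.prodEquivOfIsCompl P Q h).toLinearMap := by
    ext <;> simp
  rw [h1]
  exact hf.comp (LinearEquiv.injective _)

/-- If `f₁` is bijective modulo `R ⊔ range f₂` and `f₂` is injective modulo `R`, then together they
form a basis of the quotient by `R`. -/
theorem bijective_coprod_mkQ {U U' X : Type*} [AddCommGroup U] [Module F U] [AddCommGroup U']
    [Module F U'] [AddCommGroup X] [Module F X] {R : Submodule F X} {f : U →ₗ[F] X}
    {g : U' →ₗ[F] X} (hf : Function.Injective (R.mkQ ∘ₗ f))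
    (hg : Function.Bijective ((R ⊔ LinearMap.range f).mkQ ∘ₗ g)) :
    Function.Bijective ((R.mkQ ∘ₗ f).coprod (R.mkQ ∘ₗ g)) := by
  constructor
  · rw [← LinearMap.ker_eq_bot, LinearMap.ker_eq_bot']
    rintro ⟨u, u'⟩ h0
    simp only [LinearMap.coprod_apply, LinearMap.comp_apply] at h0
    rw [← map_add] at h0
    have h1 : f u + g u' ∈ R := (Submodule.Quotient.mk_eq_zero _).1 h0
    have h2 : u' = 0 := hg.1 (by
      rw [map_zero]
      refine (Submodule.Quotient.mk_eq_zero _).2 ?_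
      have h3 : g u' = (f u + g u') - f u := by abel
      rw [h3]
      exact sub_mem (Submodule.mem_sup_left h1) (Submodule.mem_sup_right ⟨u, rfl⟩))
    subst h2
    rw [map_zero, add_zero] at h0
    have h4 : u = 0 := hf (by rw [map_zero]; exact h0)
    rw [h4]; rfl
  · intro x
    obtain ⟨x, rfl⟩ := R.mkQ_surjective x
    obtain ⟨u', hu'⟩ := hg.2 ((R ⊔ LinearMap.range f).mkQ x)
    have h1 : x - g u' ∈ R ⊔ LinearMap.range f := (Submodule.Quotient.eq _).1 hu'.symm
    obtain ⟨r, hr, _, ⟨u, rfl⟩, hru⟩ := Submodule.mem_sup.1 h1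
    refine ⟨(u, u'), ?_⟩
    simp only [LinearMap.coprod_apply, LinearMap.comp_apply]
    rw [← map_add]
    refine (Submodule.Quotient.eq _).2 ?_
    have h3 : f u + g u' - x = - r := by
      rw [eq_sub_of_add_eq hru]; abel
    rw [h3]; exact neg_mem hr

theorem HodgeModel.ofSection {j : Coker A →ₗ[F] W}
    (hj : (LinearMap.range A).mkQ ∘ₗ j = LinearMap.id) :
    HodgeModel A 0 (LinearMap.ker A).subtype j where
  inj_p := Subtype.val_injective
  inj_m := (Function.LeftInverse.injective (LinearMap.congr_fun hj))
  disj_p := by simp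
  disj_m := by
    rw [Submodule.disjoint_def]
    rintro _ ⟨c, rfl⟩ hc
    have h1 : (LinearMap.range A).mkQ (j c) = 0 := (Submodule.Quotient.mk_eq_zero _).2 hc
    have h2 : c = 0 := (LinearMap.congr_fun hj c).symm.trans h1
    rw [h2, map_zero]
  sup_p := by simp
  sup_m := by
    rw [LinearMap.ker_zero, eq_top_iff]
    intro w _
    rw [← sub_add_cancel w (j ((LinearMap.range A).mkQ w)), add_comm]
    refine add_mem (Submodule.mem_sup_left ⟨_, rfl⟩) (Submodule.mem_sup_right ?_)
    refine (Submodule.Quotient.eq _).1 ?_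
    exact (LinearMap.congr_fun hj _).symm

theorem sub_section_mem {j : Coker A →ₗ[F] W}
    (hj : (LinearMap.range A).mkQ ∘ₗ j = LinearMap.id) (w : W) :
    w - j ((LinearMap.range A).mkQ w) ∈ LinearMap.range A :=
  (Submodule.Quotient.eq _).1 (LinearMap.congr_fun hj _).symm

/-- `A` restricts to a bijection `E → R` with inverse the restriction of `A'`. -/
structure RestrictsTo (A : V →ₗ[F] W) (A' : W →ₗ[F] V) (E : Submodule F V)
    (R : Submodule F W) : Prop where
  map_mem : E ≤ R.comap A
  left_inv : ∀ e ∈ E, A' (A e) = e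
  surj : ∀ r ∈ R, ∃ e ∈ E, A e = r

variable {E : Submodule F V} {R : Submodule F W}

theorem RestrictsTo.map_mem' (h : RestrictsTo A A' E R) : R ≤ E.comap A' := by
  intro r hr
  obtain ⟨e, he, rfl⟩ := h.surj r hr
  rwa [Submodule.mem_comap, h.left_inv e he]

theorem RestrictsTo.acyclic (h : RestrictsTo A A' E R) : AcyclicSub A 0 E R where
  map_p := h.map_mem
  map_m := fun _ _ => by simp
  exact_p := fun x hx h0 => ⟨0, zero_mem _, by rw [← h.left_inv x hx, h0, map_zero, map_zero]⟩
  exact_m := fun x hx _ => h.surj x hx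

theorem mapQ_zero_eq (h : R ≤ E.comap (0 : W →ₗ[F] V)) : R.mapQ E 0 h = 0 := by
  ext; simp

theorem RestrictsTo.model (h : RestrictsTo A A' E R) {j : Coker A →ₗ[F] W}
    (hj : (LinearMap.range A).mkQ ∘ₗ j = LinearMap.id) :
    HodgeModel (E.mapQ R A h.map_mem) 0 (E.mkQ ∘ₗ (LinearMap.ker A).subtype) (R.mkQ ∘ₗ j) := by
  have h1 := (HodgeModel.ofSection hj).descend h.acyclic
  rwa [mapQ_zero_eq] at h1

/-- The pair `E → R` is acyclic, so the induced map on quotients has the same kernel and cokernel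
dimensions. The right side does not involve `A`: operators restricting to the same pair have the
same index. -/
theorem RestrictsTo.index_eq (h : RestrictsTo A A' E R) [FiniteDimensional F (V ⧸ E)]
    [FiniteDimensional F (W ⧸ R)] [FiniteDimensional F (LinearMap.ker A)]
    [FiniteDimensional F (Coker A)] :
    index A = (finrank F (V ⧸ E) : ℤ) - finrank F (W ⧸ R) := by
  obtain ⟨j, hj⟩ := (LinearMap.range A).mkQ.exists_rightInverse_of_surjective
    (Submodule.range_mkQ _)
  have h1 := (h.model hj).op_finrank
  have h2 := (h.model hj).op_finrank'
  rw [index]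
  omega

/-- The sign by which the perturbation isomorphism differs from the quotient of torsions. -/
noncomputable def indexSign (A B : V →ₗ[F] W) : F :=
  (-1) ^ ((index A).toNat * (finrank F (LinearMap.ker A) + finrank F (LinearMap.ker B)))

theorem eq_of_apply_eq {L : Type*} [AddCommGroup L] [Module F L] (hL : finrank F L = 1)
    {f g : L →ₗ[F] F} {v : L} (hv : v ≠ 0) (h : f v = g v) : f = g := by
  ext w
  obtain ⟨a, rfl⟩ := (finrank_eq_one_iff_of_nonzero' v hv).1 hL w
  rw [map_smul, map_smul, h]

/-- On a line one non-zero value determines a functional, so a formula need only be tested on one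
non-zero tensor. -/
theorem line_ext {K C : Type*} [AddCommGroup K] [Module F K] [AddCommGroup C] [Module F C]
    [FiniteDimensional F K] [FiniteDimensional F C]
    {f g : DetLine F K ⊗[F] Dual F (DetLine F C) →ₗ[F] F}
    {v : DetLine F K ⊗[F] Dual F (DetLine F C)} (hg : g v ≠ 0) (h : f v = g v) : f = g := by
  have h1 : finrank F (DetLine F K ⊗[F] Dual F (DetLine F C)) = 1 := finrank_line
  have h2 := eq_of_apply_eq (f := f) (g := g) (v := v)
  specialize h2 h1
  exact h2 (fun h0 => hg (by rw [h0, map_zero])) h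

end OperatorReduction

end PerturbationIso

namespace PerturbationIso

open ExteriorAlgebra Module

/-! ### Perturbation maps of Fredholm operators characterized by torsions. -/

section OperatorPerturbation

variable {F : Type*} [Field F]
  {V : Type*} [AddCommGroup V] [Module F V]
  {W : Type*} [AddCommGroup W] [Module F W]
  {A B : V →ₗ[F] W} {A' B' : W →ₗ[F] V}
  [FiniteDimensional F (LinearMap.ker A)] [FiniteDimensional F (LinearMap.ker B)]
  [FiniteDimensional F (Coker A)] [FiniteDimensional F (Coker B)]
  {E : Submodule F V} {R : Submodule F W}
  [FiniteDimensional F (V ⧸ E)] [FiniteDimensional F (W ⧸ R)]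

theorem mapQ_sub_mem_range (hAE : E ≤ R.comap A) {w w' : W} (h : w - w' ∈ LinearMap.range A) :
    R.mkQ w - R.mkQ w' ∈ LinearMap.range (E.mapQ R A hAE) := by
  obtain ⟨v, hv⟩ := h
  exact ⟨E.mkQ v, by rw [← map_sub, ← hv]; rfl⟩

theorem NonposTriple.bijective_coker (T : NonposTriple A B') :
    Function.Bijective (((LinearMap.range A).mkQ ∘ₗ T.L).coprod
      ((LinearMap.range A).mkQ ∘ₗ T.N ∘ₗ (LinearMap.ker T.M).subtype)) :=
  bijective_coprod_mkQ T.injective_L T.bijective_N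

section Nonpos

variable (T : NonposTriple A B') (hA : IsPseudoInverse A A') (hB : IsPseudoInverse B B')

/-- `M` is onto modulo `range B'`, and splitting `Ker B'` as `Ker M ⊕ Ker N` shows that `Ker N`
already suffices. -/
theorem NonposTriple.surjective_kerProj (hB : IsPseudoInverse B B') :
    Function.Surjective (kerProj B B' hB ∘ₗ T.M ∘ₗ (LinearMap.ker T.N).subtype) := by
  intro x
  obtain ⟨u, hu⟩ := T.surjective_M ((cokerEquivKer hB).symm x)
  have hu' : kerProj B B' hB (T.M u) = x := by
    rw [← cokerEquivKer_mkQ hB, show (LinearMap.range B').mkQ (T.M u) = _ from hu,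
      LinearEquiv.apply_symm_apply]
  obtain ⟨a, ha, b, hb, rfl⟩ := Submodule.mem_sup.1
    (T.compl_N.sup_eq_top ▸ Submodule.mem_top : u ∈ LinearMap.ker T.M ⊔ LinearMap.ker T.N)
  refine ⟨⟨b, hb⟩, ?_⟩
  rw [map_add, LinearMap.mem_ker.1 ha, zero_add] at hu'
  exact hu'

theorem NonposTriple.sigma_apply (w : W) : T.sigma hA hB w =
    A (B' w + T.M (cokerProj B B' hB w)) +
      T.L (kerProj A A' hA (B' w + T.M (cokerProj B B' hB w))) +
      T.N (cokerProj B B' hB w) := rfl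

theorem NonposTriple.sigma_apply_range (v : V) : T.sigma hA hB (B v) =
    A (B' (B v)) + T.L (kerProj A A' hA (B' (B v))) := by
  rw [T.sigma_apply, cokerProj_range, map_zero, map_zero, add_zero, add_zero]

theorem NonposTriple.sigma_apply_coe (w : LinearMap.ker B') : T.sigma hA hB (w : W) =
    A (T.M w) + T.L (kerProj A A' hA (T.M w)) + T.N w := by
  rw [T.sigma_apply, cokerProj_coe, LinearMap.mem_ker.1 w.2, zero_add]

theorem RestrictsTo.kerProj_eq_zero (hAE : RestrictsTo A A' E R) (hA : IsPseudoInverse A A')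
    {e : V} (he : e ∈ E) : kerProj A A' hA e = 0 := by
  rw [← hAE.left_inv e he, kerProj_range]

/-- On `R` the projection `Q_B` vanishes and `B'` lands in `E`, where `P_A` vanishes and `A = B`.
Hence `det Σ` can be computed on `W ⧸ R`. -/
theorem NonposTriple.sigma_eq_self (hAE : RestrictsTo A A' E R) (hBE : RestrictsTo B B' E R)
    (hAB : ∀ e ∈ E, A e = B e) {r : W} (hr : r ∈ R) : T.sigma hA hB r = r := by
  obtain ⟨e, he, rfl⟩ := hBE.surj r hr
  rw [T.sigma_apply_range, hBE.left_inv e he, hAE.kerProj_eq_zero hA he, map_zero, add_zero,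
    hAB e he]

theorem NonposTriple.torsion (hAE : RestrictsTo A A' E R) (hBE : RestrictsTo B B' E R)
    (hAB : ∀ e ∈ E, A e = B e) {jA : Coker A →ₗ[F] W} {jB : Coker B →ₗ[F] W}
    (hjA : (LinearMap.range A).mkQ ∘ₗ jA = LinearMap.id)
    (hjB : (LinearMap.range B).mkQ ∘ₗ jB = LinearMap.id)
    {ΦA : OpLine A →ₗ[F] F} {ΦB : OpLine B →ₗ[F] F}
    (hΦA : IsTorsion (E.mapQ R A hAE.map_mem) 0 (E.mkQ ∘ₗ (LinearMap.ker A).subtype)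
      (R.mkQ ∘ₗ jA) ΦA)
    (hΦB : IsTorsion (E.mapQ R B hBE.map_mem) 0 (E.mkQ ∘ₗ (LinearMap.ker B).subtype)
      (R.mkQ ∘ₗ jB) ΦB)
    (s : DetLine F (LinearMap.ker A)) (t₁ : DetLine F (LinearMap.ker T.M))
    (t₀ : DetLine F (LinearMap.ker T.N))
    (φ : Module.Dual F (DetLine F (Coker A))) (ψ : Module.Dual F (DetLine F (Coker B)))
    (hφ : φ (detWedge ((LinearMap.range A).mkQ ∘ₗ T.L) s
        ((LinearMap.range A).mkQ ∘ₗ T.N ∘ₗ (LinearMap.ker T.M).subtype) t₁) = 1)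
    (hψ : ψ (detWedge
        ((LinearMap.range B).mkQ ∘ₗ (LinearMap.ker B').subtype ∘ₗ (LinearMap.ker T.N).subtype) t₀
        ((LinearMap.range B).mkQ ∘ₗ (LinearMap.ker B').subtype ∘ₗ (LinearMap.ker T.M).subtype) t₁)
      = 1) :
    detClassDet (T.sigma hA hB) * ΦA (s ⊗ₜ φ) =
      ΦB (detMap (kerProj B B' hB ∘ₗ T.M ∘ₗ (LinearMap.ker T.N).subtype) t₀ ⊗ₜ ψ) := by
  have : FiniteDimensional F (LinearMap.ker B') :=
    Module.Finite.equiv (kerEquivCoker hB).symm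
  have dimA : finrank F (LinearMap.ker A) + finrank F (LinearMap.ker T.M) =
      finrank F (Coker A) := finrank_eq_of_coprod T.bijective_coker
  have dimB : finrank F (LinearMap.ker T.N) + finrank F (LinearMap.ker T.M) =
      finrank F (Coker B) := by
    rw [← (kerEquivCoker hB).finrank_eq]
    exact Submodule.finrank_add_eq_of_isCompl T.compl_N.symm
  have hidx := (hAE.index_eq).trans hBE.index_eq.symm
  have dimK : finrank F (LinearMap.ker T.N) = finrank F (LinearMap.ker B) := by
    rw [index, index] at hidx
    omega
  rw [detClassDet_eq (fun r hr => T.sigma_eq_self hA hB hAE hBE hAB hr)]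
  have hHE : E ≤ R.comap (A + T.L ∘ₗ kerProj A A' hA) := fun e he => by
    simpa [hAE.kerProj_eq_zero hA he] using hAE.map_mem he
  -- Everything descends to `V ⧸ E` and `W ⧸ R`; the remaining identities already hold before
  -- dividing, apart from the congruences modulo ranges.
  refine nonpos_torsion (A' := R.mapQ E A' hAE.map_mem') (B' := R.mapQ E B' hBE.map_mem')
    (H := E.mapQ R (A + T.L ∘ₗ kerProj A A' hA) hHE)
    (l := R.mkQ ∘ₗ T.L) (m₀ := E.mkQ ∘ₗ T.M ∘ₗ (LinearMap.ker T.N).subtype)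
    (i₀ := R.mkQ ∘ₗ (LinearMap.ker B').subtype ∘ₗ (LinearMap.ker T.N).subtype)
    (i₁ := R.mkQ ∘ₗ (LinearMap.ker B').subtype ∘ₗ (LinearMap.ker T.M).subtype)
    (n₁ := R.mkQ ∘ₗ T.N ∘ₗ (LinearMap.ker T.M).subtype)
    (hAE.model hjA) (hBE.model hjB) hΦA hΦB ?_ ?_ ?_ ?_ ?_ ?_ ?_ ?_ ?_ ?_ ?_ ?_ dimA dimB dimK
    s t₀ t₁ hφ hψ
  · ext x; exact congrArg R.mkQ (hA.apply_apply x)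
  · ext x; exact congrArg R.mkQ (hB.apply_apply x)
  · ext x
    refine congrArg R.mkQ (?_ : A (A' (A x)) + T.L (kerProj A A' hA (A' (A x))) = A x)
    rw [kerProj_range, map_zero, add_zero, hA.apply_apply]
  · ext x; exact congrArg R.mkQ (T.sigma_apply_range hA hB x)
  · ext x
    refine congrArg R.mkQ (?_ : A (x : V) + T.L (kerProj A A' hA (x : V)) = T.L x)
    rw [kerProj_coe, LinearMap.mem_ker.1 x.2, zero_add]
  · ext x
    refine congrArg R.mkQ ((T.sigma_apply_coe hA hB x.1).trans ?_)
    rw [LinearMap.mem_ker.1 x.2, add_zero]; rfl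
  · ext x
    refine congrArg R.mkQ ((T.sigma_apply_coe hA hB x.1).trans ?_)
    rw [LinearMap.mem_ker.1 x.2, map_zero, map_zero, map_zero, zero_add, zero_add]; rfl
  · exact fun u => mapQ_sub_mem_range hAE.map_mem (sub_section_mem hjA _)
  · exact fun u => mapQ_sub_mem_range hAE.map_mem (sub_section_mem hjA _)
  · exact fun u => mapQ_sub_mem_range hBE.map_mem (sub_section_mem hjB _)
  · exact fun u => mapQ_sub_mem_range hBE.map_mem (sub_section_mem hjB _)
  · intro u
    refine ⟨E.mkQ (T.M u), ?_⟩
    simp only [LinearMap.comp_apply]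
    rw [← map_sub]
    exact congrArg E.mkQ (sub_sub_cancel (T.M u) (B' (B (T.M u)))).symm

theorem exists_dual_eq_one {L : Type*} [AddCommGroup L] [Module F L] {v : L} (hv : v ≠ 0) :
    ∃ φ : Dual F L, φ v = 1 :=
  Projective.exists_dual_eq_one F hv

/-- The defining formula for `P` becomes a linear equation in which the triple and the
pseudo-inverses no longer occur. -/
theorem NonposTriple.isPerturbationMap_iff (hAE : RestrictsTo A A' E R)
    (hBE : RestrictsTo B B' E R)
    (hAB : ∀ e ∈ E, A e = B e) {jA : Coker A →ₗ[F] W} {jB : Coker B →ₗ[F] W}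
    (hjA : (LinearMap.range A).mkQ ∘ₗ jA = LinearMap.id)
    (hjB : (LinearMap.range B).mkQ ∘ₗ jB = LinearMap.id)
    {ΦA : OpLine A →ₗ[F] F} {ΦB : OpLine B →ₗ[F] F}
    (hΦA : IsTorsion (E.mapQ R A hAE.map_mem) 0 (E.mkQ ∘ₗ (LinearMap.ker A).subtype)
      (R.mkQ ∘ₗ jA) ΦA)
    (hΦB : IsTorsion (E.mapQ R B hBE.map_mem) 0 (E.mkQ ∘ₗ (LinearMap.ker B).subtype)
      (R.mkQ ∘ₗ jB) ΦB) (hinj : Function.Injective ΦB) (P : OpLine A →ₗ[F] OpLine B) :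
    T.IsPerturbationMap hA hB P ↔ ΦB ∘ₗ P = ΦA := by
  have : FiniteDimensional F (LinearMap.ker B') :=
    Module.Finite.equiv (kerEquivCoker hB).symm
  have dimA : finrank F (LinearMap.ker A) + finrank F (LinearMap.ker T.M) =
      finrank F (Coker A) := finrank_eq_of_coprod T.bijective_coker
  have dimB : finrank F (LinearMap.ker T.N) + finrank F (LinearMap.ker T.M) =
      finrank F (Coker B) := by
    rw [← (kerEquivCoker hB).finrank_eq]
    exact Submodule.finrank_add_eq_of_isCompl T.compl_N.symm
  have hidx := (hAE.index_eq).trans hBE.index_eq.symm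
  have dimK : finrank F (LinearMap.ker T.N) = finrank F (LinearMap.ker B) := by
    rw [index, index] at hidx
    omega
  have tor := T.torsion hA hB hAE hBE hAB hjA hjB hΦA hΦB
  have hfix : ∀ r ∈ R, T.sigma hA hB r = r := fun r hr => T.sigma_eq_self hA hB hAE hBE hAB hr
  obtain ⟨s, hs⟩ := exists_detLine_ne_zero F (LinearMap.ker A)
  obtain ⟨t₁, ht₁⟩ := exists_detLine_ne_zero F (LinearMap.ker T.M)
  obtain ⟨t₀, ht₀⟩ := exists_detLine_ne_zero F (LinearMap.ker T.N)
  have hcA : detWedge ((LinearMap.range A).mkQ ∘ₗ T.L) s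
        ((LinearMap.range A).mkQ ∘ₗ T.N ∘ₗ (LinearMap.ker T.M).subtype) t₁ ≠ 0 := by
    rw [Ne, ← Subtype.coe_inj, coe_detWedge dimA]
    exact wedge_ne_zero T.bijective_coker.1 hs ht₁
  have hcB : detWedge
        ((LinearMap.range B).mkQ ∘ₗ (LinearMap.ker B').subtype ∘ₗ (LinearMap.ker T.N).subtype) t₀
        ((LinearMap.range B).mkQ ∘ₗ (LinearMap.ker B').subtype ∘ₗ (LinearMap.ker T.M).subtype) t₁
        ≠ 0 := by
    rw [Ne, ← Subtype.coe_inj, coe_detWedge dimB]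
    exact wedge_ne_zero (injective_coprod_of_isCompl T.compl_N.symm (kerEquivCoker hB).injective)
      ht₀ ht₁
  have hk : detMap (kerProj B B' hB ∘ₗ T.M ∘ₗ (LinearMap.ker T.N).subtype) t₀ ≠ 0 := by
    rw [Ne, ← Subtype.coe_inj, coe_detMap dimK]
    refine map_ne_zero_of_injective ?_ (fun h => ht₀ (Subtype.ext h))
    exact (LinearMap.injective_iff_surjective_of_finrank_eq_finrank dimK).2
      (T.surjective_kerProj hB)
  obtain ⟨φ, hφ⟩ := exists_dual_eq_one (F := F) hcA
  obtain ⟨ψ, hψ⟩ := exists_dual_eq_one (F := F) hcB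
  have hφ0 : φ ≠ 0 := by rintro rfl; exact zero_ne_one hφ
  have hψ0 : ψ ≠ 0 := by rintro rfl; exact zero_ne_one hψ
  -- The right side of the torsion identity is non-zero, so invertibility of `Σ` comes for free.
  have hdet : detClassDet (T.sigma hA hB) ≠ 0 := by
    intro h
    have h1 := tor s t₁ t₀ φ ψ hφ hψ
    rw [h, zero_mul] at h1
    exact (hBE.model hjB).op_torsion_ne_zero hΦB hk hψ0 h1.symm
  constructor
  · rintro ⟨-, hP⟩
    have hA0 := (hAE.model hjA).op_torsion_ne_zero hΦA hs hφ0
    refine line_ext hA0 ?_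
    rw [LinearMap.comp_apply, hP s t₁ t₀ hs ht₁ ht₀ φ ψ hφ hψ, map_smul,
      ← tor s t₁ t₀ φ ψ hφ hψ, smul_eq_mul, inv_mul_cancel_left₀ hdet]
  · intro hP
    refine ⟨⟨bijective_of_mapQ hfix (by rwa [← detClassDet_eq hfix]), finiteRank_id_sub hfix⟩, ?_⟩
    intro s t₁ t₀ _ _ _ φ ψ hφ hψ
    apply hinj
    rw [map_smul, ← tor s t₁ t₀ φ ψ hφ hψ, smul_eq_mul, inv_mul_cancel_left₀ hdet, ← hP]
    rfl

end Nonpos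

section Nonneg

variable (T : NonnegTriple A B') (hA : IsPseudoInverse A A') (hB : IsPseudoInverse B B')

theorem NonnegTriple.sigma_apply (v : V) : T.sigma hA hB v =
    B' (A v + T.L (kerProj A A' hA v)) + T.M (cokerProj B B' hB (A v + T.L (kerProj A A' hA v))) +
      T.N (kerProj A A' hA v) := rfl

theorem NonnegTriple.sigma_apply_range (w : W) : T.sigma hA hB (A' w) =
    B' (A (A' w)) + T.M (cokerProj B B' hB (A (A' w))) := by
  rw [T.sigma_apply, kerProj_range, map_zero, map_zero, add_zero, add_zero]

theorem NonnegTriple.sigma_apply_coe (v : LinearMap.ker A) : T.sigma hA hB (v : V) =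
    B' (T.L v) + T.M (cokerProj B B' hB (T.L v)) + T.N v := by
  rw [T.sigma_apply, kerProj_coe, LinearMap.mem_ker.1 v.2, zero_add]

theorem NonnegTriple.sigma_eq_self (hAE : RestrictsTo A A' E R) (hBE : RestrictsTo B B' E R)
    (hAB : ∀ e ∈ E, A e = B e) {e : V} (he : e ∈ E) : T.sigma hA hB e = e := by
  rw [T.sigma_apply, hAE.kerProj_eq_zero hA he, map_zero, map_zero, add_zero, add_zero, hAB e he,
    cokerProj_range, map_zero, add_zero, hBE.left_inv e he]

theorem NonnegTriple.surjective_coker :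
    Function.Surjective ((LinearMap.range A).mkQ ∘ₗ T.L ∘ₗ (LinearMap.ker T.N).subtype) := by
  intro x
  obtain ⟨u, hu⟩ := T.surjective_L x
  obtain ⟨a, ha, b, hb, rfl⟩ := Submodule.mem_sup.1
    (T.compl_N.sup_eq_top ▸ Submodule.mem_top : u ∈ LinearMap.ker T.L ⊔ LinearMap.ker T.N)
  refine ⟨⟨b, hb⟩, ?_⟩
  rw [LinearMap.comp_apply, map_add, LinearMap.mem_ker.1 ha, zero_add] at hu
  exact hu

/-- Modulo `range B'`, the images of `M` and of `N` on `Ker L` are complementary, and `P_B`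
identifies that quotient with `Ker B`. -/
theorem NonnegTriple.bijective_ker (hB : IsPseudoInverse B B') :
    Function.Bijective ((kerProj B B' hB ∘ₗ T.M).coprod
      (kerProj B B' hB ∘ₗ T.N ∘ₗ (LinearMap.ker T.L).subtype)) := by
  have h := bijective_coprod_mkQ (R := LinearMap.range B') T.injective_M
    (by rw [sup_comm]; exact T.bijective_N)
  have h1 := (cokerEquivKer hB).bijective.comp h
  convert h1 using 1
  ext x
  simp only [LinearMap.coprod_apply, LinearMap.comp_apply, Function.comp_apply, map_add,
    cokerEquivKer_mkQ]

theorem injective_coprod_swap {U U' X : Type*} [AddCommGroup U] [Module F U] [AddCommGroup U']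
    [Module F U'] [AddCommGroup X] [Module F X] {f : U →ₗ[F] X} {g : U' →ₗ[F] X}
    (h : Function.Injective (f.coprod g)) : Function.Injective (g.coprod f) := by
  rintro ⟨a, b⟩ ⟨a', b'⟩ hab
  simp only [LinearMap.coprod_apply] at hab
  have h1 := @h (b, a) (b', a') (by
    simp only [LinearMap.coprod_apply]; rw [add_comm, hab, add_comm])
  simp only [Prod.mk.injEq] at h1 ⊢
  exact h1.symm

/-- The equality of the indices of `A` and `B` enters here; together with the splittings it also
shows that `Ker L` has the index as its dimension. -/
theorem NonnegTriple.finrank_eqs (hAE : RestrictsTo A A' E R) (hBE : RestrictsTo B B' E R)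
    (hB : IsPseudoInverse B B') :
    finrank F (LinearMap.ker T.N) = finrank F (Coker A) ∧
    finrank F (LinearMap.ker T.L) + finrank F (LinearMap.ker T.N) = finrank F (LinearMap.ker A) ∧
    finrank F (LinearMap.ker T.L) + finrank F (LinearMap.ker B') = finrank F (LinearMap.ker B) ∧
    finrank F (LinearMap.ker B') = finrank F (Coker B) ∧
    (index A).toNat = finrank F (LinearMap.ker T.L) := by
  have : FiniteDimensional F (LinearMap.ker B') :=
    Module.Finite.equiv (kerEquivCoker hB).symm
  have h1 := finrank_eq_of_coprod (T.bijective_ker hB)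
  have h2 := Submodule.finrank_add_eq_of_isCompl T.compl_N
  have h3 := (kerEquivCoker hB).finrank_eq
  have hidx := (hAE.index_eq).trans hBE.index_eq.symm
  rw [index, index] at hidx
  rw [index]
  omega

theorem NonnegTriple.torsion (hAE : RestrictsTo A A' E R) (hBE : RestrictsTo B B' E R)
    (hAB : ∀ e ∈ E, A e = B e) {jA : Coker A →ₗ[F] W} {jB : Coker B →ₗ[F] W}
    (hjA : (LinearMap.range A).mkQ ∘ₗ jA = LinearMap.id)
    (hjB : (LinearMap.range B).mkQ ∘ₗ jB = LinearMap.id)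
    {ΦA : OpLine A →ₗ[F] F} {ΦB : OpLine B →ₗ[F] F}
    (hΦA : IsTorsion (E.mapQ R A hAE.map_mem) 0 (E.mkQ ∘ₗ (LinearMap.ker A).subtype)
      (R.mkQ ∘ₗ jA) ΦA)
    (hΦB : IsTorsion (E.mapQ R B hBE.map_mem) 0 (E.mkQ ∘ₗ (LinearMap.ker B).subtype)
      (R.mkQ ∘ₗ jB) ΦB)
    (s₀ : DetLine F (LinearMap.ker T.L)) (s₁ : DetLine F (LinearMap.ker T.N))
    (t : DetLine F (LinearMap.ker B'))
    (φ : Module.Dual F (DetLine F (Coker A))) (ψ : Module.Dual F (DetLine F (Coker B)))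
    (hφ : φ (detMap ((LinearMap.range A).mkQ ∘ₗ T.L ∘ₗ (LinearMap.ker T.N).subtype) s₁) = 1)
    (hψ : ψ (detMap ((LinearMap.range B).mkQ ∘ₗ (LinearMap.ker B').subtype) t) = 1) :
    detClassDet (T.sigma hA hB) *
      ΦA (detWedge (LinearMap.ker T.L).subtype s₀ (LinearMap.ker T.N).subtype s₁ ⊗ₜ φ) =
      indexSign A B * ΦB (detWedge (kerProj B B' hB ∘ₗ T.N ∘ₗ (LinearMap.ker T.L).subtype) s₀
          (kerProj B B' hB ∘ₗ T.M) t ⊗ₜ ψ) := by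
  have : FiniteDimensional F (LinearMap.ker B') :=
    Module.Finite.equiv (kerEquivCoker hB).symm
  obtain ⟨dimA, dimKA, dimKB, dimB, hind⟩ := T.finrank_eqs hAE hBE hB
  rw [detClassDet_eq (fun r hr => T.sigma_eq_self hA hB hAE hBE hAB hr), indexSign, hind]
  have hGE : R ≤ E.comap (B' + T.M ∘ₗ cokerProj B B' hB) := fun r hr => by
    obtain ⟨e, he, rfl⟩ := hBE.surj r hr
    simpa [cokerProj_range, hBE.left_inv e he] using he
  refine nonneg_torsion (A' := R.mapQ E A' hAE.map_mem') (B' := R.mapQ E B' hBE.map_mem')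
    (G := R.mapQ E (B' + T.M ∘ₗ cokerProj B B' hB) hGE)
    (n₀ := E.mkQ ∘ₗ T.N ∘ₗ (LinearMap.ker T.L).subtype)
    (l₁ := R.mkQ ∘ₗ T.L ∘ₗ (LinearMap.ker T.N).subtype)
    (i := R.mkQ ∘ₗ (LinearMap.ker B').subtype) (m := E.mkQ ∘ₗ T.M)
    (hAE.model hjA) (hBE.model hjB) hΦA hΦB ?_ ?_ ?_ ?_ ?_ ?_ ?_ ?_ ?_ ?_ ?_ dimA dimB dimKA dimKB
    s₀ s₁ t hφ hψ
  · ext x; exact congrArg R.mkQ (hA.apply_apply x)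
  · ext x; exact congrArg R.mkQ (hB.apply_apply x)
  · ext x
    refine congrArg E.mkQ (?_ : B' (B x) + T.M (cokerProj B B' hB (B x)) = B' (B x))
    rw [cokerProj_range, map_zero, add_zero]
  · ext x
    refine congrArg E.mkQ ((T.sigma_apply_range hA hB (A x)).trans ?_)
    rw [hA.apply_apply]; rfl
  · ext x
    refine congrArg E.mkQ ((T.sigma_apply_coe hA hB x.1).trans ?_)
    rw [LinearMap.mem_ker.1 x.2, map_zero, map_zero, map_zero, zero_add, zero_add]; rfl
  · ext x
    refine congrArg E.mkQ ((T.sigma_apply_coe hA hB x.1).trans ?_)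
    rw [LinearMap.mem_ker.1 x.2, add_zero]; rfl
  · ext x
    refine congrArg E.mkQ (?_ : B' (x : W) + T.M (cokerProj B B' hB (x : W)) = T.M x)
    rw [cokerProj_coe, LinearMap.mem_ker.1 x.2, zero_add]
  · exact fun u => mapQ_sub_mem_range hAE.map_mem (sub_section_mem hjA _)
  · exact fun u => mapQ_sub_mem_range hBE.map_mem (sub_section_mem hjB _)
  · intro u
    refine ⟨E.mkQ (T.N u), ?_⟩
    simp only [LinearMap.comp_apply]
    rw [← map_sub]
    exact congrArg E.mkQ (sub_sub_cancel (T.N u) (B' (B (T.N u)))).symm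
  · intro u
    refine ⟨E.mkQ (T.M u), ?_⟩
    simp only [LinearMap.comp_apply]
    rw [← map_sub]
    exact congrArg E.mkQ (sub_sub_cancel (T.M u) (B' (B (T.M u)))).symm

theorem indexSign_mul_self (A B : V →ₗ[F] W) : indexSign A B * indexSign A B = 1 := by
  rw [indexSign, ← mul_pow, neg_mul_neg, one_mul, one_pow]

theorem NonnegTriple.isPerturbationMap_iff (hAE : RestrictsTo A A' E R)
    (hBE : RestrictsTo B B' E R)
    (hAB : ∀ e ∈ E, A e = B e) {jA : Coker A →ₗ[F] W} {jB : Coker B →ₗ[F] W}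
    (hjA : (LinearMap.range A).mkQ ∘ₗ jA = LinearMap.id)
    (hjB : (LinearMap.range B).mkQ ∘ₗ jB = LinearMap.id)
    {ΦA : OpLine A →ₗ[F] F} {ΦB : OpLine B →ₗ[F] F}
    (hΦA : IsTorsion (E.mapQ R A hAE.map_mem) 0 (E.mkQ ∘ₗ (LinearMap.ker A).subtype)
      (R.mkQ ∘ₗ jA) ΦA)
    (hΦB : IsTorsion (E.mapQ R B hBE.map_mem) 0 (E.mkQ ∘ₗ (LinearMap.ker B).subtype)
      (R.mkQ ∘ₗ jB) ΦB) (hinj : Function.Injective ΦB) (P : OpLine A →ₗ[F] OpLine B) :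
    T.IsPerturbationMap hA hB P ↔ ΦB ∘ₗ P = (indexSign A B : F) • ΦA := by
  have : FiniteDimensional F (LinearMap.ker B') :=
    Module.Finite.equiv (kerEquivCoker hB).symm
  obtain ⟨dimA, dimKA, dimKB, dimB, hind⟩ := T.finrank_eqs hAE hBE hB
  have tor := T.torsion hA hB hAE hBE hAB hjA hjB hΦA hΦB
  have hsgn : (indexSign A B : F) * indexSign A B = 1 := indexSign_mul_self A B
  have hsgn0 : (indexSign A B : F) ≠ 0 := left_ne_zero_of_mul_eq_one hsgn
  have hfix : ∀ r ∈ E, T.sigma hA hB r = r := fun r hr => T.sigma_eq_self hA hB hAE hBE hAB hr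
  obtain ⟨s₀, hs₀⟩ := exists_detLine_ne_zero F (LinearMap.ker T.L)
  obtain ⟨s₁, hs₁⟩ := exists_detLine_ne_zero F (LinearMap.ker T.N)
  obtain ⟨t, ht⟩ := exists_detLine_ne_zero F (LinearMap.ker B')
  have hcA : detMap ((LinearMap.range A).mkQ ∘ₗ T.L ∘ₗ (LinearMap.ker T.N).subtype) s₁ ≠ 0 := by
    rw [Ne, ← Subtype.coe_inj, coe_detMap dimA]
    refine map_ne_zero_of_injective ?_ (fun h => hs₁ (Subtype.ext h))
    exact (LinearMap.injective_iff_surjective_of_finrank_eq_finrank dimA).2 T.surjective_coker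
  have hcB : detMap ((LinearMap.range B).mkQ ∘ₗ (LinearMap.ker B').subtype) t ≠ 0 := by
    rw [Ne, ← Subtype.coe_inj, coe_detMap dimB]
    exact map_ne_zero_of_injective (kerEquivCoker hB).injective (fun h => ht (Subtype.ext h))
  have hkA : detWedge (LinearMap.ker T.L).subtype s₀ (LinearMap.ker T.N).subtype s₁ ≠ 0 := by
    rw [Ne, ← Subtype.coe_inj, coe_detWedge dimKA]
    exact wedge_ne_zero (injective_coprod_of_isCompl T.compl_N (f := LinearMap.id)
      Function.injective_id) hs₀ hs₁
  have hkB : detWedge (kerProj B B' hB ∘ₗ T.N ∘ₗ (LinearMap.ker T.L).subtype) s₀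
          (kerProj B B' hB ∘ₗ T.M) t ≠ 0 := by
    rw [Ne, ← Subtype.coe_inj, coe_detWedge dimKB]
    exact wedge_ne_zero (injective_coprod_swap (T.bijective_ker hB).1) hs₀ ht
  obtain ⟨φ, hφ⟩ := exists_dual_eq_one (F := F) hcA
  obtain ⟨ψ, hψ⟩ := exists_dual_eq_one (F := F) hcB
  have hφ0 : φ ≠ 0 := by rintro rfl; exact zero_ne_one hφ
  have hψ0 : ψ ≠ 0 := by rintro rfl; exact zero_ne_one hψ
  have hdet : detClassDet (T.sigma hA hB) ≠ 0 := by
    intro h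
    have h1 := tor s₀ s₁ t φ ψ hφ hψ
    rw [h, zero_mul] at h1
    exact mul_ne_zero hsgn0 ((hBE.model hjB).op_torsion_ne_zero hΦB hkB hψ0) h1.symm
  have tor' : ∀ (s₀ : DetLine F (LinearMap.ker T.L)) (s₁ : DetLine F (LinearMap.ker T.N))
      (t : DetLine F (LinearMap.ker B')) (φ : Module.Dual F (DetLine F (Coker A)))
      (ψ : Module.Dual F (DetLine F (Coker B))),
      φ (detMap ((LinearMap.range A).mkQ ∘ₗ T.L ∘ₗ (LinearMap.ker T.N).subtype) s₁) = 1 →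
      ψ (detMap ((LinearMap.range B).mkQ ∘ₗ (LinearMap.ker B').subtype) t) = 1 →
      (detClassDet (T.sigma hA hB))⁻¹ *
        ΦB (detWedge (kerProj B B' hB ∘ₗ T.N ∘ₗ (LinearMap.ker T.L).subtype) s₀
          (kerProj B B' hB ∘ₗ T.M) t ⊗ₜ ψ) = indexSign A B *
      ΦA (detWedge (LinearMap.ker T.L).subtype s₀ (LinearMap.ker T.N).subtype s₁ ⊗ₜ φ) := by
    intro s₀ s₁ t φ ψ hφ hψ
    rw [inv_mul_eq_iff_eq_mul₀ hdet, mul_left_comm, tor s₀ s₁ t φ ψ hφ hψ, ← mul_assoc, hsgn,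
      one_mul]
  constructor
  · rintro ⟨-, hP⟩
    have hA0 := (hAE.model hjA).op_torsion_ne_zero hΦA hkA hφ0
    refine line_ext (mul_ne_zero hsgn0 hA0) ?_
    rw [LinearMap.comp_apply, hP s₀ s₁ t hs₀ hs₁ ht φ ψ hφ hψ, map_smul, smul_eq_mul,
      tor' s₀ s₁ t φ ψ hφ hψ]
    rfl
  · intro hP
    refine ⟨⟨bijective_of_mapQ hfix (by rwa [← detClassDet_eq hfix]), finiteRank_id_sub hfix⟩, ?_⟩
    intro s₀ s₁ t _ _ _ φ ψ hφ hψ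
    apply hinj
    rw [map_smul, smul_eq_mul, tor' s₀ s₁ t φ ψ hφ hψ]
    exact LinearMap.congr_fun hP _

end Nonneg

theorem indexSign_of_nonpos (h : index A ≤ 0) (B : V →ₗ[F] W) : (indexSign A B : F) = 1 := by
  rw [indexSign, Int.toNat_of_nonpos h, zero_mul, pow_zero]

/-- The sign is trivial for index `≤ 0`, so both kinds of triple obey one equation; in index zero
they therefore give the same map. -/
theorem PerturbationTriple.isPerturbationMap_iff (T : PerturbationTriple A B')
    (hA : IsPseudoInverse A A') (hB : IsPseudoInverse B B') (hAE : RestrictsTo A A' E R)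
    (hBE : RestrictsTo B B' E R)
    (hAB : ∀ e ∈ E, A e = B e) {jA : Coker A →ₗ[F] W} {jB : Coker B →ₗ[F] W}
    (hjA : (LinearMap.range A).mkQ ∘ₗ jA = LinearMap.id)
    (hjB : (LinearMap.range B).mkQ ∘ₗ jB = LinearMap.id)
    {ΦA : OpLine A →ₗ[F] F} {ΦB : OpLine B →ₗ[F] F}
    (hΦA : IsTorsion (E.mapQ R A hAE.map_mem) 0 (E.mkQ ∘ₗ (LinearMap.ker A).subtype)
      (R.mkQ ∘ₗ jA) ΦA)
    (hΦB : IsTorsion (E.mapQ R B hBE.map_mem) 0 (E.mkQ ∘ₗ (LinearMap.ker B).subtype)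
      (R.mkQ ∘ₗ jB) ΦB) (hinj : Function.Injective ΦB) (P : OpLine A →ₗ[F] OpLine B) :
    T.IsPerturbationMap hA hB P ↔ ΦB ∘ₗ P = (indexSign A B : F) • ΦA := by
  cases T with
  | nonpos h T =>
    rw [indexSign_of_nonpos h, one_smul]
    exact T.isPerturbationMap_iff hA hB hAE hBE hAB hjA hjB hΦA hΦB hinj P
  | nonneg h T => exact T.isPerturbationMap_iff hA hB hAE hBE hAB hjA hjB hΦA hΦB hinj P

end OperatorPerturbation

end PerturbationIso

namespace PerturbationIso

open ExteriorAlgebra Module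

/-! ### Torsion under a surjection of complexes inducing an isomorphism on homology. -/

section Comparison

variable {F : Type*} [Field F]
  {Yp : Type*} [AddCommGroup Yp] [Module F Yp] [FiniteDimensional F Yp]
  {Ym : Type*} [AddCommGroup Ym] [Module F Ym] [FiniteDimensional F Ym]
  {Zp : Type*} [AddCommGroup Zp] [Module F Zp] [FiniteDimensional F Zp]
  {Zm : Type*} [AddCommGroup Zm] [Module F Zm] [FiniteDimensional F Zm]
  {Hp : Type*} [AddCommGroup Hp] [Module F Hp] [FiniteDimensional F Hp]
  {Hm : Type*} [AddCommGroup Hm] [Module F Hm] [FiniteDimensional F Hm]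
  {πp : Yp →ₗ[F] Zp} {πm : Ym →ₗ[F] Zm}

/-- Volumes in a short exact sequence. -/
theorem exists_volume_ker_mul (hπ : Function.Surjective πp)
    {g : ExteriorAlgebra F (LinearMap.ker πp)}
    (hg : g ∈ ⋀[F]^(finrank F (LinearMap.ker πp)) (LinearMap.ker πp)) (hg0 : g ≠ 0) :
    ∃ l : F, l ≠ 0 ∧ ∀ ω : ExteriorAlgebra F Yp, ω ∈ ⋀[F]^(finrank F Zp) Yp →
      volume F Yp (map (LinearMap.ker πp).subtype g * ω) = l * volume F Zp (map πp ω) := by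
  obtain ⟨θ, hθ⟩ := πp.exists_rightInverse_of_surjective (LinearMap.range_eq_top.2 hπ)
  obtain ⟨z₀, hz₀⟩ := exists_detLine_ne_zero F Zp
  have hz₀' : (z₀ : ExteriorAlgebra F Zp) ≠ 0 := fun h => hz₀ (Subtype.ext h)
  have hv := (volume_eq_zero_iff z₀.2).not.2 hz₀'
  let f : ExteriorAlgebra F Zp →ₗ[F] F := volume F Yp ∘ₗ
    LinearMap.mulLeft F (map (LinearMap.ker πp).subtype g) ∘ₗ (map θ).toLinearMap
  have hf : ∀ z, f z = volume F Yp (map (LinearMap.ker πp).subtype g * map θ z) := fun _ => rfl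
  have hθπ : ∀ y, πp (θ y) = y := LinearMap.congr_fun hθ
  refine ⟨f z₀ / volume F Zp z₀, div_ne_zero ?_ hv, fun ω hω => ?_⟩
  · rw [hf, Ne, volume_eq_zero_iff]
    · refine wedge_ne_zero (u := ⟨g, hg⟩) (u' := z₀) ?_ (fun h => hg0 (congrArg Subtype.val h)) hz₀
      rw [← LinearMap.ker_eq_bot, LinearMap.ker_eq_bot']
      rintro ⟨⟨a, ha⟩, b⟩ h0
      simp only [LinearMap.coprod_apply, Submodule.subtype_apply] at h0
      have h1 := congrArg πp h0
      rw [map_add, LinearMap.mem_ker.1 ha, zero_add, hθπ, map_zero] at h1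
      rw [h1, map_zero, add_zero] at h0
      simp only [h0, h1]; rfl
    · have hd : finrank F Yp = finrank F (LinearMap.ker πp) + finrank F Zp := by
        rw [← LinearMap.finrank_range_add_finrank_ker πp, LinearMap.range_eq_top.2 hπ, finrank_top,
          add_comm]
      rw [hd]
      exact mul_mem_exteriorPower (map_mem _ hg) (map_mem _ z₀.2)
  · have h1 : map (LinearMap.ker πp).subtype g * ω =
        map (LinearMap.ker πp).subtype g * map θ (map πp ω) := by
      have h2 := mul_map_eq_of_sub_mem (f := LinearMap.id) (g := θ ∘ₗ πp)
        (k := map (LinearMap.ker πp).subtype g) (fun u => map_mul_ι_eq_zero _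
          (LinearMap.finrank_range_le _) hg (by
            rw [Submodule.range_subtype]; simp [hθπ])) ω
      rw [map_map_apply, ← h2, map_id]; rfl
    rw [h1, ← hf, div_mul_eq_mul_div, eq_div_iff hv]
    exact apply_mul_volume_comm (map_mem _ hω) z₀.2 f

variable {dp : Yp →ₗ[F] Ym} {dm : Ym →ₗ[F] Yp} {jp : Hp →ₗ[F] Yp} {jm : Hm →ₗ[F] Ym}
  {cp : Zp →ₗ[F] Zm} {cm : Zm →ₗ[F] Zp}
  {gp : LinearMap.ker πp →ₗ[F] LinearMap.ker πm} {gm : LinearMap.ker πm →ₗ[F] LinearMap.ker πp}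

/-- The same `jp`, `jm` represent the homology above and below, so the projection is an isomorphism
on homology and its kernel is acyclic. -/
theorem HodgeModel.ker_exact (M : HodgeModel dp dm jp jm)
    (N : HodgeModel cp cm (πp ∘ₗ jp) (πm ∘ₗ jm)) (hp : Function.Surjective πp)
    (hcp : ∀ y, cp (πp y) = πm (dp y)) (hcm : ∀ y, cm (πm y) = πp (dm y)) {y : Yp}
    (hy : πp y = 0) (hy0 : dp y = 0) : ∃ w, πm w = 0 ∧ dm w = y := by
  have h1 : y ∈ LinearMap.ker dp := hy0
  rw [← M.sup_p] at h1
  obtain ⟨_, ⟨h, rfl⟩, _, ⟨w, rfl⟩, rfl⟩ := Submodule.mem_sup.1 h1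
  rw [map_add, ← hcm] at hy
  have h2 : πp (jp h) = 0 := Submodule.disjoint_def.1 N.disj_p _ ⟨h, rfl⟩
    (by rw [eq_neg_of_add_eq_zero_left hy]; exact neg_mem ⟨_, rfl⟩)
  have h3 : h = 0 := N.inj_p (by rw [map_zero]; exact h2)
  rw [h2, zero_add] at hy
  have h4 : πm w ∈ LinearMap.ker cm := hy
  rw [← N.sup_m] at h4
  obtain ⟨_, ⟨c, rfl⟩, _, ⟨v, rfl⟩, hcv⟩ := Submodule.mem_sup.1 h4
  obtain ⟨v, rfl⟩ := hp v
  -- The projection of `w` is a cycle; subtracting a lift of its decomposition moves `w` into the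
  -- kernel and does not change `dm w`.
  refine ⟨w - jm c - dp v, ?_, ?_⟩
  · rw [map_sub, map_sub, ← hcp, ← hcv]
    simp
  · rw [map_sub, map_sub, M.swap.dp_jp, M.dm_dp, h3, map_zero]; simp

/-- The homology of the kernel is modelled on the zero space `PUnit`, so that the torsion lemmas
apply to the kernel too. -/
theorem HodgeModel.ker_model (M : HodgeModel dp dm jp jm)
    (N : HodgeModel cp cm (πp ∘ₗ jp) (πm ∘ₗ jm)) (hm : Function.Surjective πm)
    (hp : Function.Surjective πp)
    (hcp : ∀ y, cp (πp y) = πm (dp y)) (hcm : ∀ y, cm (πm y) = πp (dm y))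
    (hgp : ∀ y, (gp y : Ym) = dp y) (hgm : ∀ y, (gm y : Yp) = dm y) :
    HodgeModel gp gm (0 : PUnit.{1} →ₗ[F] LinearMap.ker πp)
      (0 : PUnit.{1} →ₗ[F] LinearMap.ker πm) where
  inj_p := fun _ _ _ => rfl
  inj_m := fun _ _ _ => rfl
  disj_p := by simp
  disj_m := by simp
  sup_p := by
    rw [LinearMap.range_zero, bot_sup_eq]
    apply le_antisymm
    · rintro _ ⟨w, rfl⟩
      exact Subtype.ext (by rw [hgp, hgm, M.swap.dm_dp]; rfl)
    · rintro y hy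
      have h1 : dp y = 0 := by rw [← hgp, LinearMap.mem_ker.1 hy]; rfl
      obtain ⟨w, hw, hwy⟩ := M.ker_exact N hp hcp hcm y.2 h1
      exact ⟨⟨w, hw⟩, Subtype.ext (by rw [hgm]; exact hwy)⟩
  sup_m := by
    rw [LinearMap.range_zero, bot_sup_eq]
    apply le_antisymm
    · rintro _ ⟨w, rfl⟩
      exact Subtype.ext (by rw [hgm, hgp, M.dm_dp]; rfl)
    · rintro y hy
      have h1 : dm y = 0 := by rw [← hgm, LinearMap.mem_ker.1 hy]; rfl
      obtain ⟨w, hw, hwy⟩ := M.swap.ker_exact N.swap hm hcm hcp y.2 h1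
      exact ⟨⟨w, hw⟩, Subtype.ext (by rw [hgp]; exact hwy)⟩

/-- Ranks are additive along the quotient map. -/
theorem HodgeModel.finrank_range_add (M : HodgeModel dp dm jp jm)
    (N : HodgeModel cp cm (πp ∘ₗ jp) (πm ∘ₗ jm)) (hm : Function.Surjective πm)
    (hp : Function.Surjective πp)
    (hcp : ∀ y, cp (πp y) = πm (dp y)) (hcm : ∀ y, cm (πm y) = πp (dm y))
    (hgp : ∀ y, (gp y : Ym) = dp y) :
    finrank F (LinearMap.range gp) + finrank F (LinearMap.range cp) =
      finrank F (LinearMap.range dp) := by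
  have h := LinearMap.finrank_range_add_finrank_ker (πm.domRestrict (LinearMap.range dp))
  have h1 : LinearMap.range (πm.domRestrict (LinearMap.range dp)) = LinearMap.range cp := by
    ext z
    constructor
    · rintro ⟨⟨_, ⟨y, rfl⟩⟩, rfl⟩
      exact ⟨πp y, hcp y⟩
    · rintro ⟨z, rfl⟩
      obtain ⟨y, rfl⟩ := hp z
      exact ⟨⟨dp y, ⟨y, rfl⟩⟩, (hcp y).symm⟩
  have h2 : finrank F (LinearMap.ker (πm.domRestrict (LinearMap.range dp))) =
      finrank F (LinearMap.range gp) := by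
    rw [← LinearMap.finrank_range_of_inj (f := (LinearMap.range dp).subtype ∘ₗ
      (LinearMap.ker (πm.domRestrict (LinearMap.range dp))).subtype)
      (Subtype.val_injective.comp Subtype.val_injective),
      ← LinearMap.finrank_range_of_inj (f := (LinearMap.ker πm).subtype ∘ₗ
      (LinearMap.range gp).subtype) (Subtype.val_injective.comp Subtype.val_injective)]
    refine congrArg (fun S : Submodule F Ym => finrank F S) ?_
    ext y
    constructor
    · rintro ⟨⟨⟨_, ⟨v, rfl⟩⟩, hv⟩, rfl⟩
      obtain ⟨w, hw, hwy⟩ := M.swap.ker_exact N.swap hm hcm hcp hv (M.dm_dp v)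
      exact ⟨⟨gp ⟨w, hw⟩, ⟨_, rfl⟩⟩, (hgp _).trans hwy⟩
    · rintro ⟨⟨_, ⟨w, rfl⟩⟩, rfl⟩
      exact ⟨⟨⟨dp w, ⟨_, rfl⟩⟩, by
        have h4 := (gp w).2
        rw [hgp] at h4
        exact h4⟩, (hgp w).symm⟩
  rw [h1, h2] at h
  omega

/-- The torsion upstairs is evaluated on `ep ∧ yp` and `em ∧ ym`, with `yp`, `ym` lifted from the
quotient. Numerator and denominator split off the kernel constants `lp` and `lm`. These are fixed by
the frames and by the differentials on the kernel alone. -/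
theorem HodgeModel.smul_torsion_eq (M : HodgeModel dp dm jp jm)
    (N : HodgeModel cp cm (πp ∘ₗ jp) (πm ∘ₗ jm)) (hm : Function.Surjective πm)
    (hp : Function.Surjective πp)
    (hcp : ∀ y, cp (πp y) = πm (dp y)) (hcm : ∀ y, cm (πm y) = πp (dm y))
    (hgp : ∀ y, (gp y : Ym) = dp y) (hgm : ∀ y, (gm y : Yp) = dm y)
    {ep : ExteriorAlgebra F (LinearMap.ker πp)} {em : ExteriorAlgebra F (LinearMap.ker πm)}
    (hep : ep ∈ ⋀[F]^(finrank F (LinearMap.range gp)) (LinearMap.ker πp))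
    (hem : em ∈ ⋀[F]^(finrank F (LinearMap.range gm)) (LinearMap.ker πm)) {lp lm : F}
    (hlp : ∀ ω : ExteriorAlgebra F Yp, ω ∈ ⋀[F]^(finrank F Zp) Yp →
      volume F Yp (map (LinearMap.ker πp).subtype (ep * map gm em) * ω) =
        lp * volume F Zp (map πp ω))
    (hlm : ∀ ω : ExteriorAlgebra F Ym, ω ∈ ⋀[F]^(finrank F Zm) Ym →
      volume F Ym (map (LinearMap.ker πm).subtype (map gp ep * em) * ω) =
        lm * volume F Zm (map πm ω))
    {Φ Ψ : DetLine F Hp ⊗[F] Dual F (DetLine F Hm) →ₗ[F] F} (hΦ : IsTorsion dp dm jp jm Φ)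
    (hΨ : IsTorsion cp cm (πp ∘ₗ jp) (πm ∘ₗ jm) Ψ) : lm • Φ = lp • Ψ := by
  obtain ⟨zp, hzp, hzp0⟩ := exists_map_ne_zero cp
  obtain ⟨zm, hzm, hzm0⟩ := exists_map_ne_zero cm
  obtain ⟨c, hc⟩ := exists_detLine_ne_zero F Hm
  obtain ⟨θp, hθp⟩ := πp.exists_rightInverse_of_surjective (LinearMap.range_eq_top.2 hp)
  obtain ⟨θm, hθm⟩ := πm.exists_rightInverse_of_surjective (LinearMap.range_eq_top.2 hm)
  set yp := map θp zp with hyp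
  set ym := map θm zm with hym
  have hypm : yp ∈ ⋀[F]^(finrank F (LinearMap.range cp)) Yp := map_mem θp hzp
  have hymm : ym ∈ ⋀[F]^(finrank F (LinearMap.range cm)) Ym := map_mem θm hzm
  have hπyp : map πp yp = zp := by rw [hyp, map_map_apply, hθp, map_id]; rfl
  have hπym : map πm ym = zm := by rw [hym, map_map_apply, hθm, map_id]; rfl
  clear_value yp ym
  have hdp : πm ∘ₗ dp = cp ∘ₗ πp := LinearMap.ext fun y => (hcp y).symm
  have hdm : πp ∘ₗ dm = cm ∘ₗ πm := LinearMap.ext fun y => (hcm y).symm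
  have hip : dp ∘ₗ (LinearMap.ker πp).subtype = (LinearMap.ker πm).subtype ∘ₗ gp :=
    LinearMap.ext fun y => (hgp y).symm
  have him : dm ∘ₗ (LinearMap.ker πm).subtype = (LinearMap.ker πp).subtype ∘ₗ gm :=
    LinearMap.ext fun y => (hgm y).symm
  have rp := M.finrank_range_add N hm hp hcp hcm hgp
  have rm := M.swap.finrank_range_add N.swap hp hm hcm hcp hgm
  refine TensorProduct.ext' fun h φ => ?_
  have h1 := hΦ (map (LinearMap.ker πp).subtype ep * yp)
    (by rw [← rp]; exact mul_mem_exteriorPower (map_mem _ hep) hypm)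
    (map (LinearMap.ker πm).subtype em * ym)
    (by rw [← rm]; exact mul_mem_exteriorPower (map_mem _ hem) hymm) h φ c
  have h2 := hΨ zp hzp zm hzm h φ c
  have hden := N.torsionDen_ne_zero hzp hzm hzp0 hzm0 hc
  -- In the numerator `gm em` passes `yp`, in the denominator `em` passes `dp yp`; the degrees
  -- agree, so the same sign appears twice and cancels.
  set ε : F := (-1) ^ (finrank F (LinearMap.range cp) * finrank F (LinearMap.range gm)) with hε
  have hε0 : ε ≠ 0 := pow_ne_zero _ (neg_ne_zero.2 one_ne_zero)
  have d1 : torsionDen dp jm (map (LinearMap.ker πp).subtype ep * yp)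
      (map (LinearMap.ker πm).subtype em * ym) (c : ExteriorAlgebra F Hm) =
      ε * (lm * torsionDen cp (πm ∘ₗ jm) zp zm (c : ExteriorAlgebra F Hm)) := by
    have hmem : map dp yp * (ym * map jm (c : ExteriorAlgebra F Hm)) ∈ ⋀[F]^(finrank F Zm) Ym := by
      have := N.swap.finrank_eq
      rw [show finrank F Zm = finrank F (LinearMap.range cp) +
        (finrank F (LinearMap.range cm) + finrank F Hm) by omega]
      exact mul_mem_exteriorPower (map_mem _ hypm)
        (mul_mem_exteriorPower hymm (map_mem _ c.2))
    have h3 := hlm _ hmem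
    simp only [map_mul, map_map_apply, hdp] at h3
    rw [← map_map_apply cp πp, hπyp, hπym] at h3
    rw [torsionDen, torsionDen, ← h3]
    rw [map_mul (map dp), map_map_apply dp, hip, mul_assoc, ← mul_assoc (map dp yp), ← mul_assoc (map dp yp),
      graded_comm (map_mem dp hypm) (map_mem (LinearMap.ker πm).subtype hem), smul_mul_assoc,
      smul_mul_assoc, mul_smul_comm, map_smul, smul_eq_mul]
    simp only [mul_assoc, hε]
  have d2 : torsionNum dm jp (map (LinearMap.ker πp).subtype ep * yp)
      (map (LinearMap.ker πm).subtype em * ym) (h : ExteriorAlgebra F Hp) =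
      ε * (lp * torsionNum cm (πp ∘ₗ jp) zp zm (h : ExteriorAlgebra F Hp)) := by
    have hmem : yp * (map dm ym * map jp (h : ExteriorAlgebra F Hp)) ∈ ⋀[F]^(finrank F Zp) Yp := by
      rw [N.finrank_eq]
      exact mul_mem_exteriorPower hypm
        (mul_mem_exteriorPower (map_mem _ hymm) (map_mem _ h.2))
    have h3 := hlp _ hmem
    simp only [map_mul, map_map_apply, hdm] at h3
    rw [← map_map_apply cm πm, hπyp, hπym] at h3
    rw [torsionNum, torsionNum, ← h3]
    rw [map_mul (map dm), map_map_apply dm, him, mul_assoc, ← mul_assoc yp, ← mul_assoc yp,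
      graded_comm hypm (map_mem ((LinearMap.ker πp).subtype ∘ₗ gm) hem), smul_mul_assoc,
      smul_mul_assoc, mul_smul_comm, map_smul, smul_eq_mul]
    simp only [mul_assoc, hε]
  rw [d1, d2] at h1
  rw [LinearMap.smul_apply, LinearMap.smul_apply, smul_eq_mul, smul_eq_mul]
  apply mul_right_cancel₀ (mul_ne_zero hε0 hden)
  linear_combination h1 - ε * lp * h2

/-- The kernel has trivial homology, so its torsion numerator and denominator are non-zero top
wedges, as `exists_volume_ker_mul` requires. -/
theorem HodgeModel.exists_ker_frame
    (M : HodgeModel gp gm (0 : PUnit.{1} →ₗ[F] LinearMap.ker πp)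
      (0 : PUnit.{1} →ₗ[F] LinearMap.ker πm)) (hm : Function.Surjective πm)
    (hp : Function.Surjective πp) :
    ∃ (ep : ExteriorAlgebra F (LinearMap.ker πp)) (em : ExteriorAlgebra F (LinearMap.ker πm))
      (lp lm : F), ep ∈ ⋀[F]^(finrank F (LinearMap.range gp)) (LinearMap.ker πp) ∧
      em ∈ ⋀[F]^(finrank F (LinearMap.range gm)) (LinearMap.ker πm) ∧ lp ≠ 0 ∧ lm ≠ 0 ∧
      (∀ ω : ExteriorAlgebra F Yp, ω ∈ ⋀[F]^(finrank F Zp) Yp →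
        volume F Yp (map (LinearMap.ker πp).subtype (ep * map gm em) * ω) =
          lp * volume F Zp (map πp ω)) ∧
      (∀ ω : ExteriorAlgebra F Ym, ω ∈ ⋀[F]^(finrank F Zm) Ym →
        volume F Ym (map (LinearMap.ker πm).subtype (map gp ep * em) * ω) =
          lm * volume F Zm (map πm ω)) := by
  obtain ⟨ep, hep, hep0⟩ := exists_map_ne_zero gp
  obtain ⟨em, hem, hem0⟩ := exists_map_ne_zero gm
  obtain ⟨h, hh⟩ := exists_detLine_ne_zero F PUnit.{1}
  have hnum := M.torsionNum_ne_zero hep hem hep0 hem0 hh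
  have hden := M.torsionDen_ne_zero hep hem hep0 hem0 hh
  have n1 : ep * map gm em ≠ 0 := by
    intro h0
    rw [torsionNum, ← mul_assoc, h0, zero_mul, map_zero] at hnum
    exact hnum rfl
  have n2 : map gp ep * em ≠ 0 := by
    intro h0
    rw [torsionDen, ← mul_assoc, h0, zero_mul, map_zero] at hden
    exact hden rfl
  have hP : finrank F PUnit.{1} = 0 := finrank_zero_of_subsingleton
  have m1 : ep * map gm em ∈ ⋀[F]^(finrank F (LinearMap.ker πp)) (LinearMap.ker πp) := by
    rw [M.finrank_eq, hP]
    exact mul_mem_exteriorPower hep (map_mem _ hem)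
  have m2 : map gp ep * em ∈ ⋀[F]^(finrank F (LinearMap.ker πm)) (LinearMap.ker πm) := by
    rw [M.swap.finrank_eq, hP, add_zero, add_comm]
    exact mul_mem_exteriorPower (map_mem _ hep) hem
  obtain ⟨lp, hlp0, hlp⟩ := exists_volume_ker_mul hp m1 n1
  obtain ⟨lm, hlm0, hlm⟩ := exists_volume_ker_mul hm m2 n2
  exact ⟨ep, em, lp, lm, hep, hem, hlp0, hlm0, hlp, hlm⟩

end Comparison

end PerturbationIso

namespace PerturbationIso

open ExteriorAlgebra Module

/-! ### Folding a complex into the single operator `dp + em`. -/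

section FoldedComplex

variable {F : Type*} [Field F]
  {Xp : Type*} [AddCommGroup Xp] [Module F Xp] [FiniteDimensional F Xp]
  {Xm : Type*} [AddCommGroup Xm] [Module F Xm] [FiniteDimensional F Xm]
  {Hp : Type*} [AddCommGroup Hp] [Module F Hp] [FiniteDimensional F Hp]
  {Hm : Type*} [AddCommGroup Hm] [Module F Hm] [FiniteDimensional F Hm]
  {K : Type*} [AddCommGroup K] [Module F K] [FiniteDimensional F K]
  {C : Type*} [AddCommGroup C] [Module F C] [FiniteDimensional F C]
  {dp : Xp →ₗ[F] Xm} {dm : Xm →ₗ[F] Xp} {ep : Xm →ₗ[F] Xp} {em : Xp →ₗ[F] Xm}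
  {jp : Hp →ₗ[F] Xp} {jm : Hm →ₗ[F] Xm} {κ : K →ₗ[F] Xp} {jC : C →ₗ[F] Xm}

/-- The torsion of a complex agrees with the torsion of the folded operator `dp + em`. -/
theorem HodgeModel.torsion_fold (M : HodgeModel dp dm jp jm)
    (N : HodgeModel (dp + em) 0 κ jC)
    (hp : ∀ x, dp (ep (dp x)) = dp x) (hm : ∀ w, dm (em (dm w)) = dm w)
    (hme : ∀ w, em (ep w) = 0)
    {a : K →ₗ[F] Hp} {b : Hm →ₗ[F] C} (ha : finrank F K = finrank F Hp)
    (hb : finrank F Hm = finrank F C)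
    (hκ : ∀ x, κ x - jp (a x) ∈ LinearMap.range dm) (hj : ∀ h, jC (b h) = jm h)
    {Φ : DetLine F Hp ⊗[F] Dual F (DetLine F Hm) →ₗ[F] F}
    {Ψ : DetLine F K ⊗[F] Dual F (DetLine F C) →ₗ[F] F}
    (hΦ : IsTorsion dp dm jp jm Φ) (hΨ : IsTorsion (dp + em) 0 κ jC Ψ) :
    Φ ∘ₗ TensorProduct.map (detMap a) (detMap b).dualMap = Ψ := by
  obtain ⟨yp, hyp, hyp0⟩ := exists_map_ne_zero dp
  obtain ⟨ym, hym, hym0⟩ := exists_map_ne_zero dm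
  obtain ⟨c, hc⟩ := exists_detLine_ne_zero F Hm
  have hp' : dp ∘ₗ ep ∘ₗ dp = dp := LinearMap.ext hp
  have hm' : dm ∘ₗ em ∘ₗ dm = dm := LinearMap.ext hm
  have hy1 := map_mem (ep ∘ₗ dp) hyp
  have hy2 := map_mem (em ∘ₗ dm) hym
  have hn1 : map dp (map (ep ∘ₗ dp) yp) ≠ 0 := by rwa [map_map_apply, hp']
  have hn2 : map dm (map (em ∘ₗ dm) ym) ≠ 0 := by rwa [map_map_apply, hm']
  -- On frames in the images of the pseudo-inverses, `dp + em` sends `yp` to `dp yp`, because `em ep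
  -- = 0`, and `dm ym` back to `ym`, because `dp dm = 0`.
  have hs1 : map (dp + em) (map (ep ∘ₗ dp) yp) = map dp (map (ep ∘ₗ dp) yp) := by
    rw [map_map_apply, map_map_apply]
    congr 2
    ext x
    simp [hme]
  have hs2 : map (dp + em) (map dm (map (em ∘ₗ dm) ym)) = map (em ∘ₗ dm) ym := by
    rw [map_map_apply, map_map_apply]
    congr 2
    ext x
    have := LinearMap.mem_ker.1 (M.sup_p ▸ Submodule.mem_sup_right ⟨x, rfl⟩ :
      dm x ∈ LinearMap.ker dp)
    simp [hm, this]
  generalize map (ep ∘ₗ dp) yp = yp at *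
  generalize map (em ∘ₗ dm) ym = ym at *
  have hdeg : finrank F (LinearMap.range dp) + finrank F (LinearMap.range dm) =
      finrank F (LinearMap.range (dp + em)) := by
    have h1 := N.op_finrank
    have h2 := M.finrank_eq
    omega
  have hden := M.torsionDen_ne_zero hy1 hy2 hn1 hn2 hc
  refine TensorProduct.ext' fun s φ => ?_
  have h1 := hΦ yp hy1 ym hy2 (detMap a s) (φ ∘ₗ detMap b) c
  -- The frame `yp ∧ dm ym` of the folded operator has image `dp yp ∧ ym`: its torsion has the
  -- numerator and denominator of the complex.
  have h2 := hΨ.op (hdeg ▸ mul_mem_exteriorPower hy1 (map_mem dm hy2)) s φ (detMap b c)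
  have hj' : jC ∘ₗ b = jm := LinearMap.ext hj
  rw [coe_detMap hb, map_map_apply, hj', map_mul (map (dp + em)), hs1, hs2, mul_assoc] at h2
  apply mul_right_cancel₀ hden
  rw [LinearMap.comp_apply, TensorProduct.map_tmul]
  refine h1.trans ((Eq.trans ?_ h2.symm).trans rfl)
  rw [torsionNum, coe_detMap ha, map_map_apply, mul_assoc, LinearMap.comp_apply]
  rw [← mul_map_eq_of_sub_mem' (fun v hv => map_mul_ι_eq_zero dm le_rfl hy2 hv) hκ]

end FoldedComplex

/-! ### The kernel and cokernel of `σ₊`, and adapted subspaces. -/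

namespace GradedComplex

variable {F : Type*} [Field F]
  {Xp : Type*} [AddCommGroup Xp] [Module F Xp] {Xm : Type*} [AddCommGroup Xm] [Module F Xm]
  {D : GradedComplex F Xp Xm} {D' : GradedComplex F Xm Xp}

theorem minus_plus_apply (D : GradedComplex F Xp Xm) (x : Xp) : D.dMinus (D.dPlus x) = 0 :=
  LinearMap.congr_fun D.minus_plus x

theorem plus_minus_apply (D : GradedComplex F Xp Xm) (x : Xm) : D.dPlus (D.dMinus x) = 0 :=
  LinearMap.congr_fun D.plus_minus x

theorem sigmaPlus_apply (x : Xp) : D.sigmaPlus D' x = D.dPlus x + D'.dMinus x := rfl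

theorem sigmaPlus_dMinus (w : Xm) : D.sigmaPlus D' (D.dMinus w) = D'.dMinus (D.dMinus w) := by
  rw [sigmaPlus_apply, plus_minus_apply, zero_add]

/-- An element of `Ker σ₊` is killed by `d₊` and by `d₋^†`, and a boundary killed by `d₋^†` is zero.
A cycle `x` is homologous to `x - d₋ d₋^† x`, which lies in `Ker σ₊`. -/
theorem IsDagger.bijective_kerToHPlus (h : D.IsDagger D') :
    Function.Bijective h.kerToHPlus := by
  constructor
  · rw [← LinearMap.ker_eq_bot, LinearMap.ker_eq_bot']
    intro x hx
    have h0 := (Submodule.Quotient.mk_eq_zero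
      ((LinearMap.range D.dMinus).submoduleOf (LinearMap.ker D.dPlus))).1 hx
    obtain ⟨w, hw⟩ : (x : Xp) ∈ LinearMap.range D.dMinus := h0
    have h1 : D.dPlus (x : Xp) = 0 := h.ker_le x.2
    have h2 : D.dPlus (x : Xp) + D'.dMinus (x : Xp) = 0 := x.2
    rw [h1, zero_add] at h2
    apply Subtype.ext
    rw [← hw, ← h.minus.apply_apply, hw, h2, map_zero]; rfl
  · intro y
    obtain ⟨x, rfl⟩ := Submodule.mkQ_surjective _ y
    have h1 : D.dPlus (x : Xp) = 0 := x.2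
    refine ⟨⟨x - D.dMinus (D'.dMinus x), ?_⟩, ?_⟩
    · rw [LinearMap.mem_ker, sigmaPlus_apply, map_sub, map_sub, plus_minus_apply, h1,
        h.minus.apply_apply']
      simp
    · refine (Submodule.Quotient.eq _).2 ?_
      change (x : Xp) - D.dMinus (D'.dMinus x) - x ∈ LinearMap.range D.dMinus
      rw [sub_sub_cancel_left]
      exact neg_mem ⟨_, rfl⟩

/-- Modulo `d₋^† d₋ w = σ₊ (d₋ w)` every `w` is a cycle; a cycle of the form `σ₊ v` has `d₋^† v = 0`
and hence equals `d₊ v`. -/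
theorem IsDagger.bijective_hMinusToCoker (h : D.IsDagger D') :
    Function.Bijective h.hMinusToCoker := by
  constructor
  · rw [← LinearMap.ker_eq_bot, LinearMap.ker_eq_bot']
    intro x hx
    obtain ⟨x, rfl⟩ := Submodule.mkQ_surjective _ x
    obtain ⟨v, hv⟩ : (x : Xm) ∈ LinearMap.range (D.sigmaPlus D') :=
      (Submodule.Quotient.mk_eq_zero _).1 hx
    rw [sigmaPlus_apply] at hv
    have h1 : D.dMinus (x : Xm) = 0 := x.2
    rw [← hv, map_add, minus_plus_apply, zero_add] at h1
    have h2 : D'.dMinus v = 0 := by rw [← h.minus.apply_apply', h1, map_zero]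
    refine (Submodule.Quotient.mk_eq_zero _).2 ⟨v, ?_⟩
    rw [h2, add_zero] at hv
    exact hv
  · intro y
    obtain ⟨w, rfl⟩ := Submodule.mkQ_surjective _ y
    refine ⟨Submodule.mkQ _ ⟨w - D'.dMinus (D.dMinus w), ?_⟩, ?_⟩
    · rw [LinearMap.mem_ker, map_sub, h.minus.apply_apply, sub_self]
    · refine (Submodule.Quotient.eq _).2 ?_
      change w - D'.dMinus (D.dMinus w) - w ∈ _
      rw [sub_sub_cancel_left, ← sigmaPlus_dMinus]
      exact neg_mem ⟨_, rfl⟩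

/-- Maps choosing representatives of the homology classes. -/
structure IsRepresentative (D : GradedComplex F Xp Xm) (jp : D.HPlus →ₗ[F] Xp)
    (jm : D.HMinus →ₗ[F] Xm) : Prop where
  model : HodgeModel D.dPlus D.dMinus jp jm
  sub_mem_p : ∀ x : LinearMap.ker D.dPlus,
    (x : Xp) - jp (Submodule.mkQ _ x) ∈ LinearMap.range D.dMinus
  sub_mem_m : ∀ x : LinearMap.ker D.dMinus,
    (x : Xm) - jm (Submodule.mkQ _ x) ∈ LinearMap.range D.dPlus

theorem exists_section_subtype {V : Type*} [AddCommGroup V] [Module F V] {K R : Submodule F V}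
    (hRK : R ≤ K) : ∃ j : (K ⧸ R.submoduleOf K) →ₗ[F] V, Function.Injective j ∧
      Disjoint (LinearMap.range j) R ∧ LinearMap.range j ⊔ R = K ∧
      ∀ x : K, (x : V) - j (Submodule.mkQ _ x) ∈ R := by
  obtain ⟨s, hs⟩ := (R.submoduleOf K).mkQ.exists_rightInverse_of_surjective
    (Submodule.range_mkQ _)
  have hs' : ∀ c, (R.submoduleOf K).mkQ (s c) = c := LinearMap.congr_fun hs
  have hsub : ∀ x : K, (x : V) - s (Submodule.mkQ _ x) ∈ R := fun x =>
    (Submodule.Quotient.eq (R.submoduleOf K)).1 (hs' _).symm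
  refine ⟨K.subtype ∘ₗ s, ?_, ?_, ?_, hsub⟩
  · exact Subtype.val_injective.comp (Function.LeftInverse.injective hs')
  · rw [Submodule.disjoint_def]
    rintro _ ⟨c, rfl⟩ hc
    have h1 : (R.submoduleOf K).mkQ (s c) = 0 := (Submodule.Quotient.mk_eq_zero _).2 hc
    rw [hs'] at h1
    rw [h1, map_zero]
  · apply le_antisymm
    · refine sup_le ?_ hRK
      rintro _ ⟨c, rfl⟩
      exact (s c).2
    · intro x hx
      rw [← sub_add_cancel x (s (Submodule.mkQ _ ⟨x, hx⟩)), add_comm]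
      exact add_mem (Submodule.mem_sup_left ⟨_, rfl⟩) (Submodule.mem_sup_right (hsub ⟨x, hx⟩))

theorem exists_isRepresentative (D : GradedComplex F Xp Xm) :
    ∃ jp jm, D.IsRepresentative jp jm := by
  obtain ⟨jp, p1, p2, p3, p4⟩ := exists_section_subtype
    (R := LinearMap.range D.dMinus) (K := LinearMap.ker D.dPlus)
    (by rintro _ ⟨w, rfl⟩; exact D.plus_minus_apply w)
  obtain ⟨jm, m1, m2, m3, m4⟩ := exists_section_subtype
    (R := LinearMap.range D.dPlus) (K := LinearMap.ker D.dMinus)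
    (by rintro _ ⟨w, rfl⟩; exact D.minus_plus_apply w)
  exact ⟨jp, jm, ⟨p1, m1, p2, m2, p3, m3⟩, p4, m4⟩

/-- Graded subspaces stable under `d` and its pseudo-inverse `d'`, on which `d d' + d' d = 1`. -/
structure IsAdapted (D : GradedComplex F Xp Xm) (D' : GradedComplex F Xm Xp)
    (Ep : Submodule F Xp) (Em : Submodule F Xm) : Prop where
  dPlus_mem : Ep ≤ Em.comap D.dPlus
  dMinus_mem : Em ≤ Ep.comap D.dMinus
  dPlus_mem' : Em ≤ Ep.comap D'.dPlus
  dMinus_mem' : Ep ≤ Em.comap D'.dMinus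
  hodge_p : ∀ x ∈ Ep, D'.dPlus (D.dPlus x) + D.dMinus (D'.dMinus x) = x
  hodge_m : ∀ x ∈ Em, D'.dMinus (D.dMinus x) + D.dPlus (D'.dPlus x) = x

variable {Ep : Submodule F Xp} {Em : Submodule F Xm}

/-- On an adapted subspace the pseudo-inverse is a contracting homotopy. -/
theorem IsAdapted.acyclicSub (h : D.IsAdapted D' Ep Em) :
    AcyclicSub D.dPlus D.dMinus Ep Em where
  map_p := h.dPlus_mem
  map_m := h.dMinus_mem
  exact_p := fun x hx h0 => ⟨D'.dMinus x, h.dMinus_mem' hx, by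
    have := h.hodge_p x hx
    rwa [h0, map_zero, zero_add] at this⟩
  exact_m := fun x hx h0 => ⟨D'.dPlus x, h.dPlus_mem' hx, by
    have := h.hodge_m x hx
    rwa [h0, map_zero, zero_add] at this⟩

/-- The preimage of `r` under `σ₊` is `d₊^† r + d₋ r`: the cross terms vanish because both `D` and
`D'` are complexes. The arbitrary pseudo-inverse `S` enters only through `Ep ≤ range S`. -/
theorem IsAdapted.restrictsTo (h : D.IsAdapted D' Ep Em) {S : Xm →ₗ[F] Xp}
    (hS : IsPseudoInverse (D.sigmaPlus D') S) (hE : Ep ≤ LinearMap.range S) :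
    RestrictsTo (D.sigmaPlus D') S Ep Em where
  map_mem := fun x hx => Em.add_mem (h.dPlus_mem hx) (h.dMinus_mem' hx)
  left_inv := fun x hx => by
    obtain ⟨w, rfl⟩ := hE hx
    exact hS.apply_apply' w
  surj := fun r hr => ⟨D'.dPlus r + D.dMinus r, add_mem (h.dPlus_mem' hr) (h.dMinus_mem hr), by
    rw [sigmaPlus_apply, map_add, map_add, plus_minus_apply, minus_plus_apply, add_zero, zero_add,
      add_comm]
    exact h.hodge_m r hr⟩

/-- The representatives of the cokernel of `σ₊` given by representatives of the homology. -/
noncomputable def IsDagger.cokerRep (h : D.IsDagger D') (jm : D.HMinus →ₗ[F] Xm) :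
    Coker (D.sigmaPlus D') →ₗ[F] Xm :=
  jm ∘ₗ (LinearEquiv.ofBijective h.hMinusToCoker h.bijective_hMinusToCoker).symm.toLinearMap

theorem IsDagger.cokerRep_apply (h : D.IsDagger D') (jm : D.HMinus →ₗ[F] Xm) (x : D.HMinus) :
    h.cokerRep jm (h.hMinusToCoker x) = jm x :=
  congrArg jm ((LinearEquiv.ofBijective h.hMinusToCoker
    h.bijective_hMinusToCoker).symm_apply_apply x)

theorem IsDagger.mkQ_cokerRep (h : D.IsDagger D') {jp : D.HPlus →ₗ[F] Xp}
    {jm : D.HMinus →ₗ[F] Xm} (hj : D.IsRepresentative jp jm) :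
    (LinearMap.range (D.sigmaPlus D')).mkQ ∘ₗ h.cokerRep jm = LinearMap.id := by
  refine LinearMap.ext fun c => ?_
  obtain ⟨x, rfl⟩ := h.bijective_hMinusToCoker.2 c
  obtain ⟨w, rfl⟩ := Submodule.mkQ_surjective _ x
  rw [LinearMap.comp_apply, h.cokerRep_apply]
  refine ((Submodule.Quotient.eq _).2 ?_).symm
  exact h.range_le (hj.sub_mem_m w)

theorem IsDagger.finiteDimensional_ker (h : D.IsDagger D') (hD : D.IsFredholm) :
    FiniteDimensional F (LinearMap.ker (D.sigmaPlus D')) := by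
  have := hD.1
  exact Module.Finite.equiv (LinearEquiv.ofBijective _ h.bijective_kerToHPlus).symm

theorem IsDagger.finiteDimensional_coker (h : D.IsDagger D') (hD : D.IsFredholm) :
    FiniteDimensional F (Coker (D.sigmaPlus D')) := by
  have := hD.2
  exact Module.Finite.equiv (LinearEquiv.ofBijective _ h.bijective_hMinusToCoker)

theorem IsDagger.finrank_ker (h : D.IsDagger D') :
    finrank F (LinearMap.ker (D.sigmaPlus D')) = finrank F D.HPlus :=
  (LinearEquiv.ofBijective _ h.bijective_kerToHPlus).finrank_eq

theorem IsDagger.finrank_coker (h : D.IsDagger D') :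
    finrank F (Coker (D.sigmaPlus D')) = finrank F D.HMinus :=
  (LinearEquiv.ofBijective _ h.bijective_hMinusToCoker).finrank_eq.symm

theorem IsDagger.torsion_comp_lineMap (h : D.IsDagger D') (hD : D.IsFredholm)
    {jp : D.HPlus →ₗ[F] Xp} {jm : D.HMinus →ₗ[F] Xm} (hj : D.IsRepresentative jp jm)
    (hE : D.IsAdapted D' Ep Em) [FiniteDimensional F (Xp ⧸ Ep)] [FiniteDimensional F (Xm ⧸ Em)]
    {S : Xm →ₗ[F] Xp} (hr : RestrictsTo (D.sigmaPlus D') S Ep Em)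
    {Φ : D.Line →ₗ[F] F} {Ψ : OpLine (D.sigmaPlus D') →ₗ[F] F}
    (hΦ : IsTorsion (Ep.mapQ Em D.dPlus hE.dPlus_mem) (Em.mapQ Ep D.dMinus hE.dMinus_mem)
      (Ep.mkQ ∘ₗ jp) (Em.mkQ ∘ₗ jm) Φ)
    (hΨ : IsTorsion (Ep.mapQ Em (D.sigmaPlus D') hr.map_mem) 0
      (Ep.mkQ ∘ₗ (LinearMap.ker (D.sigmaPlus D')).subtype) (Em.mkQ ∘ₗ h.cokerRep jm) Ψ) :
    Φ ∘ₗ h.lineMap = Ψ := by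
  have := hD.1
  have := hD.2
  have := h.finiteDimensional_ker hD
  have := h.finiteDimensional_coker hD
  have hsum : Ep.mapQ Em (D.sigmaPlus D') hr.map_mem =
      Ep.mapQ Em D.dPlus hE.dPlus_mem + Ep.mapQ Em D'.dMinus hE.dMinus_mem' := by
    ext x; rfl
  have M := hj.model.descend hE.acyclicSub
  have N := hr.model (h.mkQ_cokerRep hj)
  rw [hsum] at hΨ N
  refine M.torsion_fold N (ep := Em.mapQ Ep D'.dPlus hE.dPlus_mem') ?_ ?_ ?_ h.finrank_ker
    h.finrank_coker.symm ?_ ?_ hΦ hΨ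
  · intro x
    obtain ⟨x, rfl⟩ := Ep.mkQ_surjective x
    exact congrArg Em.mkQ (h.plus.apply_apply x)
  · intro x
    obtain ⟨x, rfl⟩ := Em.mkQ_surjective x
    exact congrArg Ep.mkQ (h.minus.apply_apply x)
  · intro x
    obtain ⟨x, rfl⟩ := Em.mkQ_surjective x
    exact congrArg Em.mkQ (D'.minus_plus_apply x)
  · intro x
    obtain ⟨w, hw⟩ := hj.sub_mem_p (Submodule.inclusion h.ker_le x)
    exact ⟨Em.mkQ w, congrArg Ep.mkQ hw⟩
  · intro x
    exact congrArg Em.mkQ (h.cokerRep_apply jm x)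

end GradedComplex

end PerturbationIso

namespace PerturbationIso

open ExteriorAlgebra Module

/-! ### Subspaces of finite codimension and the change of the acyclic subcomplex. -/

theorem cofg_comap {F V W : Type*} [Field F] [AddCommGroup V] [Module F V] [AddCommGroup W]
    [Module F W] {N : Submodule F W} (hN : N.CoFG) (f : V →ₗ[F] W) : (N.comap f).CoFG := by
  have h : N.comap f = LinearMap.ker (N.mkQ ∘ₗ f) := by
    rw [LinearMap.ker_comp, Submodule.ker_mkQ]
  rw [h]
  exact Submodule.CoFG.ker _

theorem FiniteRank.cofg_ker {F V W : Type*} [Field F] [AddCommGroup V] [Module F V]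
    [AddCommGroup W] [Module F W] {f : V →ₗ[F] W} (h : FiniteRank f) : (LinearMap.ker f).CoFG :=
  Submodule.range_fg_iff_ker_cofg.1 (Module.Finite.iff_fg.1 h)

theorem FiniteRank.of_cofg_ker {F V W : Type*} [Field F] [AddCommGroup V] [Module F V]
    [AddCommGroup W] [Module F W] {f : V →ₗ[F] W} (h : (LinearMap.ker f).CoFG) : FiniteRank f :=
  Module.Finite.iff_fg.2 (Submodule.range_fg_iff_ker_cofg.2 h)

theorem IsPseudoInverse.cofg_range {F V W : Type*} [Field F] [AddCommGroup V] [Module F V]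
    [AddCommGroup W] [Module F W] {A : V →ₗ[F] W} {A' : W →ₗ[F] V} (h : IsPseudoInverse A A')
    [FiniteDimensional F (LinearMap.ker A)] : (LinearMap.range A').CoFG :=
  Module.Finite.equiv (cokerEquivKer h).symm

section Comparison

variable {F : Type*} [Field F]
  {Xp : Type*} [AddCommGroup Xp] [Module F Xp] {Xm : Type*} [AddCommGroup Xm] [Module F Xm]
  {Hp : Type*} [AddCommGroup Hp] [Module F Hp] [FiniteDimensional F Hp]
  {Hm : Type*} [AddCommGroup Hm] [Module F Hm] [FiniteDimensional F Hm]
  {Kp : Type*} [AddCommGroup Kp] [Module F Kp] [FiniteDimensional F Kp]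
  {Km : Type*} [AddCommGroup Km] [Module F Km] [FiniteDimensional F Km]
  {dp δp : Xp →ₗ[F] Xm} {dm δm : Xm →ₗ[F] Xp}
  {jp : Hp →ₗ[F] Xp} {jm : Hm →ₗ[F] Xm} {kp : Kp →ₗ[F] Xp} {km : Km →ₗ[F] Xm}
  {Ep Ep' : Submodule F Xp} {Em Em' : Submodule F Xm}
  [FiniteDimensional F (Xp ⧸ Ep)] [FiniteDimensional F (Xm ⧸ Em)]
  [FiniteDimensional F (Xp ⧸ Ep')] [FiniteDimensional F (Xm ⧸ Em')]

theorem exists_restrict_factor (hp : Ep ≤ Ep') (hm : Em ≤ Em') (hE : Ep ≤ Em.comap dp)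
    (hE' : Ep' ≤ Em'.comap dp) :
    ∃ g : LinearMap.ker (Submodule.factor hp) →ₗ[F] LinearMap.ker (Submodule.factor hm),
      ∀ y, (g y : Xm ⧸ Em) = Ep.mapQ Em dp hE y := by
  refine ⟨(Ep.mapQ Em dp hE).restrict ?_, fun y => rfl⟩
  intro y hy
  obtain ⟨x, rfl⟩ := Ep.mkQ_surjective y
  have hx : x ∈ Ep' := (Submodule.Quotient.mk_eq_zero _).1 hy
  exact (Submodule.Quotient.mk_eq_zero _).2 (hE' hx)

theorem mapQ_eq_of_mem_ker_factor (hp : Ep ≤ Ep') (hE : Ep ≤ Em.comap dp) (hδ : Ep ≤ Em.comap δp)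
    (h : ∀ x ∈ Ep', dp x = δp x) (y : LinearMap.ker (Submodule.factor hp)) :
    Ep.mapQ Em dp hE y = Ep.mapQ Em δp hδ y := by
  obtain ⟨y, hy⟩ := y
  obtain ⟨x, rfl⟩ := Ep.mkQ_surjective y
  have hx : x ∈ Ep' := (Submodule.Quotient.mk_eq_zero _).1 hy
  exact congrArg Em.mkQ (h x hx)

/-- Changing the acyclic subcomplex on which two complexes agree rescales both torsions by the
same factor. -/
theorem exists_smul_torsion (hp : Ep ≤ Ep') (hm : Em ≤ Em') (M : HodgeModel dp dm jp jm)
    (N : HodgeModel δp δm kp km) (hM : AcyclicSub dp dm Ep Em) (hM' : AcyclicSub dp dm Ep' Em')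
    (hN : AcyclicSub δp δm Ep Em) (hN' : AcyclicSub δp δm Ep' Em')
    (hdp : ∀ x ∈ Ep', dp x = δp x) (hdm : ∀ x ∈ Em', dm x = δm x)
    {Φ Φ' : DetLine F Hp ⊗[F] Dual F (DetLine F Hm) →ₗ[F] F}
    {Ψ Ψ' : DetLine F Kp ⊗[F] Dual F (DetLine F Km) →ₗ[F] F}
    (hΦ : IsTorsion (Ep.mapQ Em dp hM.map_p) (Em.mapQ Ep dm hM.map_m) (Ep.mkQ ∘ₗ jp)
      (Em.mkQ ∘ₗ jm) Φ)
    (hΦ' : IsTorsion (Ep'.mapQ Em' dp hM'.map_p) (Em'.mapQ Ep' dm hM'.map_m) (Ep'.mkQ ∘ₗ jp)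
      (Em'.mkQ ∘ₗ jm) Φ')
    (hΨ : IsTorsion (Ep.mapQ Em δp hN.map_p) (Em.mapQ Ep δm hN.map_m) (Ep.mkQ ∘ₗ kp)
      (Em.mkQ ∘ₗ km) Ψ)
    (hΨ' : IsTorsion (Ep'.mapQ Em' δp hN'.map_p) (Em'.mapQ Ep' δm hN'.map_m) (Ep'.mkQ ∘ₗ kp)
      (Em'.mkQ ∘ₗ km) Ψ') :
    ∃ a : F, a ≠ 0 ∧ Φ = a • Φ' ∧ Ψ = a • Ψ' := by
  obtain ⟨gp, hgp⟩ := exists_restrict_factor hp hm hM.map_p hM'.map_p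
  obtain ⟨gm, hgm⟩ := exists_restrict_factor hm hp hM.map_m hM'.map_m
  have sp := Submodule.factor_surjective hp
  have sm := Submodule.factor_surjective hm
  have cM : ∀ y, Ep'.mapQ Em' dp hM'.map_p (Submodule.factor hp y) =
      Submodule.factor hm (Ep.mapQ Em dp hM.map_p y) := by
    intro y
    obtain ⟨x, rfl⟩ := Ep.mkQ_surjective y
    rfl
  have cM' : ∀ y, Em'.mapQ Ep' dm hM'.map_m (Submodule.factor hm y) =
      Submodule.factor hp (Em.mapQ Ep dm hM.map_m y) := by
    intro y
    obtain ⟨x, rfl⟩ := Em.mkQ_surjective y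
    rfl
  have cN : ∀ y, Ep'.mapQ Em' δp hN'.map_p (Submodule.factor hp y) =
      Submodule.factor hm (Ep.mapQ Em δp hN.map_p y) := by
    intro y
    obtain ⟨x, rfl⟩ := Ep.mkQ_surjective y
    rfl
  have cN' : ∀ y, Em'.mapQ Ep' δm hN'.map_m (Submodule.factor hm y) =
      Submodule.factor hp (Em.mapQ Ep δm hN.map_m y) := by
    intro y
    obtain ⟨x, rfl⟩ := Em.mkQ_surjective y
    rfl
  have hgp' := fun y => (hgp y).trans (mapQ_eq_of_mem_ker_factor hp hM.map_p hN.map_p hdp y)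
  have hgm' := fun y => (hgm y).trans (mapQ_eq_of_mem_ker_factor hm hM.map_m hN.map_m hdm y)
  have KM := (M.descend hM).ker_model (M.descend hM') sm sp cM cM' hgp hgm
  -- A single frame of `E' / E` serves both complexes, since their differentials coincide there;
  -- this is why the two factors are equal.
  obtain ⟨ep, em, lp, lm, hep, hem, hlp0, hlm0, hlp, hlm⟩ := KM.exists_ker_frame sm sp
  have e1 := (M.descend hM).smul_torsion_eq (M.descend hM') sm sp cM cM' hgp hgm hep hem hlp hlm
    hΦ hΦ'
  have e2 := (N.descend hN).smul_torsion_eq (N.descend hN') sm sp cN cN' hgp' hgm' hep hem hlp hlm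
    hΨ hΨ'
  refine ⟨lm⁻¹ * lp, mul_ne_zero (inv_ne_zero hlm0) hlp0, ?_, ?_⟩
  · rw [mul_smul, ← e1, inv_smul_smul₀ hlm0]
  · rw [mul_smul, ← e2, inv_smul_smul₀ hlm0]

end Comparison

/-! ### Common reductions and independence of all choices. -/

namespace GradedComplex

variable {F : Type*} [Field F]
  {Xp : Type*} [AddCommGroup Xp] [Module F Xp] {Xm : Type*} [AddCommGroup Xm] [Module F Xm]
  {D Δ : GradedComplex F Xp Xm} {D' Δ' : GradedComplex F Xm Xp}

/-- The same complex with the roles of even and odd interchanged. -/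
def swap (D : GradedComplex F Xp Xm) : GradedComplex F Xm Xp :=
  ⟨D.dMinus, D.dPlus, D.plus_minus, D.minus_plus⟩

theorem IsDagger.swap (h : D.IsDagger D') : D.swap.IsDagger D'.swap :=
  ⟨⟨h.fredholm.2, h.fredholm.1⟩, h.minus, h.plus⟩

theorem IsFredholm.swap (h : D.IsFredholm) : D.swap.IsFredholm := ⟨h.2, h.1⟩

/-- The largest subspace of the even part of an adapted subspace inside `(Np, Nm)`. -/
def adaptedSub (D : GradedComplex F Xp Xm) (D' : GradedComplex F Xm Xp) (Np : Submodule F Xp)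
    (Nm : Submodule F Xm) : Submodule F Xp :=
  (Np ⊓ Nm.comap D.dPlus ⊓ Nm.comap D'.dMinus) ⊓
    (Np.comap (D'.dPlus ∘ₗ D.dPlus) ⊓ Np.comap (D.dMinus ∘ₗ D'.dMinus) ⊓
      LinearMap.ker (D'.dPlus ∘ₗ D.dPlus + D.dMinus ∘ₗ D'.dMinus - LinearMap.id))

theorem mem_adaptedSub {Np : Submodule F Xp} {Nm : Submodule F Xm} {x : Xp} :
    x ∈ D.adaptedSub D' Np Nm ↔ ((x ∈ Np ∧ D.dPlus x ∈ Nm) ∧ D'.dMinus x ∈ Nm) ∧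
      (D'.dPlus (D.dPlus x) ∈ Np ∧ D.dMinus (D'.dMinus x) ∈ Np) ∧
      D'.dPlus (D.dPlus x) + D.dMinus (D'.dMinus x) = x := by
  simp only [adaptedSub, Submodule.mem_inf, Submodule.mem_comap, LinearMap.comp_apply,
    LinearMap.mem_ker, LinearMap.sub_apply, LinearMap.add_apply, LinearMap.id_apply, sub_eq_zero]

/-- Because `d² = 0` and `d d^† d = d`, the conditions reproduce themselves after one step. So
finitely many of them give a stable subspace. -/
theorem IsDagger.dPlus_mem_adaptedSub (h : D.IsDagger D') {Np : Submodule F Xp}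
    {Nm : Submodule F Xm} {x : Xp} (hx : x ∈ D.adaptedSub D' Np Nm) :
    D.dPlus x ∈ D.swap.adaptedSub D'.swap Nm Np := by
  obtain ⟨⟨⟨h1, h2⟩, h3⟩, ⟨h4, h5⟩, h6⟩ := mem_adaptedSub.1 hx
  rw [mem_adaptedSub]
  simp only [GradedComplex.swap, minus_plus_apply, h.plus.apply_apply, map_zero, zero_mem, zero_add,
    h2, h4, and_self]

theorem IsDagger.dMinus_mem_adaptedSub (h : D.IsDagger D') {Np : Submodule F Xp}
    {Nm : Submodule F Xm} {x : Xp} (hx : x ∈ D.adaptedSub D' Np Nm) :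
    D'.dMinus x ∈ D.swap.adaptedSub D'.swap Nm Np := by
  obtain ⟨⟨⟨h1, h2⟩, h3⟩, ⟨h4, h5⟩, h6⟩ := mem_adaptedSub.1 hx
  rw [mem_adaptedSub]
  simp only [GradedComplex.swap, plus_minus_apply, h.minus.apply_apply', map_zero, zero_mem,
    add_zero, h3, h5, and_self]

theorem IsDagger.isAdapted (h : D.IsDagger D') (Np : Submodule F Xp) (Nm : Submodule F Xm) :
    D.IsAdapted D' (D.adaptedSub D' Np Nm) (D.swap.adaptedSub D'.swap Nm Np) where
  dPlus_mem := fun _ hx => h.dPlus_mem_adaptedSub hx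
  dMinus_mem := fun _ hx => h.swap.dPlus_mem_adaptedSub hx
  dPlus_mem' := fun _ hx => h.swap.dMinus_mem_adaptedSub hx
  dMinus_mem' := fun _ hx => h.dMinus_mem_adaptedSub hx
  hodge_p := fun _ hx => (mem_adaptedSub.1 hx).2.2
  hodge_m := fun _ hx => (mem_adaptedSub.1 hx).2.2

theorem IsDagger.cofg_adaptedSub (h : D.IsDagger D') (hD : D.IsFredholm) {Np : Submodule F Xp}
    {Nm : Submodule F Xm} (hp : Np.CoFG) (hm : Nm.CoFG) : (D.adaptedSub D' Np Nm).CoFG := by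
  refine ((hp.inf (cofg_comap hm _)).inf (cofg_comap hm _)).inf
    (((cofg_comap hp _).inf (cofg_comap hp _)).inf (FiniteRank.cofg_ker ?_))
  have := h.finiteDimensional_ker hD
  -- The defect `d₊^† d₊ + d₋ d₋^† - 1` takes values in `Ker σ₊`, which is finite dimensional
  -- because it is the homology.
  refine Submodule.finiteDimensional_of_le (S₂ := LinearMap.ker (D.sigmaPlus D')) ?_
  rintro _ ⟨x, rfl⟩
  rw [LinearMap.mem_ker, sigmaPlus_apply]
  simp [plus_minus_apply, minus_plus_apply, h.plus.apply_apply, h.minus.apply_apply']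

variable {Ep : Submodule F Xp} {Em : Submodule F Xm}

/-- A subspace of finite codimension on which all the choices for `D` and `Δ` agree. -/
structure PerturbationData.IsReduction (c : PerturbationData D Δ) (Ep : Submodule F Xp)
    (Em : Submodule F Xm) : Prop where
  finite_p : FiniteDimensional F (Xp ⧸ Ep)
  finite_m : FiniteDimensional F (Xm ⧸ Em)
  adapted_D : D.IsAdapted c.Ddag Ep Em
  adapted_Δ : Δ.IsAdapted c.Δdag Ep Em
  eq_p : ∀ x ∈ Ep, D.dPlus x = Δ.dPlus x
  eq_m : ∀ x ∈ Em, D.dMinus x = Δ.dMinus x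
  eq_m' : ∀ x ∈ Ep, c.Ddag.dMinus x = c.Δdag.dMinus x
  le_sigma : Ep ≤ LinearMap.range c.sigmaInv
  le_tau : Ep ≤ LinearMap.range c.tauInv

/-- The subspace is adapted to `D` inside the locus where all four maps agree with those of `Δ`, so
it is adapted to `Δ` as well. The bounds `Np`, `Nm` allow it to be placed inside an earlier
reduction. -/
theorem PerturbationData.exists_isReduction (c : PerturbationData D Δ) (hD : D.IsFredholm)
    (hΔ : Δ.IsFredholm) (h : D.IsFiniteRankPerturbation Δ) {Np : Submodule F Xp}
    {Nm : Submodule F Xm} (hp : Np.CoFG) (hm : Nm.CoFG) :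
    ∃ Ep ≤ Np, ∃ Em ≤ Nm, c.IsReduction Ep Em := by
  have := c.isDagger_D.finiteDimensional_ker hD
  have := c.isDagger_Δ.finiteDimensional_ker hΔ
  let Kp : Submodule F Xp := Np ⊓ LinearMap.ker (D.dPlus - Δ.dPlus) ⊓
    LinearMap.ker (c.Ddag.dMinus - c.Δdag.dMinus) ⊓ LinearMap.range c.sigmaInv ⊓
    LinearMap.range c.tauInv
  let Km : Submodule F Xm := Nm ⊓ LinearMap.ker (D.dMinus - Δ.dMinus) ⊓
    LinearMap.ker (c.Ddag.dPlus - c.Δdag.dPlus)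
  have hKp : Kp.CoFG := (((hp.inf h.1.cofg_ker).inf c.finiteRank.2.cofg_ker).inf
    c.isPseudoInverse_sigma.cofg_range).inf c.isPseudoInverse_tau.cofg_range
  have hKm : Km.CoFG := (hm.inf h.2.cofg_ker).inf c.finiteRank.1.cofg_ker
  have hle : D.adaptedSub c.Ddag Kp Km ≤ Kp := fun x hx => (mem_adaptedSub.1 hx).1.1.1
  have hle' : D.swap.adaptedSub c.Ddag.swap Km Kp ≤ Km := fun x hx => (mem_adaptedSub.1 hx).1.1.1
  have ad := c.isDagger_D.isAdapted Kp Km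
  have e1 : ∀ x ∈ D.adaptedSub c.Ddag Kp Km, D.dPlus x = Δ.dPlus x := fun x hx =>
    sub_eq_zero.1 (hle hx).1.1.1.2
  have e2 : ∀ x ∈ D.adaptedSub c.Ddag Kp Km, c.Ddag.dMinus x = c.Δdag.dMinus x := fun x hx =>
    sub_eq_zero.1 (hle hx).1.1.2
  have e3 : ∀ x ∈ D.swap.adaptedSub c.Ddag.swap Km Kp, D.dMinus x = Δ.dMinus x := fun x hx =>
    sub_eq_zero.1 (hle' hx).1.2
  have e4 : ∀ x ∈ D.swap.adaptedSub c.Ddag.swap Km Kp, c.Ddag.dPlus x = c.Δdag.dPlus x :=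
    fun x hx => sub_eq_zero.1 (hle' hx).2
  refine ⟨_, fun x hx => (hle hx).1.1.1.1, _, fun x hx => (hle' hx).1.1,
    c.isDagger_D.cofg_adaptedSub hD hKp hKm, c.isDagger_D.swap.cofg_adaptedSub hD.swap hKm hKp,
    ad, ⟨?_, ?_, ?_, ?_, ?_, ?_⟩, e1, e3, e2, fun x hx => (hle hx).1.2, fun x hx => (hle hx).2⟩
  · intro x hx
    rw [Submodule.mem_comap, ← e1 x hx]; exact ad.dPlus_mem hx
  · intro x hx
    rw [Submodule.mem_comap, ← e3 x hx]; exact ad.dMinus_mem hx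
  · intro x hx
    rw [Submodule.mem_comap, ← e4 x hx]; exact ad.dPlus_mem' hx
  · intro x hx
    rw [Submodule.mem_comap, ← e2 x hx]; exact ad.dMinus_mem' hx
  · intro x hx
    rw [← e1 x hx, ← e2 x hx, ← e4 _ (ad.dPlus_mem hx), ← e3 _ (ad.dMinus_mem' hx)]
    exact ad.hodge_p x hx
  · intro x hx
    rw [← e3 x hx, ← e4 x hx, ← e2 _ (ad.dMinus_mem hx), ← e1 _ (ad.dPlus_mem' hx)]
    exact ad.hodge_m x hx

/-- The sign by which the perturbation isomorphism differs from the quotient of torsions. -/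
noncomputable def homologySign (D Δ : GradedComplex F Xp Xm) : F :=
  (-1) ^ (((finrank F D.HPlus : ℤ) - finrank F D.HMinus).toNat *
    (finrank F D.HPlus + finrank F Δ.HPlus))

theorem PerturbationData.indexSign_eq (c : PerturbationData D Δ) :
    (indexSign (D.sigmaPlus c.Ddag) (Δ.sigmaPlus c.Δdag) : F) = homologySign D Δ := by
  rw [indexSign, homologySign, index, c.isDagger_D.finrank_ker, c.isDagger_D.finrank_coker,
    c.isDagger_Δ.finrank_ker]

/-- The characterization for `σ₊` and `τ₊` is carried to homology by `torsion_comp_lineMap`. The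
choices in `c` survive only through the subspaces `Ep`, `Em`. -/
theorem PerturbationData.IsReduction.isPerturbationIso_iff {c : PerturbationData D Δ}
    (hc : c.IsReduction Ep Em) (hD : D.IsFredholm) (hΔ : Δ.IsFredholm)
    [FiniteDimensional F (Xp ⧸ Ep)] [FiniteDimensional F (Xm ⧸ Em)]
    {jp : D.HPlus →ₗ[F] Xp} {jm : D.HMinus →ₗ[F] Xm} (hj : D.IsRepresentative jp jm)
    {kp : Δ.HPlus →ₗ[F] Xp} {km : Δ.HMinus →ₗ[F] Xm} (hk : Δ.IsRepresentative kp km)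
    {Φ : D.Line →ₗ[F] F} {Ψ : Δ.Line →ₗ[F] F}
    (hΦ : IsTorsion (Ep.mapQ Em D.dPlus hc.adapted_D.dPlus_mem)
      (Em.mapQ Ep D.dMinus hc.adapted_D.dMinus_mem) (Ep.mkQ ∘ₗ jp) (Em.mkQ ∘ₗ jm) Φ)
    (hΨ : IsTorsion (Ep.mapQ Em Δ.dPlus hc.adapted_Δ.dPlus_mem)
      (Em.mapQ Ep Δ.dMinus hc.adapted_Δ.dMinus_mem) (Ep.mkQ ∘ₗ kp) (Em.mkQ ∘ₗ km) Ψ)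
    (hΦb : Function.Injective Φ) (hΨb : Function.Injective Ψ) (P : D.Line →ₗ[F] Δ.Line) :
    c.IsPerturbationIso P ↔ Ψ ∘ₗ P = homologySign D Δ • Φ := by
  have := c.isDagger_D.finiteDimensional_ker hD
  have := c.isDagger_D.finiteDimensional_coker hD
  have := c.isDagger_Δ.finiteDimensional_ker hΔ
  have := c.isDagger_Δ.finiteDimensional_coker hΔ
  have rD := hc.adapted_D.restrictsTo c.isPseudoInverse_sigma hc.le_sigma
  have rΔ := hc.adapted_Δ.restrictsTo c.isPseudoInverse_tau hc.le_tau
  have jD := c.isDagger_D.mkQ_cokerRep hj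
  have jΔ := c.isDagger_Δ.mkQ_cokerRep hk
  obtain ⟨Φ₀, bΦ, tΦ⟩ := (rD.model jD).exists_isTorsion
  obtain ⟨Ψ₀, bΨ, tΨ⟩ := (rΔ.model jΔ).exists_isTorsion
  have eΦ := c.isDagger_D.torsion_comp_lineMap hD hj hc.adapted_D rD hΦ tΦ
  have eΨ := c.isDagger_Δ.torsion_comp_lineMap hΔ hk hc.adapted_Δ rΔ hΨ tΨ
  have key := c.triple.isPerturbationMap_iff c.isPseudoInverse_sigma c.isPseudoInverse_tau rD rΔ
    (fun x hx => by rw [sigmaPlus_apply, sigmaPlus_apply, hc.eq_p x hx, hc.eq_m' x hx]) jD jΔ tΦ tΨ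
    bΨ.1
  rw [c.indexSign_eq] at key
  -- Surjectivity follows from the torsions: `Φ` is injective and its composite with `lineMap` is
  -- bijective.
  have hsurj : Function.Surjective c.isDagger_D.lineMap := by
    intro x
    obtain ⟨y, hy⟩ := bΦ.2 (Φ x)
    exact ⟨y, hΦb (by rw [← hy, ← eΦ]; rfl)⟩
  constructor
  · rintro ⟨P₀, h1, h2⟩
    rw [key] at h1
    refine LinearMap.ext fun x => ?_
    obtain ⟨y, rfl⟩ := hsurj x
    have h3 := LinearMap.congr_fun h2 y
    have h4 := LinearMap.congr_fun h1 y
    rw [← eΦ, ← eΨ] at h4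
    simp only [LinearMap.comp_apply, LinearMap.smul_apply] at h3 h4 ⊢
    rw [h3, h4]
  · intro hP
    let e := LinearEquiv.ofBijective Ψ₀ bΨ
    have he : ∀ a, Ψ₀ (e.symm a) = a := e.apply_symm_apply
    refine ⟨e.symm.toLinearMap ∘ₗ (homologySign D Δ • Φ₀), (key _).2 ?_, ?_⟩
    · exact LinearMap.ext fun x => he _
    · refine LinearMap.ext fun y => hΨb ?_
      have h3 := LinearMap.congr_fun hP (c.isDagger_D.lineMap y)
      refine h3.trans ?_
      have h4 := LinearMap.congr_fun eΨ (e.symm (homologySign D Δ • Φ₀ y))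
      rw [he] at h4
      refine Eq.trans ?_ h4.symm
      rw [← eΦ]; rfl

theorem homologySign_ne_zero (D Δ : GradedComplex F Xp Xm) : homologySign D Δ ≠ 0 :=
  pow_ne_zero _ (neg_ne_zero.2 one_ne_zero)

/-- All choices give the same isomorphism. -/
theorem PerturbationData.exists_forall_isPerturbationIso_iff (c₀ : PerturbationData D Δ)
    (hD : D.IsFredholm) (hΔ : Δ.IsFredholm) (h : D.IsFiniteRankPerturbation Δ) :
    ∃ P : D.Line ≃ₗ[F] Δ.Line, ∀ (c : PerturbationData D Δ) (P' : D.Line →ₗ[F] Δ.Line),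
      c.IsPerturbationIso P' ↔ P' = P.toLinearMap := by
  have := hD.1
  have := hD.2
  have := hΔ.1
  have := hΔ.2
  obtain ⟨jp, jm, hj⟩ := D.exists_isRepresentative
  obtain ⟨kp, km, hk⟩ := Δ.exists_isRepresentative
  obtain ⟨Ep', -, Em', -, r₀⟩ := c₀.exists_isReduction hD hΔ h Submodule.CoFG.top
    Submodule.CoFG.top
  have := r₀.finite_p
  have := r₀.finite_m
  obtain ⟨Φ₀, bΦ, tΦ⟩ := (hj.model.descend r₀.adapted_D.acyclicSub).exists_isTorsion
  obtain ⟨Ψ₀, bΨ, tΨ⟩ := (hk.model.descend r₀.adapted_Δ.acyclicSub).exists_isTorsion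
  let eΦ := LinearEquiv.ofBijective Φ₀ bΦ
  let eΨ := LinearEquiv.ofBijective Ψ₀ bΨ
  -- The solution of `Ψ₀ ∘ P = ± Φ₀` for one fixed reduction.
  let P : D.Line ≃ₗ[F] Δ.Line := (eΦ.trans (LinearEquiv.smulOfNeZero F F _
    (homologySign_ne_zero D Δ))).trans eΨ.symm
  have hP : ∀ x, Ψ₀ (P x) = homologySign D Δ • Φ₀ x := fun x => eΨ.apply_symm_apply _
  refine ⟨P, fun c P' => ?_⟩
  -- The reduction for another choice is taken inside the fixed one, so that the two are nested and
  -- the torsions can be compared.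
  obtain ⟨Ep, hEp, Em, hEm, r⟩ := c.exists_isReduction hD hΔ h r₀.finite_p r₀.finite_m
  have := r.finite_p
  have := r.finite_m
  obtain ⟨Φ, bΦ', tΦ'⟩ := (hj.model.descend r.adapted_D.acyclicSub).exists_isTorsion
  obtain ⟨Ψ, bΨ', tΨ'⟩ := (hk.model.descend r.adapted_Δ.acyclicSub).exists_isTorsion
  rw [r.isPerturbationIso_iff hD hΔ hj hk tΦ' tΨ' bΦ'.1 bΨ'.1]
  obtain ⟨a, ha, rfl, rfl⟩ := exists_smul_torsion hEp hEm hj.model hk.model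
    r.adapted_D.acyclicSub r₀.adapted_D.acyclicSub r.adapted_Δ.acyclicSub
    r₀.adapted_Δ.acyclicSub r₀.eq_p r₀.eq_m tΦ' tΦ tΨ' tΨ
  constructor
  · intro h1
    refine LinearMap.ext fun x => bΨ.1 ?_
    have h2 := LinearMap.congr_fun h1 x
    simp only [LinearMap.comp_apply, LinearMap.smul_apply, smul_eq_mul] at h2
    refine Eq.trans ?_ (hP x).symm
    rw [smul_eq_mul]
    apply mul_left_cancel₀ ha
    rw [h2]; ring
  · rintro rfl
    refine LinearMap.ext fun x => ?_
    have h2 := hP x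
    simp only [LinearMap.comp_apply, LinearMap.smul_apply, smul_eq_mul, LinearEquiv.coe_coe] at h2 ⊢
    rw [h2]; ring

end GradedComplex

end PerturbationIso

namespace PerturbationIso

open ExteriorAlgebra Module

/-! ### Existence of pseudo-inverses; stability of the index. -/

section Existence

variable {F : Type*} [Field F]
  {V : Type*} [AddCommGroup V] [Module F V]
  {W : Type*} [AddCommGroup W] [Module F W]
  {U : Type*} [AddCommGroup U] [Module F U]

/-- A pseudo-inverse with prescribed image and kernel. -/
theorem exists_isPseudoInverse_of_isCompl {A : V →ₗ[F] W} {Y : Submodule F V} {Z : Submodule F W}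
    (hY : IsCompl Y (LinearMap.ker A)) (hZ : IsCompl (LinearMap.range A) Z) :
    ∃ A' : W →ₗ[F] V, IsPseudoInverse A A' ∧ (∀ y ∈ Y, A' (A y) = y) ∧ (∀ z ∈ Z, A' z = 0) ∧
      ∀ w, A' w ∈ Y := by
  obtain ⟨g, hg⟩ := exists_section A
  have hp : ∀ v, A (Y.projection _ hY v) = A v := fun v => by
    have := LinearMap.mem_ker.1 (Submodule.sub_projection_mem hY v)
    rw [map_sub, sub_eq_zero] at this
    exact this.symm
  have hq : ∀ v, (LinearMap.range A).projection Z hZ (A v) = A v := fun v =>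
    Submodule.projection_apply_left hZ ⟨A v, v, rfl⟩
  have hp' : ∀ y ∈ Y, Y.projection _ hY y = y := fun y hy =>
    Submodule.projection_apply_left hY ⟨y, hy⟩
  have hA' : ∀ v, Y.projection _ hY (g ((LinearMap.range A).projection Z hZ (A v))) =
      Y.projection _ hY v := fun v => by
    rw [hq, ← sub_eq_zero, ← map_sub, Submodule.projection_apply_eq_zero_iff, LinearMap.mem_ker,
      map_sub, hg, sub_self]
  refine ⟨Y.projection _ hY ∘ₗ g ∘ₗ (LinearMap.range A).projection Z hZ,
    IsPseudoInverse.of_apply_apply (fun v => ?_) (fun w => ?_), fun y hy => ?_, fun z hz => ?_,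
    fun w => Submodule.projection_apply_mem hY _⟩
  · simp only [LinearMap.comp_apply]
    rw [hA', hp]
  · simp only [LinearMap.comp_apply]
    rw [hA', hp' _ (Submodule.projection_apply_mem hY _)]
  · simp only [LinearMap.comp_apply]
    rw [hA', hp' y hy]
  · simp only [LinearMap.comp_apply]
    rw [(Submodule.projection_apply_eq_zero_iff hZ).2 hz, map_zero, map_zero]

theorem exists_isPseudoInverse (A : V →ₗ[F] W) : ∃ A' : W →ₗ[F] V, IsPseudoInverse A A' := by
  obtain ⟨Y, hY⟩ := Submodule.exists_isCompl (LinearMap.ker A)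
  obtain ⟨Z, hZ⟩ := Submodule.exists_isCompl (LinearMap.range A)
  obtain ⟨A', h, -⟩ := exists_isPseudoInverse_of_isCompl hY.symm hZ
  exact ⟨A', h⟩

theorem exists_fg_sup_eq_top {N : Submodule F V} (hN : N.CoFG) :
    ∃ G : Submodule F V, G.FG ∧ N ⊔ G = ⊤ := by
  obtain ⟨G, hG⟩ := Submodule.exists_isCompl N
  exact ⟨G, hN.fg_of_isCompl hG, hG.sup_eq_top⟩

theorem cofg_of_fg_sup_eq_top {N G : Submodule F V} (hG : G.FG) (h : N ⊔ G = ⊤) : N.CoFG := by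
  have := Module.Finite.iff_fg.2 hG
  refine Module.Finite.of_surjective (N.mkQ ∘ₗ G.subtype) fun x => ?_
  obtain ⟨x, rfl⟩ := N.mkQ_surjective x
  obtain ⟨n, hn, g, hg, rfl⟩ := Submodule.mem_sup.1 (h ▸ Submodule.mem_top : x ∈ N ⊔ G)
  refine ⟨⟨g, hg⟩, (Submodule.Quotient.eq _).2 ?_⟩
  simpa using hn

theorem cofg_map_of_finite_coker {A : V →ₗ[F] W} [FiniteDimensional F (Coker A)]
    {E : Submodule F V} (hE : E.CoFG) : (E.map A).CoFG := by
  obtain ⟨G, hG, hEG⟩ := exists_fg_sup_eq_top hE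
  obtain ⟨G', hG', hAG⟩ := exists_fg_sup_eq_top (N := LinearMap.range A) ‹_›
  refine cofg_of_fg_sup_eq_top ((hG.map A).sup hG') ?_
  rw [← sup_assoc, ← Submodule.map_sup, hEG, Submodule.map_top, hAG]

/-- The index is stable under perturbations of finite rank. -/
theorem index_eq_of_finiteRank {A B : V →ₗ[F] W} [FiniteDimensional F (LinearMap.ker A)]
    [FiniteDimensional F (LinearMap.ker B)] [FiniteDimensional F (Coker A)]
    [FiniteDimensional F (Coker B)] (h : FiniteRank (A - B)) : index A = index B := by
  obtain ⟨A', hA⟩ := exists_isPseudoInverse A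
  obtain ⟨B', hB⟩ := exists_isPseudoInverse B
  -- On this subspace `A = B`, and both pseudo-inverses undo the operators; its image has finite
  -- codimension since `Coker A` is finite dimensional.
  let E := LinearMap.ker (A - B) ⊓ LinearMap.range A' ⊓ LinearMap.range B'
  have hE : E.CoFG := (h.cofg_ker.inf hA.cofg_range).inf hB.cofg_range
  have hAB : ∀ e ∈ E, A e = B e := fun e he => sub_eq_zero.1 he.1.1
  have hR : (E.map A).CoFG := cofg_map_of_finite_coker hE
  have rA : RestrictsTo A A' E (E.map A) := by
    refine ⟨fun x hx => ⟨x, hx, rfl⟩, ?_, fun r hr => hr⟩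
    rintro e ⟨⟨-, w, rfl⟩, -⟩
    exact hA.apply_apply' w
  have rB : RestrictsTo B B' E (E.map A) := by
    refine ⟨fun x hx => ⟨x, hx, hAB x hx⟩, ?_, ?_⟩
    · rintro e ⟨-, w, rfl⟩
      exact hB.apply_apply' w
    · rintro _ ⟨e, he, rfl⟩
      exact ⟨e, he, (hAB e he).symm⟩
  rw [rA.index_eq, rB.index_eq]

/-! ### Existence of perturbation triples -/

theorem exists_surjective_of_finrank_le [FiniteDimensional F U] [FiniteDimensional F V]
    (h : finrank F V ≤ finrank F U) : ∃ f : U →ₗ[F] V, Function.Surjective f := by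
  let eU := (finBasis F U).equivFun
  let eV := (finBasis F V).equivFun
  refine ⟨eV.symm.toLinearMap ∘ₗ LinearMap.funLeft F F (Fin.castLE h) ∘ₗ eU.toLinearMap, ?_⟩
  exact eV.symm.surjective.comp ((LinearMap.funLeft_surjective_of_injective F F _
    (Fin.castLE_injective h)).comp eU.surjective)

theorem exists_injective_of_finrank_le [FiniteDimensional F U] [FiniteDimensional F V]
    (h : finrank F U ≤ finrank F V) : ∃ f : U →ₗ[F] V, Function.Injective f := by
  obtain ⟨g, hg⟩ := exists_surjective_of_finrank_le h
  obtain ⟨f, hf⟩ := g.exists_rightInverse_of_surjective (LinearMap.range_eq_top.2 hg)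
  exact ⟨f, Function.LeftInverse.injective (LinearMap.congr_fun hf)⟩

variable {R : Submodule F W} [FiniteDimensional F U] [FiniteDimensional F (W ⧸ R)]

/-- Lifting through an injective section does not enlarge or shrink the kernel, so dimension counts
for `f` carry over to `L`. -/
theorem exists_mkQ_comp_eq (f : V →ₗ[F] W ⧸ R) :
    ∃ L : V →ₗ[F] W, R.mkQ ∘ₗ L = f ∧ LinearMap.ker L = LinearMap.ker f := by
  obtain ⟨s, hs⟩ := R.mkQ.exists_rightInverse_of_surjective R.range_mkQ
  refine ⟨s ∘ₗ f, by rw [← LinearMap.comp_assoc, hs, LinearMap.id_comp], ?_⟩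
  rw [LinearMap.ker_comp, LinearMap.ker_eq_bot_of_inverse hs, LinearMap.ker]

theorem exists_injective_mkQ_comp (h : finrank F U ≤ finrank F (W ⧸ R)) :
    ∃ L : U →ₗ[F] W, Function.Injective (R.mkQ ∘ₗ L) := by
  obtain ⟨f, hf⟩ := exists_injective_of_finrank_le h
  obtain ⟨L, hL, -⟩ := exists_mkQ_comp_eq f
  exact ⟨L, hL ▸ hf⟩

theorem exists_surjective_mkQ_comp (h : finrank F (W ⧸ R) ≤ finrank F U) :
    ∃ L : U →ₗ[F] W, Function.Surjective (R.mkQ ∘ₗ L) ∧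
      finrank F (W ⧸ R) + finrank F (LinearMap.ker L) = finrank F U := by
  obtain ⟨f, hf⟩ := exists_surjective_of_finrank_le h
  obtain ⟨L, hL, hk⟩ := exists_mkQ_comp_eq f
  refine ⟨L, hL ▸ hf, ?_⟩
  rw [hk, ← LinearMap.finrank_range_add_finrank_ker f, LinearMap.range_eq_top.2 hf, finrank_top]

theorem finrank_quotient_sup_range {L : U →ₗ[F] W} (hL : Function.Injective (R.mkQ ∘ₗ L)) :
    finrank F (W ⧸ (R ⊔ LinearMap.range L)) + finrank F U = finrank F (W ⧸ R) := by
  rw [← (Submodule.quotientQuotientEquivQuotientSup R (LinearMap.range L)).finrank_eq,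
    ← LinearMap.finrank_range_of_inj hL, LinearMap.range_comp, Submodule.finrank_quotient_add_finrank]

/-- An isomorphism on `K` is extended by zero along a chosen complement, which becomes the kernel.
-/
theorem exists_bijective_on_subspace {K : Submodule F U} {S : Submodule F W}
    [FiniteDimensional F (W ⧸ S)] (h : finrank F K = finrank F (W ⧸ S)) :
    ∃ N : U →ₗ[F] W, Function.Bijective (S.mkQ ∘ₗ N ∘ₗ K.subtype) ∧ IsCompl K (LinearMap.ker N) := by
  obtain ⟨Q, hQ⟩ := Submodule.exists_isCompl K
  let e := LinearEquiv.ofFinrankEq K (W ⧸ S) h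
  obtain ⟨n, hn, hk⟩ := exists_mkQ_comp_eq e.toLinearMap
  have hk' : LinearMap.ker n = ⊥ := by rw [hk]; exact e.ker
  refine ⟨n ∘ₗ K.projectionOnto Q hQ, ?_, ?_⟩
  · rw [LinearMap.comp_assoc, Submodule.projectionOnto_comp_subtype, LinearMap.comp_id, hn]
    exact e.bijective
  · rw [LinearMap.ker_comp, hk']
    change IsCompl K (LinearMap.ker (K.projectionOnto Q hQ))
    rwa [Submodule.ker_projectionOnto]

/-- `Ker B'` and `Coker B'` have the dimensions of `Coker B` and `Ker B`. The sign of the index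
permits `L` and `M`; the equality of the indices makes source and target of `N` equidimensional. -/
theorem exists_perturbationTriple {A B : V →ₗ[F] W} {B' : W →ₗ[F] V} (hB : IsPseudoInverse B B')
    [FiniteDimensional F (LinearMap.ker A)] [FiniteDimensional F (LinearMap.ker B)]
    [FiniteDimensional F (Coker A)] [FiniteDimensional F (Coker B)] (h : index A = index B) :
    Nonempty (PerturbationTriple A B') := by
  have : FiniteDimensional F (LinearMap.ker B') := Module.Finite.equiv (kerEquivCoker hB).symm
  have : FiniteDimensional F (V ⧸ LinearMap.range B') := Module.Finite.equiv (cokerEquivKer hB).symm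
  have e1 := (kerEquivCoker hB).finrank_eq
  have e2 : finrank F (V ⧸ LinearMap.range B') = _ := (cokerEquivKer hB).finrank_eq
  simp only [index, Coker] at h e1
  rcases le_total (index A) 0 with hi | hi
  · have hi' := hi
    simp only [index, Coker] at hi'
    obtain ⟨L, hL⟩ := exists_injective_mkQ_comp (U := LinearMap.ker A) (R := LinearMap.range A)
      (by omega)
    obtain ⟨M, hM, hMk⟩ := exists_surjective_mkQ_comp (U := LinearMap.ker B')
      (R := LinearMap.range B') (by omega)
    have hd := finrank_quotient_sup_range hL
    have : FiniteDimensional F (W ⧸ (LinearMap.range A ⊔ LinearMap.range L)) :=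
      Submodule.CoFG.of_le le_sup_left ‹FiniteDimensional F (Coker A)›
    obtain ⟨N, hN, hNk⟩ := exists_bijective_on_subspace (K := LinearMap.ker M)
      (S := LinearMap.range A ⊔ LinearMap.range L) (by omega)
    exact ⟨.nonpos hi ⟨L, M, N, hL, hM, hN, hNk⟩⟩
  · have hi' := hi
    simp only [index, Coker] at hi'
    obtain ⟨L, hL, hLk⟩ := exists_surjective_mkQ_comp (U := LinearMap.ker A)
      (R := LinearMap.range A) (by omega)
    obtain ⟨M, hM⟩ := exists_injective_mkQ_comp (U := LinearMap.ker B') (R := LinearMap.range B')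
      (by omega)
    have hd := finrank_quotient_sup_range hM
    rw [sup_comm] at hd
    have : FiniteDimensional F (V ⧸ (LinearMap.range M ⊔ LinearMap.range B')) :=
      Submodule.CoFG.of_le le_sup_right ‹FiniteDimensional F (V ⧸ LinearMap.range B')›
    obtain ⟨N, hN, hNk⟩ := exists_bijective_on_subspace (K := LinearMap.ker L)
      (S := LinearMap.range M ⊔ LinearMap.range B') (by omega)
    exact ⟨.nonneg hi ⟨L, M, N, hL, hM, hN, hNk⟩⟩

end Existence

/-- For cycles `K`, boundaries `R`, representatives `P` and a complement `Y` of the cycles, this is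
the Hodge decomposition. It supplies the kernel `Y ⊔ P` for a pseudo-inverse. -/
theorem isCompl_sup_of_isCompl {α : Type*} [Lattice α] [BoundedOrder α] [IsModularLattice α]
    {Y K P R : α} (h : IsCompl Y K) (hPR : Disjoint P R) (hK : P ⊔ R = K) : IsCompl R (Y ⊔ P) where
  disjoint := by
    subst hK
    exact (Disjoint.disjoint_sup_left_of_disjoint_sup_right hPR h.disjoint).symm
  codisjoint := by
    subst hK
    rw [codisjoint_iff, sup_comm, sup_assoc, h.sup_eq_top]

/-! ### Existence of pseudo-inverse complexes and of all the choices. -/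

namespace GradedComplex

variable {F : Type*} [Field F]
  {Xp : Type*} [AddCommGroup Xp] [Module F Xp] {Xm : Type*} [AddCommGroup Xm] [Module F Xm]
  {D Δ : GradedComplex F Xp Xm} {D' Δ' : GradedComplex F Xm Xp}

/-- The class of `x - d₋^† d₋ x` maps `Ker d₊^†` to `H₋(D)`. If that vector is `d₊ v`, applying
`d₊^†` gives `d₊ v = 0`, so `x` lies in the image of `d₋^†`. -/
theorem finiteDimensional_hPlus_of_isPseudoInverse (hD : D.IsFredholm)
    (hp : IsPseudoInverse D.dPlus D'.dPlus) (hm : IsPseudoInverse D.dMinus D'.dMinus) :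
    FiniteDimensional F D'.HPlus := by
  have := hD.2
  let f : LinearMap.ker D'.dPlus →ₗ[F] D.HMinus := Submodule.mkQ _ ∘ₗ
    (kerProj D.dMinus D'.dMinus hm ∘ₗ (LinearMap.ker D'.dPlus).subtype)
  refine Submodule.CoFG.of_le (S := LinearMap.ker f) ?_ (Submodule.CoFG.ker f)
  rintro ⟨x, hx⟩ h0
  obtain ⟨v, hv⟩ : x - D'.dMinus (D.dMinus x) ∈ LinearMap.range D.dPlus :=
    (Submodule.Quotient.mk_eq_zero
      ((LinearMap.range D.dPlus).submoduleOf (LinearMap.ker D.dMinus))).1 h0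
  have h1 := congrArg D'.dPlus hv
  rw [map_sub, LinearMap.mem_ker.1 hx, D'.plus_minus_apply, sub_zero] at h1
  rw [← hp.apply_apply, h1, map_zero] at hv
  exact ⟨D.dMinus x, (sub_eq_zero.1 hv.symm).symm⟩

/-- Pseudo-inverses of a complex exist and can be prescribed on subspaces meeting the cycles
trivially. -/
theorem exists_isDagger (hD : D.IsFredholm) {Yp : Submodule F Xp} {Ym : Submodule F Xm}
    (hYp : Disjoint Yp (LinearMap.ker D.dPlus)) (hYm : Disjoint Ym (LinearMap.ker D.dMinus)) :
    ∃ D' : GradedComplex F Xm Xp, D.IsDagger D' ∧ (∀ y ∈ Yp, D'.dPlus (D.dPlus y) = y) ∧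
      (∀ y ∈ Ym, D'.dMinus (D.dMinus y) = y) ∧ (∀ y ∈ Yp, D'.dMinus y = 0) ∧
      ∀ y ∈ Ym, D'.dPlus y = 0 := by
  obtain ⟨jp, jm, hj⟩ := D.exists_isRepresentative
  obtain ⟨Zp, hZp, cp⟩ := hYp.exists_isCompl
  obtain ⟨Zm, hZm, cm⟩ := hYm.exists_isCompl
  -- Each pseudo-inverse has its image in the chosen complement of the cycles, and the other one
  -- vanishes there; hence they form a complex.
  obtain ⟨ep, p1, p2, p3, p4⟩ := exists_isPseudoInverse_of_isCompl cp
    (isCompl_sup_of_isCompl cm hj.model.disj_m hj.model.sup_m)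
  obtain ⟨em, m1, m2, m3, m4⟩ := exists_isPseudoInverse_of_isCompl cm
    (isCompl_sup_of_isCompl cp hj.model.disj_p hj.model.sup_p)
  let D' : GradedComplex F Xm Xp := ⟨ep, em,
    LinearMap.ext fun x => m3 _ (Submodule.mem_sup_left (p4 x)),
    LinearMap.ext fun x => p3 _ (Submodule.mem_sup_left (m4 x))⟩
  refine ⟨D', ⟨⟨finiteDimensional_hPlus_of_isPseudoInverse (D' := D') hD p1 m1,
    finiteDimensional_hPlus_of_isPseudoInverse (D' := D'.swap) hD.swap m1 p1⟩, p1, m1⟩,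
    fun y hy => p2 y (hZp hy), fun y hy => m2 y (hZm hy),
    fun y hy => m3 y (Submodule.mem_sup_left (hZp hy)),
    fun y hy => p3 y (Submodule.mem_sup_left (hZm hy))⟩

/-- Up to finite dimensions, `d₊ Yp` is all of `range d₊`, hence all cycles of `d₋` as the homology
is finite dimensional; and `Ym` supplies the rest of `Km`. -/
theorem cofg_sup_map (hD : D.IsFredholm) {Kp Yp : Submodule F Xp} {Km Ym : Submodule F Xm}
    (hKp : Kp.CoFG) (hKm : Km.CoFG) (hYp : LinearMap.ker D.dPlus ⊓ Kp ⊔ Yp = Kp)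
    (hYm : LinearMap.ker D.dMinus ⊓ Km ⊔ Ym = Km) : (Ym ⊔ Yp.map D.dPlus).CoFG := by
  have := hD.2
  obtain ⟨jp, jm, hj⟩ := D.exists_isRepresentative
  obtain ⟨Gp, hGp, hGp'⟩ := exists_fg_sup_eq_top hKp
  obtain ⟨Gm, hGm, hGm'⟩ := exists_fg_sup_eq_top hKm
  have hH : (LinearMap.range jm).FG := Module.Finite.iff_fg.1 inferInstance
  refine cofg_of_fg_sup_eq_top (((hGp.map D.dPlus).sup hH).sup hGm) ?_
  have h1 : Kp.map D.dPlus ≤ Yp.map D.dPlus := by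
    rw [← hYp, Submodule.map_sup]
    refine sup_le ?_ le_rfl
    rintro _ ⟨x, hx, rfl⟩
    rw [LinearMap.mem_ker.1 hx.1]
    exact zero_mem _
  have h2 : LinearMap.range D.dPlus ≤ Yp.map D.dPlus ⊔ Gp.map D.dPlus := by
    rw [← Submodule.map_top, ← hGp', Submodule.map_sup]
    exact sup_le_sup_right h1 _
  have h3 : LinearMap.ker D.dMinus ≤ LinearMap.range jm ⊔ (Yp.map D.dPlus ⊔ Gp.map D.dPlus) := by
    exact hj.model.sup_m.ge.trans (sup_le_sup_left h2 _)
  have h4 : Km ≤ (LinearMap.range jm ⊔ (Yp.map D.dPlus ⊔ Gp.map D.dPlus)) ⊔ Ym := by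
    rw [← hYm]
    exact sup_le_sup_right (inf_le_left.trans h3) _
  rw [eq_top_iff, ← hGm']
  refine (sup_le_sup_right h4 Gm).trans (le_of_eq ?_)
  ac_rfl

/-- `Y` complements the common cycles inside the locus `d = δ`. Since the maps agree on it, it meets
neither kernel. -/
theorem exists_compl_in {V W : Type*} [AddCommGroup V] [Module F V] [AddCommGroup W] [Module F W]
    (d δ : V →ₗ[F] W) : ∃ Y : Submodule F V,
      LinearMap.ker d ⊓ LinearMap.ker (d - δ) ⊔ Y = LinearMap.ker (d - δ) ∧
      Disjoint Y (LinearMap.ker d) ∧ Disjoint Y (LinearMap.ker δ) ∧ ∀ y ∈ Y, d y = δ y := by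
  obtain ⟨Q, hQ⟩ := Submodule.exists_isCompl (LinearMap.ker d ⊓ LinearMap.ker (d - δ))
  have h0 : ∀ y ∈ Q ⊓ LinearMap.ker (d - δ), d y = δ y := fun y hy => sub_eq_zero.1 hy.2
  have h1 : Disjoint (Q ⊓ LinearMap.ker (d - δ)) (LinearMap.ker d) := by
    rw [Submodule.disjoint_def]
    exact fun x hx hd => Submodule.disjoint_def.1 hQ.disjoint x ⟨hd, hx.2⟩ hx.1
  refine ⟨Q ⊓ LinearMap.ker (d - δ), ?_, h1, ?_, h0⟩
  · rw [← sup_inf_assoc_of_le _ inf_le_right, hQ.sup_eq_top, top_inf_eq]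
  · rw [Submodule.disjoint_def] at h1 ⊢
    exact fun x hx hd => h1 x hx (by rw [LinearMap.mem_ker, h0 x hx]; exact hd)

theorem exists_perturbationData (hD : D.IsFredholm) (hΔ : Δ.IsFredholm)
    (h : D.IsFiniteRankPerturbation Δ) : Nonempty (PerturbationData D Δ) := by
  obtain ⟨Yp, p1, p2, p3, p4⟩ := exists_compl_in D.dPlus Δ.dPlus
  obtain ⟨Ym, m1, m2, m3, m4⟩ := exists_compl_in D.dMinus Δ.dMinus
  obtain ⟨D', hD', a1, a2, a3, a4⟩ := exists_isDagger hD p2 m2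
  obtain ⟨Δ', hΔ', b1, b2, b3, b4⟩ := exists_isDagger hΔ p3 m3
  -- On `Ym ⊔ d₊ Yp` both versions of `d₊^†` are prescribed: zero on `Ym`, and inverse to `d₊ = δ₊`
  -- on the image of `Yp`. By `cofg_sup_map` this subspace has finite codimension; the other degree
  -- is symmetric.
  have fr : D'.IsFiniteRankPerturbation Δ' := by
    constructor
    · refine FiniteRank.of_cofg_ker (Submodule.CoFG.of_le ?_
        (cofg_sup_map hD h.1.cofg_ker h.2.cofg_ker p1 m1))
      refine sup_le (fun y hy => ?_) ?_
      · rw [LinearMap.mem_ker, LinearMap.sub_apply, a4 y hy, b4 y hy, sub_zero]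
      · rintro _ ⟨y, hy, rfl⟩
        rw [LinearMap.mem_ker, LinearMap.sub_apply, a1 y hy, p4 y hy, b1 y hy, sub_self]
    · refine FiniteRank.of_cofg_ker (Submodule.CoFG.of_le ?_
        (cofg_sup_map hD.swap h.2.cofg_ker h.1.cofg_ker m1 p1))
      refine sup_le (fun y hy => ?_) ?_
      · rw [LinearMap.mem_ker, LinearMap.sub_apply, a3 y hy, b3 y hy, sub_zero]
      · rintro _ ⟨y, hy, rfl⟩
        change D.dMinus y ∈ _
        rw [LinearMap.mem_ker, LinearMap.sub_apply, a2 y hy, m4 y hy, b2 y hy, sub_self]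
  have := hD'.finiteDimensional_ker hD
  have := hD'.finiteDimensional_coker hD
  have := hΔ'.finiteDimensional_ker hΔ
  have := hΔ'.finiteDimensional_coker hΔ
  obtain ⟨S, hS⟩ := exists_isPseudoInverse (D.sigmaPlus D')
  obtain ⟨T, hT⟩ := exists_isPseudoInverse (Δ.sigmaPlus Δ')
  have hfr : FiniteRank (D.sigmaPlus D' - Δ.sigmaPlus Δ') := by
    refine FiniteRank.of_cofg_ker (Submodule.CoFG.of_le ?_ (h.1.cofg_ker.inf fr.2.cofg_ker))
    rintro x ⟨h1, h2⟩
    have h1' : D.dPlus x = Δ.dPlus x := sub_eq_zero.1 h1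
    have h2' : D'.dMinus x = Δ'.dMinus x := sub_eq_zero.1 h2
    rw [LinearMap.mem_ker, LinearMap.sub_apply, sigmaPlus_apply, sigmaPlus_apply, h1', h2', sub_self]
  obtain ⟨t⟩ := exists_perturbationTriple hT (index_eq_of_finiteRank hfr)
  exact ⟨⟨D', Δ', hD', hΔ', fr, S, T, hS, hT, t⟩⟩

end GradedComplex

end PerturbationIso

/-- Choices exist, and there is one isomorphism `|D| → |Δ|` which is, for every choice, the one and
only map given by the construction from that choice. -/
theorem theorem3p7 {F : Type*} [Field F]
    {Xp : Type*} [AddCommGroup Xp] [Module F Xp] {Xm : Type*} [AddCommGroup Xm] [Module F Xm]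
    (D Δ : PerturbationIso.GradedComplex F Xp Xm)
    (hD : D.IsFredholm) (hΔ : Δ.IsFredholm) (h : D.IsFiniteRankPerturbation Δ) :
    Nonempty (PerturbationIso.GradedComplex.PerturbationData D Δ) ∧
    ∃ P : D.Line ≃ₗ[F] Δ.Line,
      ∀ (c : PerturbationIso.GradedComplex.PerturbationData D Δ) (P' : D.Line →ₗ[F] Δ.Line),
        c.IsPerturbationIso P' ↔ P' = P.toLinearMap := by
  obtain ⟨c⟩ := PerturbationIso.GradedComplex.exists_perturbationData hD hΔ h
  exact ⟨⟨c⟩, c.exists_forall_isPerturbationIso_iff hD hΔ h⟩
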